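/- Let $k\ge 2$ be an integer, let $\tau$ range over the upper half-plane $\mathbb H$, put $q=e^{2\pi i\tau}$ and $q^a=e^{2\pi i a\tau}$, and write $D=q\frac{d}{dq}=\frac1{2\pi i}\frac{d}{d\tau}$. Let $(a)_\infty=\prod_{n\ge0}(1-aq^n)$, $\eta(\tau)=q^{1/24}\prod_{n\ge1}(1-q^n)$ and $\mathfrak f_1(\tau)=\eta(2\tau)/\eta(\tau)$. For $1\le j\le k$ let $$\mathrm{ch}_{k,j}=q^{\frac{(j-1)^2}{4k}}\frac{(-q)_\infty}{(q)_\infty}\sum_{n\in\mathbb Z}(-1)^nq^{kn^2+(j-1)n},$$ $$B_{k,j}=q^{\frac{6j^2-12j-k+6}{24k}}\prod_{m\ge1}\frac{(1-q^{2km})(1-q^{2km-k-j+1})(1-q^{2km-k+j-1})}{1-q^m}.$$ For $\ell\ge1$, with $\beta_{2\ell}$ the Bernoulli numbers, let $$E_{2\ell}=\frac{\beta_{2\ell}}{4\ell}-\sum_{n\ge1}\frac{n^{2\ell-1}q^n}{1-q^n},\qquad E_{2\ell,1}=\frac{\beta_{2\ell}}{4\ell}+\sum_{n\ge1}\frac{n^{2\ell-1}q^n}{1+q^n}.$$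 A fundamental system of solutions of a linear differential equation means a basis of the complex vector space of its holomorphic solutions on $\mathbb H$. A quasi-modular form of weight $w$ for $\Gamma_0(2)$ is a function $f$ on $\mathbb H$ for which there are $p\ge0$ and holomorphic functions $g_0,\dots,g_p$ on $\mathbb H$ of moderate growth, i.e. $g_i(\tau)=O\big((\operatorname{Im}\tau+1/\operatorname{Im}\tau)^N\big)$ for some $N$, such that $(c\tau+d)^{-w}f\big(\frac{a\tau+b}{c\tau+d}\big)=\sum_{i=0}^p g_i(\tau)\big(\frac{c}{c\tau+d}\big)^i$ for all $\begin{pmatrix}a&b\\c&d\end{pmatrix}\in\Gamma_0(2)$. Then there are $F_0,\dots,F_{k-1}\in\mathbb Q[E_{2\ell},E_{2\ell,1}:\ell\ge1]$ with $F_{k-1}=-\{2k(k-1)E_2+(1-k)E_{2,1}\}$ such that $\mathrm{ch}_{k,1},\dots,\mathrm{ch}_{k,k}$ form a fundamental system of solutions of $$D^ky+F_{k-1}D^{k-1}y+\cdots+F_0y=0,\qquad(1)$$ and the substitution $\tilde y=y/\mathfrak f_1$ turns (1) into a monic equation $$D^k\tilde y+P_{k-1}D^{k-1}\tilde y+\cdots+P_0\tilde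 y=0,\qquad(2)$$ that is, the left side of (2) equals the left side of (1) divided by $\mathfrak f_1$ for every holomorphic $y$ on $\mathbb H$. Here $P_{k-1}=-\{2k(k-1)E_2+(1-2k)E_{2,1}\}$, each $P_n$ with $0\le n<k$ is a quasi-modular form for $\Gamma_0(2)$, of weight $2(k-n)$, and $B_{k,1},\dots,B_{k,k}$ form a fundamental system of solutions of (2). -/

import Mathlib

open UpperHalfPlane
open scoped Manifold MatrixGroups ModularForm

noncomputable section

namespace AndrewsBressoud

/-- The nome `q = exp (2 π i τ)`. -/
def nome (τ : ℍ) : ℂ := Complex.exp (2 * Real.pi * Complex.I * τ)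

/-- The fractional power `q ^ a = exp (2 π i a τ)`. -/
def nomePow (a : ℚ) (τ : ℍ) : ℂ := Complex.exp (2 * Real.pi * Complex.I * a * τ)

/-- The infinite `q`-Pochhammer symbol `(a)_∞ = ∏_{n ≥ 0} (1 - a q ^ n)`. -/
def qPochInf (a q : ℂ) : ℂ := ∏' n : ℕ, (1 - a * q ^ n)

/-- The exponent `a_{k,j} = (6 j ^ 2 - 12 j - k + 6) / (24 k)`. -/
def leadingExponent (k j : ℕ) : ℚ := (6 * (j : ℚ) ^ 2 - 12 * j - k + 6) / (24 * k)

/-- The Andrews-Bressoud series `B_{k,j}`, in product form, as a function on the upper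
half-plane. The index `m` of the product is shifted so that it starts at `0`. -/
def andrewsBressoud (k j : ℕ) (τ : ℍ) : ℂ :=
  nomePow (leadingExponent k j) τ * ∏' n : ℕ,
    let m : ℤ := n + 1
    (1 - nome τ ^ (2 * k * m)) * (1 - nome τ ^ (2 * k * m - k - j + 1)) *
      (1 - nome τ ^ (2 * k * m - k + j - 1)) / (1 - nome τ ^ m)

/-- The Ramond sector characters
`ch_{k,j} = q ^ ((j-1)^2 / 4k) (-q)_∞ / (q)_∞ ∑_{n ∈ ℤ} (-1)^n q ^ (k n^2 + (j-1) n)`. -/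
def character (k j : ℕ) (τ : ℍ) : ℂ :=
  nomePow (((j : ℚ) - 1) ^ 2 / (4 * k)) τ *
    (qPochInf (-nome τ) (nome τ) / qPochInf (nome τ) (nome τ)) *
    ∑' n : ℤ, (-1 : ℂ) ^ n * nome τ ^ (k * n ^ 2 + ((j : ℤ) - 1) * n)

/-- The Weber function `𝔣₁(τ) = η(2τ) / η(τ)`. -/
def weberF1 (τ : ℍ) : ℂ := ModularForm.eta (2 * (τ : ℂ)) / ModularForm.eta (τ : ℂ)

/-- `eisE l` is `E_{2l} = B_{2l} / (4 l) - ∑_{n ≥ 1} n ^ (2l-1) q ^ n / (1 - q ^ n)`. -/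
def eisE (l : ℕ) (τ : ℍ) : ℂ :=
  (bernoulli (2 * l) : ℂ) / (4 * l) -
    ∑' n : ℕ, ((n : ℂ) + 1) ^ (2 * l - 1) * nome τ ^ (n + 1) / (1 - nome τ ^ (n + 1))

/-- `eisE1 l` is `E_{2l,1} = B_{2l} / (4 l) + ∑_{n ≥ 1} n ^ (2l-1) q ^ n / (1 + q ^ n)`. -/
def eisE1 (l : ℕ) (τ : ℍ) : ℂ :=
  (bernoulli (2 * l) : ℂ) / (4 * l) +
    ∑' n : ℕ, ((n : ℂ) + 1) ^ (2 * l - 1) * nome τ ^ (n + 1) / (1 + nome τ ^ (n + 1))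

/-- The ring `ℚ[E_{2l}, E_{2l,1} : l ≥ 1]` of functions on the upper half-plane. -/
def eisRing : Subalgebra ℚ (ℍ → ℂ) :=
  Algebra.adjoin ℚ {f | ∃ l : ℕ, 1 ≤ l ∧ (f = eisE l ∨ f = eisE1 l)}

/-- The derivation `q d/dq = (2 π i)⁻¹ d/dτ`. -/
abbrev qD (y : ℍ → ℂ) : ℍ → ℂ := Derivative.normalizedDerivOfComplex y

/-- The monic differential operator
`y ↦ (q d/dq) ^ k y + ∑_{n < k} P_n (q d/dq) ^ n y` of order `k`.
Only the values `P n` with `n < k` matter. -/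
def monicOp (k : ℕ) (P : ℕ → ℍ → ℂ) (y : ℍ → ℂ) : ℍ → ℂ :=
  qD^[k] y + ∑ n ∈ Finset.range k, P n * qD^[n] y

/-- The functions `b 0, …, b (k-1)` form a fundamental system of solutions of the equation
`monicOp k P y = 0`: they are a basis of the complex vector space of its holomorphic solutions
on the upper half-plane. -/
def IsFundamentalSystem (k : ℕ) (P : ℕ → ℍ → ℂ) (b : Fin k → ℍ → ℂ) : Prop :=
  LinearIndependent ℂ b ∧
    ∀ y : ℍ → ℂ, y ∈ Submodule.span ℂ (Set.range b) ↔
      MDifferentiable 𝓘(ℂ) 𝓘(ℂ) y ∧ monicOp k P y = 0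

/-- Moderate growth on the upper half-plane, that is, at all cusps. -/
def ModerateGrowth (f : ℍ → ℂ) : Prop :=
  ∃ (C : ℝ) (N : ℕ), ∀ τ : ℍ, ‖f τ‖ ≤ C * (τ.im + 1 / τ.im) ^ N

/-- `f` is a quasi-modular form of weight `w` for `Γ`: there are a depth bound `p` and
holomorphic functions `g 0, …, g p` of moderate growth such that
`(c τ + d) ^ (-w) f(γ τ) = ∑_{i ≤ p} g_i(τ) (c / (c τ + d)) ^ i`
for all `γ = (a b; c d)` in `Γ`. (At `γ = 1` this says that `f = g 0`.) -/
def IsQuasiModularForm (Γ : Subgroup SL(2, ℤ)) (w : ℤ) (f : ℍ → ℂ) : Prop :=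
  ∃ (p : ℕ) (g : ℕ → ℍ → ℂ),
    (∀ i ≤ p, MDifferentiable 𝓘(ℂ) 𝓘(ℂ) (g i) ∧ ModerateGrowth (g i)) ∧
    ∀ γ ∈ Γ, ∀ τ : ℍ, (f ∣[w] γ) τ =
      ∑ i ∈ Finset.range (p + 1), g i τ * ((γ 1 0 : ℂ) / denom γ τ) ^ i

end AndrewsBressoud

end

/-!
Write `D = q d/dq` and `Θ_s(τ) = ∑_n (-1)^n q^(k (n + s/2k)^2)`. By the Jacobi triple product
identity (`tripleProduct`), `B_{k,s+1} = Θ_s / η` and `ch_{k,s+1} = 𝔣₁ Θ_s / η`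
(`andrewsBressoud_eq`, `character_eq`). So everything follows from one monic operator of order `k`
that annihilates `Θ_0, …, Θ_{k-1}`: conjugating it by `η`, respectively by `η / 𝔣₁`, gives the
equations for the `B_{k,j}` and for the characters (`mul_monicOp_conjCoeff`), and the substitution
`y ↦ y / 𝔣₁` intertwines the two conjugates. As `D η = E_2 η` and `D 𝔣₁ = E_{2,1} 𝔣₁`, the
coefficients of the conjugates are differential polynomials in Eisenstein series and in the
coefficients of the original operator.

The operator comes from a residue. Let `θ(z; τ) = ∑_n (-1)^n q^((n+1/2)^2/2) e^((n+1/2) z)` be the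
odd Jacobi theta function and `f_s(z; τ) = ∑_n (-1)^n q^(k (n+s/2k)^2) e^((2 k n + s) z)`. The
function `f_s(z; τ) θ(2 z; 2 τ) / θ(z; τ)^(2k+2)` has the periods `2 π i` and `2 π i τ` and no pole
but the origin, of order `2 k + 1`; hence its residue there is zero
(`sum_thetaMoment_mul_kernelSeries`). The Taylor coefficients of `f_s` are moments of the theta
series; the even ones are the derivatives `D^m Θ_s` by the heat equation. The Taylor coefficients of
the remaining factor do not depend on `s`, and those of odd order vanish. So the residue relation is
a linear differential equation of order `k` satisfied by every `Θ_s`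
(`monicOp_thetaOpCoeff_eq_zero`).

Its coefficients are isobaric polynomials in the `E_{2l}` and `E_{2l,1}`. The logarithmic derivative
of the product for `θ` shows that the Taylor coefficients of `z θ' / θ` are multiples of the `E_{2l}`
(`X_mul_derivative_taylorSeries_oddTheta`), so those of `θ(z) / (z θ'(0))` are isobaric polynomials in
the `E_{2l}` (`isIsobaric_oddThetaCoeff`); passing to `2 τ` brings in
`E_{2l,1}(τ) = 2 E_{2l}(2 τ) - E_{2l}(τ)`. The heat equation for `θ` expresses the derivatives of the
Eisenstein series in the same way (`IsIsobaric.qD`). Isobaric polynomials of weight `w` are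
quasi-modular of weight `w`, because the `E_{2l}` are and the passage to `2 τ` lowers the level to
`Γ₀(2)` (`IsIsobaric.hasQuasiModularPolynomial`).

Finally, a solution of a monic equation of order `k` with holomorphic coefficients is determined by
its first `k` derivatives at a point, so `k` linearly independent solutions form a basis
(`isFundamentalSystem_of_linearIndependent`). The `Θ_s` with `0 ≤ s < k` are linearly independent
because their leading exponents `s^2 / 4k` at the cusp are distinct (`linearIndependent_theta`).
-/

noncomputable section

namespace AndrewsBressoud

open Derivative

/-! ### Linear differential operators on the upper half-plane -/

lemma mdifferentiable_zero : MDifferentiable 𝓘(ℂ) 𝓘(ℂ) (0 : ℍ → ℂ) :=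
  mdifferentiable_const

lemma mdifferentiable_one : MDifferentiable 𝓘(ℂ) 𝓘(ℂ) (1 : ℍ → ℂ) :=
  mdifferentiable_const

lemma mdifferentiable_qD {y : ℍ → ℂ} (hy : MDifferentiable 𝓘(ℂ) 𝓘(ℂ) y) :
    MDifferentiable 𝓘(ℂ) 𝓘(ℂ) (qD y) :=
  normalizedDerivOfComplex_mdifferentiable hy

lemma qD_zero : qD 0 = 0 := normalizedDerivOfComplex_const 0

lemma qD_one : qD 1 = 0 := normalizedDerivOfComplex_const 1

lemma qD_add {f g : ℍ → ℂ} (hf : MDifferentiable 𝓘(ℂ) 𝓘(ℂ) f)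
    (hg : MDifferentiable 𝓘(ℂ) 𝓘(ℂ) g) : qD (f + g) = qD f + qD g :=
  normalizedDerivOfComplex_add f g hf hg

lemma qD_mul {f g : ℍ → ℂ} (hf : MDifferentiable 𝓘(ℂ) 𝓘(ℂ) f)
    (hg : MDifferentiable 𝓘(ℂ) 𝓘(ℂ) g) : qD (f * g) = qD f * g + f * qD g :=
  normalizedDerivOfComplex_mul f g hf hg

lemma qD_smul (c : ℂ) {f : ℍ → ℂ} (hf : MDifferentiable 𝓘(ℂ) 𝓘(ℂ) f) : qD (c • f) = c • qD f :=
  normalizedDerivOfComplex_smul c f hf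

lemma mdifferentiable_iterate_qD {y : ℍ → ℂ} (hy : MDifferentiable 𝓘(ℂ) 𝓘(ℂ) y) (n : ℕ) :
    MDifferentiable 𝓘(ℂ) 𝓘(ℂ) (qD^[n] y) := by
  induction n with
  | zero => exact hy
  | succ n ih =>
    rw [Function.iterate_succ_apply']
    exact mdifferentiable_qD ih

lemma iterate_qD_add {f g : ℍ → ℂ} (hf : MDifferentiable 𝓘(ℂ) 𝓘(ℂ) f)
    (hg : MDifferentiable 𝓘(ℂ) 𝓘(ℂ) g) (n : ℕ) : qD^[n] (f + g) = qD^[n] f + qD^[n] g := by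
  induction n with
  | zero => rfl
  | succ n ih =>
    rw [Function.iterate_succ_apply', ih, qD_add
      (mdifferentiable_iterate_qD hf n) (mdifferentiable_iterate_qD hg n),
      Function.iterate_succ_apply', Function.iterate_succ_apply']

lemma iterate_qD_smul (c : ℂ) {f : ℍ → ℂ} (hf : MDifferentiable 𝓘(ℂ) 𝓘(ℂ) f) (n : ℕ) :
    qD^[n] (c • f) = c • qD^[n] f := by
  induction n with
  | zero => rfl
  | succ n ih =>
    rw [Function.iterate_succ_apply', ih, qD_smul _
      (mdifferentiable_iterate_qD hf n), Function.iterate_succ_apply']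

lemma mdifferentiable_finset_sum {ι : Type*} (s : Finset ι) {f : ι → ℍ → ℂ}
    (hf : ∀ i ∈ s, MDifferentiable 𝓘(ℂ) 𝓘(ℂ) (f i)) :
    MDifferentiable 𝓘(ℂ) 𝓘(ℂ) (∑ i ∈ s, f i) := by
  classical
  induction s using Finset.induction_on with
  | empty => simpa using mdifferentiable_zero
  | insert i s hi ih =>
    rw [Finset.sum_insert hi]
    exact (hf i (Finset.mem_insert_self _ _)).add
      (ih fun j hj ↦ hf j (Finset.mem_insert_of_mem hj))

lemma qD_sum {ι : Type*} (s : Finset ι) {f : ι → ℍ → ℂ}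
    (hf : ∀ i ∈ s, MDifferentiable 𝓘(ℂ) 𝓘(ℂ) (f i)) :
    qD (∑ i ∈ s, f i) = ∑ i ∈ s, qD (f i) := by
  classical
  induction s using Finset.induction_on with
  | empty => simp [qD_zero]
  | insert i s hi ih =>
    rw [Finset.sum_insert hi, Finset.sum_insert hi, qD_add
      (hf i (Finset.mem_insert_self _ _))
      (mdifferentiable_finset_sum s fun j hj ↦ hf j (Finset.mem_insert_of_mem hj)),
      ih fun j hj ↦ hf j (Finset.mem_insert_of_mem hj)]

/-- `d/dτ = 2 π i D`. -/
lemma iteratedDeriv_comp_ofComplex {y : ℍ → ℂ} (n : ℕ) (τ : ℍ) :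
    iteratedDeriv n (y ∘ ofComplex) τ = (2 * Real.pi * Complex.I) ^ n * (qD^[n] y) τ := by
  induction n generalizing τ with
  | zero => simp [ofComplex_apply]
  | succ n ih =>
    rw [iteratedDeriv_succ, Function.iterate_succ_apply']
    have h : iteratedDeriv n (y ∘ ofComplex) =ᶠ[nhds (τ : ℂ)]
        fun z ↦ (2 * Real.pi * Complex.I) ^ n * ((qD^[n] y) ∘ ofComplex) z := by
      filter_upwards [isOpen_upperHalfPlaneSet.mem_nhds τ.2] with z hz
      have := ih ⟨z, hz⟩
      simpa [ofComplex_apply_of_im_pos hz] using this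
    rw [h.deriv_eq, deriv_const_mul_field, qD, normalizedDerivOfComplex]
    have : (2 * Real.pi * Complex.I : ℂ) ≠ 0 := Complex.two_pi_I_ne_zero
    field_simp
    ring

/-- A holomorphic function on the upper half-plane all of whose derivatives vanish at one point
is zero. -/
lemma eq_zero_of_iterate_qD_eq_zero {y : ℍ → ℂ} (hy : MDifferentiable 𝓘(ℂ) 𝓘(ℂ) y) (τ : ℍ)
    (h : ∀ n, (qD^[n] y) τ = 0) : y = 0 := by
  have hd := UpperHalfPlane.mdifferentiable_iff.mp hy
  have han : AnalyticOnNhd ℂ (y ∘ ofComplex) upperHalfPlaneSet :=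
    hd.analyticOnNhd isOpen_upperHalfPlaneSet
  have hp := (han τ τ.2).hasFPowerSeriesAt
  have h0 : (y ∘ ofComplex) =ᶠ[nhds (τ : ℂ)] 0 := by
    have hz : FormalMultilinearSeries.ofScalars ℂ
        (fun n ↦ iteratedDeriv n (y ∘ ofComplex) τ / (n.factorial : ℂ)) = 0 := by
      rw [FormalMultilinearSeries.ofScalars_series_eq_zero]
      funext n
      simp [iteratedDeriv_comp_ofComplex, h n]
    rw [hz] at hp
    exact hp.eventually_eq_zero
  have hpc : IsPreconnected upperHalfPlaneSet :=
    (convex_halfSpace_im_gt 0).isPreconnected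
  have := han.eqOn_zero_of_preconnected_of_eventuallyEq_zero hpc τ.2 h0
  funext z
  simpa [ofComplex_apply] using this z.2

/-- Uniqueness for the initial value problem of a monic linear differential equation with
holomorphic coefficients. -/
lemma eq_zero_of_monicOp_eq_zero {k : ℕ} {P : ℕ → ℍ → ℂ}
    (hP : ∀ n < k, MDifferentiable 𝓘(ℂ) 𝓘(ℂ) (P n)) {y : ℍ → ℂ}
    (hy : MDifferentiable 𝓘(ℂ) 𝓘(ℂ) y) (hs : monicOp k P y = 0) (τ : ℍ)
    (h : ∀ n < k, (qD^[n] y) τ = 0) : y = 0 := by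
  -- every derivative of `y` is a combination of the first `k` ones, with holomorphic coefficients
  have key : ∀ m, ∃ c : ℕ → ℍ → ℂ, (∀ n, MDifferentiable 𝓘(ℂ) 𝓘(ℂ) (c n)) ∧
      qD^[m] y = ∑ n ∈ Finset.range k, c n * qD^[n] y := by
    have hk : qD^[k] y = ∑ n ∈ Finset.range k, (- P n) * qD^[n] y := by
      have := hs
      unfold monicOp at this
      rw [eq_neg_of_add_eq_zero_left this, ← Finset.sum_neg_distrib]
      exact Finset.sum_congr rfl fun n _ ↦ (neg_mul _ _).symm
    intro m
    induction m with
    | zero =>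
      rcases Nat.eq_zero_or_pos k with rfl | hk0
      · exact ⟨0, fun _ ↦ mdifferentiable_zero, by simpa using hk⟩
      · refine ⟨fun n ↦ if n = 0 then 1 else 0, fun n ↦ ?_, ?_⟩
        · dsimp only; split_ifs
          exacts [mdifferentiable_one, mdifferentiable_zero]
        · rw [Finset.sum_eq_single_of_mem 0 (Finset.mem_range.mpr hk0)]
          · simp
          · intro b _ hb; simp [hb]
    | succ m ih =>
      obtain ⟨c, hc, hm⟩ := ih
      have hterm : ∀ n, MDifferentiable 𝓘(ℂ) 𝓘(ℂ) (c n * qD^[n] y) := fun n ↦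
        (hc n).mul (mdifferentiable_iterate_qD hy n)
      have e1 : qD^[m + 1] y =
          ∑ n ∈ Finset.range k, (qD (c n) * qD^[n] y + c n * qD^[n + 1] y) := by
        rw [Function.iterate_succ_apply', hm, qD_sum _ fun n _ ↦ hterm n]
        refine Finset.sum_congr rfl fun n _ ↦ ?_
        rw [qD_mul (hc n) (mdifferentiable_iterate_qD hy n),
          Function.iterate_succ_apply']
      rcases Nat.eq_zero_or_pos k with rfl | hk0
      · exact ⟨c, hc, by simpa using e1⟩
      obtain ⟨l, rfl⟩ : ∃ l, k = l + 1 := ⟨k - 1, by omega⟩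
      -- the equation eliminates `D ^ k y`, which comes from the last term
      refine ⟨fun n ↦ qD (c n) + (if n = 0 then 0 else c (n - 1)) -
        (if n < l + 1 then c l * P n else 0),
        fun n ↦ ?_, ?_⟩
      · refine ((mdifferentiable_qD (hc n)).add ?_).sub ?_
        · split_ifs
          exacts [mdifferentiable_zero, hc _]
        · split_ifs with hn
          exacts [(hc l).mul (hP n hn), mdifferentiable_zero]
      · rw [e1, Finset.sum_add_distrib, Finset.sum_range_succ (fun n ↦ c n * qD^[n + 1] y), hk]
        simp only [sub_mul, add_mul, Finset.sum_add_distrib, Finset.sum_sub_distrib]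
        rw [Finset.sum_range_succ' (fun n ↦ (if n = 0 then 0 else c (n - 1)) * qD^[n] y)]
        simp only [Nat.add_eq_zero_iff, one_ne_zero, and_false, if_false, Nat.add_sub_cancel,
          if_true, zero_mul, add_zero]
        rw [Finset.mul_sum, add_sub_assoc, sub_eq_add_neg, ← Finset.sum_neg_distrib]
        congr 2
        refine Finset.sum_congr rfl fun n hn ↦ ?_
        rw [if_pos (Finset.mem_range.mp hn)]
        ring
  refine eq_zero_of_iterate_qD_eq_zero hy τ fun m ↦ ?_
  obtain ⟨c, -, hm⟩ := key m
  rw [hm, Finset.sum_apply]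
  refine Finset.sum_eq_zero fun n hn ↦ ?_
  simp [h n (Finset.mem_range.mp hn)]

lemma monicOp_add (k : ℕ) (P : ℕ → ℍ → ℂ) {f g : ℍ → ℂ} (hf : MDifferentiable 𝓘(ℂ) 𝓘(ℂ) f)
    (hg : MDifferentiable 𝓘(ℂ) 𝓘(ℂ) g) : monicOp k P (f + g) = monicOp k P f + monicOp k P g := by
  simp only [monicOp, iterate_qD_add hf hg, mul_add, Finset.sum_add_distrib]
  ring

lemma monicOp_smul (k : ℕ) (P : ℕ → ℍ → ℂ) (c : ℂ) {f : ℍ → ℂ}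
    (hf : MDifferentiable 𝓘(ℂ) 𝓘(ℂ) f) : monicOp k P (c • f) = c • monicOp k P f := by
  simp only [monicOp, iterate_qD_smul c hf, mul_smul_comm, smul_add, Finset.smul_sum]

/-- The space of holomorphic solutions of `monicOp k P y = 0`. -/
def solutionSpace (k : ℕ) (P : ℕ → ℍ → ℂ) : Submodule ℂ (ℍ → ℂ) where
  carrier := {y | MDifferentiable 𝓘(ℂ) 𝓘(ℂ) y ∧ monicOp k P y = 0}
  add_mem' hf hg := ⟨hf.1.add hg.1, by rw [monicOp_add k P hf.1 hg.1, hf.2, hg.2, add_zero]⟩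
  zero_mem' := ⟨mdifferentiable_zero, by
    simpa using monicOp_smul k P 0 mdifferentiable_zero⟩
  smul_mem' c f hf := ⟨hf.1.const_smul c, by rw [monicOp_smul k P c hf.1, hf.2, smul_zero]⟩

/-- The solution space has dimension at most `k`, since a solution is determined by its first `k`
derivatives at a point; so `k` linearly independent solutions span it. -/
lemma isFundamentalSystem_of_linearIndependent {k : ℕ} {P : ℕ → ℍ → ℂ}
    (hP : ∀ n < k, MDifferentiable 𝓘(ℂ) 𝓘(ℂ) (P n)) {b : Fin k → ℍ → ℂ}
    (hb : ∀ j, MDifferentiable 𝓘(ℂ) 𝓘(ℂ) (b j)) (hs : ∀ j, monicOp k P (b j) = 0)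
    (hli : LinearIndependent ℂ b) : IsFundamentalSystem k P b := by
  let jet : solutionSpace k P →ₗ[ℂ] (Fin k → ℂ) :=
    { toFun := fun y n ↦ (qD^[(n : ℕ)] (y : ℍ → ℂ)) UpperHalfPlane.I
      map_add' := fun f g ↦ by
        funext n
        simp [iterate_qD_add f.2.1 g.2.1]
      map_smul' := fun c f ↦ by
        funext n
        simp [iterate_qD_smul c f.2.1] }
  have hinj : Function.Injective jet := by
    rw [← LinearMap.ker_eq_bot, LinearMap.ker_eq_bot']
    intro y hy
    ext1
    exact eq_zero_of_monicOp_eq_zero hP y.2.1 y.2.2 UpperHalfPlane.I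
      fun n hn ↦ congrFun hy ⟨n, hn⟩
  have hfin : FiniteDimensional ℂ (solutionSpace k P) := FiniteDimensional.of_injective jet hinj
  have hle : Submodule.span ℂ (Set.range b) ≤ solutionSpace k P :=
    Submodule.span_le.mpr (by rintro _ ⟨j, rfl⟩; exact ⟨hb j, hs j⟩)
  have hdim : Module.finrank ℂ (solutionSpace k P) ≤ k := by
    simpa using LinearMap.finrank_le_finrank_of_injective hinj
  have heq : Submodule.span ℂ (Set.range b) = solutionSpace k P :=
    Submodule.eq_of_le_of_finrank_le hle (by rw [finrank_span_eq_card hli]; simpa using hdim)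
  exact ⟨hli, fun y ↦ by rw [heq]; rfl⟩

/-- The coefficients `c_{m,n}` in the expansion `(D + u) ^ m = ∑ n, c_{m,n} D ^ n`. -/
def shiftCoeff (u : ℍ → ℂ) : ℕ → ℕ → ℍ → ℂ
  | 0, 0 => 1
  | 0, _ + 1 => 0
  | m + 1, 0 => qD (shiftCoeff u m 0) + u * shiftCoeff u m 0
  | m + 1, n + 1 => shiftCoeff u m n + qD (shiftCoeff u m (n + 1)) + u * shiftCoeff u m (n + 1)

lemma shiftCoeff_of_lt (u : ℍ → ℂ) {m n : ℕ} (h : m < n) : shiftCoeff u m n = 0 := by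
  induction m generalizing n with
  | zero =>
    obtain ⟨n, rfl⟩ : ∃ l, n = l + 1 := ⟨n - 1, by omega⟩
    rfl
  | succ m ih =>
    obtain ⟨n, rfl⟩ : ∃ l, n = l + 1 := ⟨n - 1, by omega⟩
    rw [shiftCoeff, ih (by omega), ih (by omega)]
    simp [qD_zero]

lemma shiftCoeff_self (u : ℍ → ℂ) (m : ℕ) : shiftCoeff u m m = 1 := by
  induction m with
  | zero => rfl
  | succ m ih =>
    rw [shiftCoeff, ih, shiftCoeff_of_lt u (Nat.lt_succ_self m)]
    simp [qD_zero]

lemma shiftCoeff_succ_self (u : ℍ → ℂ) (m : ℕ) :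
    shiftCoeff u (m + 1) m = ((m : ℂ) + 1) • u := by
  induction m with
  | zero => simp [shiftCoeff, qD_one]
  | succ m ih =>
    rw [shiftCoeff, ih, shiftCoeff_self, qD_one]
    push_cast
    simp only [add_zero, mul_one, add_smul, one_smul]

lemma mdifferentiable_shiftCoeff {u : ℍ → ℂ} (hu : MDifferentiable 𝓘(ℂ) 𝓘(ℂ) u) (m n : ℕ) :
    MDifferentiable 𝓘(ℂ) 𝓘(ℂ) (shiftCoeff u m n) := by
  induction m generalizing n with
  | zero => cases n; exacts [mdifferentiable_one, mdifferentiable_zero]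
  | succ m ih =>
    cases n with
    | zero =>
      exact (mdifferentiable_qD (ih 0)).add (hu.mul (ih 0))
    | succ n =>
      exact ((ih n).add (mdifferentiable_qD (ih (n + 1)))).add
        (hu.mul (ih (n + 1)))

/-- If `u` is the logarithmic derivative of `M`, then `D ^ m ∘ M = M ∘ (D + u) ^ m`. -/
lemma iterate_qD_mul {M u y : ℍ → ℂ} (hM : MDifferentiable 𝓘(ℂ) 𝓘(ℂ) M)
    (hu : MDifferentiable 𝓘(ℂ) 𝓘(ℂ) u) (hMu : qD M = u * M)
    (hy : MDifferentiable 𝓘(ℂ) 𝓘(ℂ) y) (m : ℕ) :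
    qD^[m] (M * y) = M * ∑ n ∈ Finset.range (m + 1), shiftCoeff u m n * qD^[n] y := by
  induction m with
  | zero => simp [shiftCoeff]
  | succ m ih =>
    have hterm : ∀ n, MDifferentiable 𝓘(ℂ) 𝓘(ℂ) (shiftCoeff u m n * qD^[n] y) := fun n ↦
      (mdifferentiable_shiftCoeff hu m n).mul (mdifferentiable_iterate_qD hy n)
    rw [Function.iterate_succ_apply', ih, qD_mul hM
      (mdifferentiable_finset_sum _ fun n _ ↦ hterm n), hMu, qD_sum _ fun n _ ↦ hterm n]
    have e : ∀ n, qD (shiftCoeff u m n * qD^[n] y) =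
        qD (shiftCoeff u m n) * qD^[n] y + shiftCoeff u m n * qD^[n + 1] y := fun n ↦ by
      rw [qD_mul (mdifferentiable_shiftCoeff hu m n)
        (mdifferentiable_iterate_qD hy n), Function.iterate_succ_apply']
    simp only [e]
    rw [Finset.sum_range_succ' (fun n ↦ shiftCoeff u (m + 1) n * qD^[n] y)]
    simp only [shiftCoeff, add_mul, Finset.sum_add_distrib]
    have s1 := Finset.sum_range_succ' (fun n ↦ qD (shiftCoeff u m n) * qD^[n] y) (m + 1)
    rw [Finset.sum_range_succ, shiftCoeff_of_lt u (Nat.lt_succ_self m), qD_zero, zero_mul,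
      add_zero] at s1
    have s2 := Finset.sum_range_succ' (fun n ↦ u * shiftCoeff u m n * qD^[n] y) (m + 1)
    rw [Finset.sum_range_succ, shiftCoeff_of_lt u (Nat.lt_succ_self m), mul_zero, zero_mul,
      add_zero] at s2
    have s3 : u * M * ∑ n ∈ Finset.range (m + 1), shiftCoeff u m n * qD^[n] y =
        M * ∑ n ∈ Finset.range (m + 1), u * shiftCoeff u m n * qD^[n] y := by
      rw [mul_comm u M, mul_assoc, Finset.mul_sum]
      simp only [mul_assoc]
    rw [s3, s1, s2]
    ring

/-- The coefficients of the operator `M⁻¹ ∘ monicOp k a ∘ M`, where `u` is the logarithmic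
derivative of `M`. As for `monicOp`, only the values at `n < k` matter. -/
def conjCoeff (k : ℕ) (u : ℍ → ℂ) (a : ℕ → ℍ → ℂ) (n : ℕ) : ℍ → ℂ :=
  shiftCoeff u k n + ∑ m ∈ Finset.range k, a m * shiftCoeff u m n

lemma conjCoeff_pred {k : ℕ} (hk : 1 ≤ k) (u : ℍ → ℂ) (a : ℕ → ℍ → ℂ) :
    conjCoeff k u a (k - 1) = (k : ℂ) • u + a (k - 1) := by
  obtain ⟨l, rfl⟩ : ∃ l, k = l + 1 := ⟨k - 1, by omega⟩
  rw [conjCoeff, Nat.add_sub_cancel, shiftCoeff_succ_self, Finset.sum_range_succ,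
    shiftCoeff_self, Finset.sum_eq_zero]
  · push_cast
    simp
  · intro m hm
    rw [shiftCoeff_of_lt u (Finset.mem_range.mp hm), mul_zero]

lemma mul_monicOp_conjCoeff {k : ℕ} {M u y : ℍ → ℂ} (a : ℕ → ℍ → ℂ)
    (hM : MDifferentiable 𝓘(ℂ) 𝓘(ℂ) M)
    (hu : MDifferentiable 𝓘(ℂ) 𝓘(ℂ) u) (hMu : qD M = u * M)
    (hy : MDifferentiable 𝓘(ℂ) 𝓘(ℂ) y) :
    M * monicOp k (conjCoeff k u a) y = monicOp k a (M * y) := by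
  have ext : ∀ m ≤ k, ∑ n ∈ Finset.range (m + 1), shiftCoeff u m n * qD^[n] y =
      ∑ n ∈ Finset.range (k + 1), shiftCoeff u m n * qD^[n] y := fun m hm ↦ by
    refine Finset.sum_subset (Finset.range_mono (by omega)) fun n _ hn ↦ ?_
    rw [shiftCoeff_of_lt u (by simpa using hn), zero_mul]
  unfold monicOp
  simp only [iterate_qD_mul hM hu hMu hy]
  have e1 : ∑ m ∈ Finset.range k, a m * (M * ∑ n ∈ Finset.range (m + 1),
      shiftCoeff u m n * qD^[n] y) = ∑ m ∈ Finset.range k, a m * (M *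
      ∑ n ∈ Finset.range (k + 1), shiftCoeff u m n * qD^[n] y) :=
    Finset.sum_congr rfl fun m hm ↦ by rw [ext m (Finset.mem_range.mp hm).le]
  have e2 : ∑ m ∈ Finset.range k, a m * (M * ∑ n ∈ Finset.range (k + 1),
      shiftCoeff u m n * qD^[n] y) =
      M * ∑ n ∈ Finset.range k, (∑ m ∈ Finset.range k, a m * shiftCoeff u m n) * qD^[n] y := by
    simp only [Finset.sum_mul, Finset.mul_sum]
    rw [Finset.sum_comm, Finset.sum_range_succ]
    rw [Finset.sum_eq_zero (s := Finset.range k)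
      (f := fun m ↦ a m * (M * (shiftCoeff u m k * qD^[k] y))), add_zero]
    · refine Finset.sum_congr rfl fun n _ ↦ Finset.sum_congr rfl fun m _ ↦ ?_
      ring
    · intro m hm
      rw [shiftCoeff_of_lt u (Finset.mem_range.mp hm)]
      simp
  rw [e1, e2, Finset.sum_range_succ, shiftCoeff_self]
  simp only [conjCoeff, add_mul, Finset.sum_add_distrib]
  ring


/-! ### Alternating theta series -/

lemma summable_exp_neg_abs_int : Summable fun n : ℤ ↦ Real.exp (-|(n : ℝ)|) := by
  have h : Summable fun n : ℕ ↦ Real.exp (-(n : ℝ)) := by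
    simpa using Real.summable_exp_nat_mul_iff.mpr (show (-1 : ℝ) < 0 by norm_num)
  refine Summable.of_nat_of_neg ?_ ?_ <;> simpa using h

lemma summable_exp_quadratic {α : ℝ} (hα : 0 < α) (β r : ℝ) :
    Summable fun n : ℤ ↦ Real.exp (-α * ((n : ℝ) + r) ^ 2 + β * |(n : ℝ) + r|) := by
  refine Summable.of_nonneg_of_le (fun _ ↦ (Real.exp_pos _).le) (fun n ↦ ?_)
    (summable_exp_neg_abs_int.mul_left (Real.exp ((β + 1) ^ 2 / (4 * α) + |r|)))
  rw [← Real.exp_add]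
  refine Real.exp_le_exp.mpr ?_
  set x := |(n : ℝ) + r| with hx
  have h1 : |(n : ℝ)| ≤ x + |r| := by
    have := abs_sub ((n : ℝ) + r) r
    simpa using this
  have h2 : ((n : ℝ) + r) ^ 2 = x ^ 2 := (sq_abs _).symm
  -- complete the square
  have h3 : -α * x ^ 2 + (β + 1) * x ≤ (β + 1) ^ 2 / (4 * α) := by
    rw [le_div_iff₀ (by positivity)]
    nlinarith [sq_nonneg (2 * α * x - (β + 1))]
  rw [h2]
  linarith

/-- The general term of `thetaSeries`. -/
def thetaTerm (κ r : ℝ) (j : ℕ) (z τ : ℂ) (n : ℤ) : ℂ :=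
  (-1) ^ n * (n + r : ℂ) ^ j *
    Complex.exp (2 * Real.pi * Complex.I * κ * (n + r) ^ 2 * τ + 2 * κ * (n + r) * z)

/-- The alternating theta series
`∑ n, (-1) ^ n (n + r) ^ j q ^ (κ (n + r) ^ 2) ζ ^ (2 κ (n + r))`, where `ζ = exp z`. -/
def thetaSeries (κ r : ℝ) (j : ℕ) (z τ : ℂ) : ℂ := ∑' n : ℤ, thetaTerm κ r j z τ n

/-- A bound that is uniform for bounded `z` and for `τ` in a half-plane `ε ≤ Im τ`. -/
lemma norm_thetaTerm_le {κ r : ℝ} (hκ : 0 < κ) (j : ℕ) {z τ : ℂ} {ε R : ℝ} (hτ : ε ≤ τ.im)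
    (hz : ‖z‖ ≤ R) (n : ℤ) : ‖thetaTerm κ r j z τ n‖ ≤
      Real.exp (-(2 * Real.pi * κ * ε) * ((n : ℝ) + r) ^ 2 + (2 * κ * R + j) * |(n : ℝ) + r|) := by
  have e1 : (n + r : ℂ) = (((n : ℝ) + r : ℝ) : ℂ) := by push_cast; rfl
  rw [thetaTerm, e1]
  set x : ℝ := (n : ℝ) + r
  have hre : (2 * Real.pi * Complex.I * κ * (x : ℂ) ^ 2 * τ + 2 * κ * x * z).re =
      -(2 * Real.pi * κ * τ.im) * x ^ 2 + 2 * κ * x * z.re := by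
    have : (2 * Real.pi * Complex.I * κ * (x : ℂ) ^ 2 * τ + 2 * κ * x * z) =
      ((2 * Real.pi * κ * x ^ 2 : ℝ) : ℂ) * (Complex.I * τ) + ((2 * κ * x : ℝ) : ℂ) * z := by
      push_cast; ring
    rw [this, Complex.add_re, Complex.re_ofReal_mul, Complex.re_ofReal_mul, Complex.I_mul_re]
    ring
  rw [norm_mul, norm_mul, norm_zpow, norm_neg, norm_one, one_zpow, one_mul, norm_pow,
    Complex.norm_real, Complex.norm_exp, hre, Real.norm_eq_abs]
  have hx : |x| ^ j ≤ Real.exp (j * |x|) := by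
    rw [Real.exp_nat_mul]
    exact pow_le_pow_left₀ (abs_nonneg _) (by linarith [Real.add_one_le_exp |x|]) _
  refine (mul_le_mul_of_nonneg_right hx (Real.exp_pos _).le).trans ?_
  rw [← Real.exp_add]
  refine Real.exp_le_exp.mpr ?_
  have h1 : 2 * κ * x * z.re ≤ 2 * κ * R * |x| := by
    have : x * z.re ≤ |x| * R := (le_abs_self _).trans (by
      rw [abs_mul]
      exact mul_le_mul_of_nonneg_left ((Complex.abs_re_le_norm z).trans hz) (abs_nonneg _))
    nlinarith
  have h2 : 2 * Real.pi * κ * ε * x ^ 2 ≤ 2 * Real.pi * κ * τ.im * x ^ 2 := by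
    have := Real.pi_pos
    gcongr
  linarith

lemma summable_norm_thetaTerm {κ : ℝ} (hκ : 0 < κ) (r : ℝ) (j : ℕ) (z : ℂ) {τ : ℂ}
    (hτ : 0 < τ.im) : Summable fun n ↦ ‖thetaTerm κ r j z τ n‖ :=
  Summable.of_nonneg_of_le (fun _ ↦ norm_nonneg _)
    (fun n ↦ norm_thetaTerm_le hκ j le_rfl le_rfl n)
    (summable_exp_quadratic (by have := Real.pi_pos; positivity) _ r)

lemma hasDerivAt_thetaTerm_left (κ r : ℝ) (j : ℕ) (z τ : ℂ) (n : ℤ) :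
    HasDerivAt (fun w ↦ thetaTerm κ r j w τ n) (2 * κ * thetaTerm κ r (j + 1) z τ n) z := by
  unfold thetaTerm
  have h := ((((hasDerivAt_id z).const_mul (2 * κ * (n + r) : ℂ)).const_add
    (2 * Real.pi * Complex.I * κ * (n + r) ^ 2 * τ)).cexp).const_mul
    ((-1) ^ n * (n + r : ℂ) ^ j)
  refine h.congr_deriv ?_
  simp only [id]
  ring

lemma hasDerivAt_thetaTerm_right (κ r : ℝ) (j : ℕ) (z τ : ℂ) (n : ℤ) :
    HasDerivAt (fun w ↦ thetaTerm κ r j z w n)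
      (2 * Real.pi * Complex.I * κ * thetaTerm κ r (j + 2) z τ n) τ := by
  unfold thetaTerm
  have h := ((((hasDerivAt_id τ).const_mul (2 * Real.pi * Complex.I * κ * (n + r) ^ 2)).add_const
    (2 * κ * (n + r) * z : ℂ)).cexp).const_mul ((-1) ^ n * (n + r : ℂ) ^ j)
  refine h.congr_deriv ?_
  simp only [id]
  ring

lemma hasDerivAt_thetaSeries_left {κ : ℝ} (hκ : 0 < κ) (r : ℝ) (j : ℕ) (z : ℂ) {τ : ℂ}
    (hτ : 0 < τ.im) : HasDerivAt (fun w ↦ thetaSeries κ r j w τ)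
      (2 * κ * thetaSeries κ r (j + 1) z τ) z := by
  have hU : IsOpen (Metric.ball (0 : ℂ) (‖z‖ + 1)) := Metric.isOpen_ball
  have hz : z ∈ Metric.ball (0 : ℂ) (‖z‖ + 1) := by simp
  have hu := summable_exp_quadratic (α := 2 * Real.pi * κ * τ.im)
    (by have := Real.pi_pos; positivity) (2 * κ * (‖z‖ + 1) + j) r
  have hF : ∀ n : ℤ, DifferentiableOn ℂ (fun w ↦ thetaTerm κ r j w τ n)
      (Metric.ball (0 : ℂ) (‖z‖ + 1)) := fun n w _ ↦
    (hasDerivAt_thetaTerm_left κ r j w τ n).differentiableAt.differentiableWithinAt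
  have hb : ∀ (n : ℤ) w, w ∈ Metric.ball (0 : ℂ) (‖z‖ + 1) → ‖thetaTerm κ r j w τ n‖ ≤ _ :=
    fun n w hw ↦ norm_thetaTerm_le hκ j le_rfl (mem_ball_zero_iff.mp hw).le n
  have hd := (Complex.differentiableOn_tsum_of_summable_norm hu hF hU hb).differentiableAt
    (hU.mem_nhds hz)
  have hs := Complex.hasSum_deriv_of_summable_norm hu hF hU hb hz
  refine hd.hasDerivAt.congr_deriv ?_
  rw [← hs.tsum_eq, thetaSeries, ← tsum_mul_left]
  exact tsum_congr fun n ↦ (hasDerivAt_thetaTerm_left κ r j z τ n).deriv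

lemma hasDerivAt_thetaSeries_right {κ : ℝ} (hκ : 0 < κ) (r : ℝ) (j : ℕ) (z : ℂ) {τ : ℂ}
    (hτ : 0 < τ.im) : HasDerivAt (fun w ↦ thetaSeries κ r j z w)
      (2 * Real.pi * Complex.I * κ * thetaSeries κ r (j + 2) z τ) τ := by
  have hU : IsOpen {w : ℂ | τ.im / 2 < w.im} := isOpen_lt continuous_const Complex.continuous_im
  have hz : τ ∈ {w : ℂ | τ.im / 2 < w.im} := by simpa using hτ
  have hu := summable_exp_quadratic (α := 2 * Real.pi * κ * (τ.im / 2))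
    (by have := Real.pi_pos; positivity) (2 * κ * ‖z‖ + j) r
  have hF : ∀ n : ℤ, DifferentiableOn ℂ (fun w ↦ thetaTerm κ r j z w n)
      {w : ℂ | τ.im / 2 < w.im} := fun n w _ ↦
    (hasDerivAt_thetaTerm_right κ r j z w n).differentiableAt.differentiableWithinAt
  have hb : ∀ (n : ℤ) w, w ∈ {w : ℂ | τ.im / 2 < w.im} → ‖thetaTerm κ r j z w n‖ ≤ _ :=
    fun n w hw ↦ norm_thetaTerm_le hκ j (le_of_lt hw) le_rfl n
  have hd := (Complex.differentiableOn_tsum_of_summable_norm hu hF hU hb).differentiableAt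
    (hU.mem_nhds hz)
  have hs := Complex.hasSum_deriv_of_summable_norm hu hF hU hb hz
  refine hd.hasDerivAt.congr_deriv ?_
  rw [← hs.tsum_eq, thetaSeries, ← tsum_mul_left]
  exact tsum_congr fun n ↦ (hasDerivAt_thetaTerm_right κ r j z τ n).deriv

lemma differentiable_thetaSeries {κ : ℝ} (hκ : 0 < κ) (r : ℝ) (j : ℕ) {τ : ℂ}
    (hτ : 0 < τ.im) : Differentiable ℂ fun w ↦ thetaSeries κ r j w τ := fun z ↦
  (hasDerivAt_thetaSeries_left hκ r j z hτ).differentiableAt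

lemma iteratedDeriv_thetaSeries {κ : ℝ} (hκ : 0 < κ) (r : ℝ) {τ : ℂ} (hτ : 0 < τ.im) (m : ℕ) :
    iteratedDeriv m (fun w ↦ thetaSeries κ r 0 w τ) =
      fun z ↦ (2 * κ) ^ m * thetaSeries κ r m z τ := by
  induction m with
  | zero => simp
  | succ m ih =>
    rw [iteratedDeriv_succ, ih]
    funext z
    rw [((hasDerivAt_thetaSeries_left hκ r m z hτ).const_mul _).deriv]
    ring

/-- The moments `∑ n, (-1) ^ n (n + r) ^ j q ^ (κ (n + r) ^ 2)`, as functions on `ℍ`. -/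
def thetaMoment (κ r : ℝ) (j : ℕ) (τ : ℍ) : ℂ := thetaSeries κ r j 0 τ

lemma mdifferentiable_thetaMoment {κ : ℝ} (hκ : 0 < κ) (r : ℝ) (j : ℕ) :
    MDifferentiable 𝓘(ℂ) 𝓘(ℂ) (thetaMoment κ r j) := by
  rw [UpperHalfPlane.mdifferentiable_iff]
  intro τ hτ
  refine ((hasDerivAt_thetaSeries_right hκ r j 0 hτ).differentiableAt.congr_of_eventuallyEq
    ?_).differentiableWithinAt
  filter_upwards [isOpen_upperHalfPlaneSet.mem_nhds hτ] with w hw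
  simp [thetaMoment, ofComplex_apply_of_im_pos hw]

/-- The heat equation. -/
lemma qD_thetaMoment {κ : ℝ} (hκ : 0 < κ) (r : ℝ) (j : ℕ) :
    qD (thetaMoment κ r j) = (κ : ℂ) • thetaMoment κ r (j + 2) := by
  funext τ
  have h : (thetaMoment κ r j ∘ ofComplex) =ᶠ[nhds (τ : ℂ)] fun w ↦ thetaSeries κ r j 0 w := by
    filter_upwards [isOpen_upperHalfPlaneSet.mem_nhds τ.2] with w hw
    simp [thetaMoment, ofComplex_apply_of_im_pos hw]
  rw [qD, Derivative.normalizedDerivOfComplex, h.deriv_eq,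
    (hasDerivAt_thetaSeries_right hκ r j 0 τ.2).deriv]
  have := Complex.two_pi_I_ne_zero
  simp only [Pi.smul_apply, smul_eq_mul, thetaMoment]
  field_simp

lemma iterate_qD_thetaMoment {κ : ℝ} (hκ : 0 < κ) (r : ℝ) (m : ℕ) :
    qD^[m] (thetaMoment κ r 0) = (κ ^ m : ℂ) • thetaMoment κ r (2 * m) := by
  induction m with
  | zero => simp
  | succ m ih =>
    rw [Function.iterate_succ_apply', ih, qD_smul _ (mdifferentiable_thetaMoment hκ r _),
      qD_thetaMoment hκ, smul_smul]
    rfl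

/-- Quasi-periodicity, from the shift `n ↦ n + 1` of the summation index. -/
lemma thetaSeries_add_two_pi_I_mul (κ r : ℝ) (z τ : ℂ) :
    thetaSeries κ r 0 (z + 2 * Real.pi * Complex.I * τ) τ =
      -Complex.exp (-(2 * Real.pi * Complex.I * κ * τ) - 2 * κ * z) * thetaSeries κ r 0 z τ := by
  rw [thetaSeries, thetaSeries, ← (Equiv.addRight (1 : ℤ)).tsum_eq (thetaTerm κ r 0 z τ),
    ← tsum_mul_left]
  refine tsum_congr fun n ↦ ?_
  simp only [thetaTerm, Equiv.coe_addRight, pow_zero, mul_one]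
  rw [zpow_add₀ (by norm_num), zpow_one]
  have : ∀ a b c : ℂ, -Complex.exp a * (b * -1 * Complex.exp c) = b * Complex.exp (a + c) := by
    intro a b c; rw [Complex.exp_add]; ring
  rw [this]
  congr 2
  push_cast
  ring

lemma thetaSeries_add_two_pi_I (κ r : ℝ) (z τ : ℂ) (N : ℤ) (c : ℂ)
    (h : ∀ n : ℤ, Complex.exp (2 * κ * (n + r) * (2 * Real.pi * Complex.I * N)) = c) :
    thetaSeries κ r 0 (z + 2 * Real.pi * Complex.I * N) τ = c * thetaSeries κ r 0 z τ := by
  rw [thetaSeries, thetaSeries, ← tsum_mul_left]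
  refine tsum_congr fun n ↦ ?_
  simp only [thetaTerm, pow_zero, mul_one]
  rw [← h n, mul_left_comm, ← Complex.exp_add]
  congr 2
  ring


/-! ### The Jacobi triple product identity -/

/-- The finite `q`-Pochhammer symbol `(Q; Q)_j = ∏_{i = 1}^j (1 - Q ^ i)`. -/
def qPoch (Q : ℂ) (j : ℕ) : ℂ := ∏ i ∈ Finset.range j, (1 - Q ^ (i + 1))

/-- The reciprocal `1 / (Q; Q)_j`, with the usual convention that it vanishes for `j < 0`. -/
def invQPoch (Q : ℂ) (j : ℤ) : ℂ := if j < 0 then 0 else (qPoch Q j.toNat)⁻¹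

lemma one_sub_pow_succ_ne_zero {Q : ℂ} (hQ : ‖Q‖ < 1) (n : ℕ) : 1 - Q ^ (n + 1) ≠ 0 := by
  intro h
  have h1 : ‖Q ^ (n + 1)‖ = 1 := by rw [← sub_eq_zero.mp h, norm_one]
  rw [norm_pow] at h1
  exact absurd h1 (pow_lt_one₀ (norm_nonneg _) hQ (by omega)).ne

lemma qPoch_ne_zero {Q : ℂ} (hQ : ‖Q‖ < 1) (j : ℕ) : qPoch Q j ≠ 0 :=
  Finset.prod_ne_zero_iff.mpr fun i _ ↦ one_sub_pow_succ_ne_zero hQ i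

lemma qPoch_succ (Q : ℂ) (j : ℕ) : qPoch Q (j + 1) = qPoch Q j * (1 - Q ^ (j + 1)) :=
  Finset.prod_range_succ _ _

lemma invQPoch_sub_one {Q : ℂ} (hQ : ‖Q‖ < 1) (j : ℤ) :
    invQPoch Q (j - 1) = (1 - Q ^ j) * invQPoch Q j := by
  rcases lt_trichotomy j 0 with h | rfl | h
  · rw [invQPoch, invQPoch, if_pos h, if_pos (by omega), mul_zero]
  · simp [invQPoch]
  · obtain ⟨m, rfl⟩ : ∃ m : ℕ, j = m + 1 := ⟨(j - 1).toNat, by omega⟩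
    rw [invQPoch, invQPoch, if_neg (by omega), if_neg (by omega),
      show ((m : ℤ) + 1 - 1).toNat = m by omega, show ((m : ℤ) + 1).toNat = m + 1 by omega,
      qPoch_succ]
    have h1 := one_sub_pow_succ_ne_zero hQ m
    have h2 := qPoch_ne_zero hQ m
    rw [show Q ^ ((m : ℤ) + 1) = Q ^ (m + 1) by exact_mod_cast zpow_natCast Q (m + 1)]
    field_simp

lemma tendsto_qPoch {Q : ℂ} (hQ : ‖Q‖ < 1) :
    Filter.Tendsto (qPoch Q) Filter.atTop (nhds (∏' n : ℕ, (1 - Q ^ (n + 1)))) :=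
  (ModularForm.multipliable_one_sub_pow hQ).hasProd.tendsto_prod_nat

lemma tprod_one_sub_pow_ne_zero {Q : ℂ} (hQ : ‖Q‖ < 1) : ∏' n : ℕ, (1 - Q ^ (n + 1)) ≠ 0 := by
  have h := tprod_one_add_ne_zero_of_summable (f := fun n : ℕ ↦ -Q ^ (n + 1))
    (fun n ↦ by simpa [← sub_eq_add_neg] using one_sub_pow_succ_ne_zero hQ n)
    (by
      simpa using (summable_nat_add_iff 1).mpr (summable_geometric_of_lt_one (norm_nonneg _) hQ))
  simpa [← sub_eq_add_neg] using h

/-- The finite form of the Jacobi triple product identity, by induction on `N`: the new factor is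
`1 + p ^ (4N+2) - p ^ (2N+1) ζ - p ^ (2N+1) ζ⁻¹`, and multiplication by `ζ` and `ζ⁻¹` shifts the
summation index. With the convention for `invQPoch` the sum runs over all integers. -/
lemma hasSum_finite_tripleProduct {p ζ : ℂ} (hp0 : p ≠ 0) (hp : ‖p‖ < 1) (hζ : ζ ≠ 0) (N : ℕ) :
    HasSum (fun n : ℤ ↦ qPoch (p ^ 2) (2 * N) * ((-1) ^ n * p ^ (n ^ 2) * ζ ^ n *
        (invQPoch (p ^ 2) (N + n) * invQPoch (p ^ 2) (N - n))))
      (∏ m ∈ Finset.range N, ((1 - p ^ (2 * m + 1) * ζ) * (1 - p ^ (2 * m + 1) * ζ⁻¹))) := by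
  have hQ : ‖p ^ 2‖ < 1 := by rw [norm_pow]; exact pow_lt_one₀ (norm_nonneg _) hp two_ne_zero
  induction N with
  | zero =>
    have := hasSum_single (f := fun n : ℤ ↦ qPoch (p ^ 2) (2 * 0) * ((-1) ^ n * p ^ (n ^ 2) *
      ζ ^ n * (invQPoch (p ^ 2) ((0 : ℕ) + n) * invQPoch (p ^ 2) ((0 : ℕ) - n)))) 0 ?_
    · simpa [qPoch, invQPoch] using this
    · intro n hn
      rcases lt_or_gt_of_ne hn with h | h
      · simp [invQPoch, h]
      · simp [invQPoch, h]
  | succ N ih =>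
    rw [Finset.prod_range_succ]
    have h0 := ih.mul_left (1 + p ^ (4 * N + 2))
    have h1 := ((Equiv.subRight (1 : ℤ)).hasSum_iff.mpr ih).mul_left (-(p ^ (2 * N + 1) * ζ))
    have h2 := ((Equiv.addRight (1 : ℤ)).hasSum_iff.mpr ih).mul_left (-(p ^ (2 * N + 1) * ζ⁻¹))
    have h3 := (h0.add h1).add h2
    convert! h3 using 1
    · funext n
      simp only [Function.comp_apply, Equiv.subRight_apply, Equiv.coe_addRight]
      set a : ℂ := (p ^ 2) ^ ((N : ℤ) + 1 + n) with ha
      set b : ℂ := (p ^ 2) ^ ((N : ℤ) + 1 - n) with hb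
      have hp2 : p ^ 2 ≠ 0 := pow_ne_zero _ hp0
      have hab : a * b = p ^ (4 * N + 4) := by
        rw [ha, hb, ← zpow_add₀ hp2, ← zpow_natCast p 2, ← zpow_mul, ← zpow_natCast]
        congr 1; push_cast; ring
      -- all `invQPoch` factors are polynomials in `a`, `b` times the two with the largest indices
      have r1 : invQPoch (p ^ 2) (N + n) = (1 - a) * invQPoch (p ^ 2) (N + 1 + n) := by
        rw [ha, ← invQPoch_sub_one hQ]; congr 1; ring
      have r2 : invQPoch (p ^ 2) (N - n) = (1 - b) * invQPoch (p ^ 2) (N + 1 - n) := by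
        rw [hb, ← invQPoch_sub_one hQ]; congr 1; ring
      have r3 : p ^ 2 * invQPoch (p ^ 2) (N + (n - 1)) =
          (p ^ 2 - a) * invQPoch (p ^ 2) (N + n) := by
        have := invQPoch_sub_one hQ (N + n)
        rw [show (N : ℤ) + (n - 1) = N + n - 1 by ring, this, ha,
          show (N : ℤ) + 1 + n = (N + n) + 1 by ring, zpow_add_one₀ hp2]
        ring
      have r4 : p ^ 2 * invQPoch (p ^ 2) (N - (n + 1)) =
          (p ^ 2 - b) * invQPoch (p ^ 2) (N - n) := by
        have := invQPoch_sub_one hQ (N - n)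
        rw [show (N : ℤ) - (n + 1) = N - n - 1 by ring, this, hb,
          show (N : ℤ) + 1 - n = (N - n) + 1 by ring, zpow_add_one₀ hp2]
        ring
      have r5 : invQPoch (p ^ 2) (N - (n - 1)) = invQPoch (p ^ 2) (N + 1 - n) := by
        congr 1; ring
      have r6 : invQPoch (p ^ 2) (N + (n + 1)) = invQPoch (p ^ 2) (N + 1 + n) := by
        congr 1; ring
      have s1 : p ^ ((n - 1) ^ 2) * p ^ (2 * N + 1) = p ^ (n ^ 2) * b := by
        rw [hb, ← zpow_natCast p 2, ← zpow_mul, ← zpow_natCast, ← zpow_add₀ hp0, ← zpow_add₀ hp0]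
        congr 1; push_cast; ring
      have s2 : p ^ ((n + 1) ^ 2) * p ^ (2 * N + 1) = p ^ (n ^ 2) * a := by
        rw [ha, ← zpow_natCast p 2, ← zpow_mul, ← zpow_natCast, ← zpow_add₀ hp0, ← zpow_add₀ hp0]
        congr 1; push_cast; ring
      have m1 : (-1 : ℂ) ^ (n - 1) = -(-1) ^ n := by rw [zpow_sub_one₀ (by norm_num)]; norm_num
      have m2 : (-1 : ℂ) ^ (n + 1) = -(-1) ^ n := by rw [zpow_add_one₀ (by norm_num)]; ring
      have z1 : ζ ^ (n - 1) * ζ = ζ ^ n := by rw [zpow_sub_one₀ hζ]; field_simp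
      have z2 : ζ ^ (n + 1) * ζ⁻¹ = ζ ^ n := by rw [zpow_add_one₀ hζ]; field_simp
      rw [show 2 * (N + 1) = 2 * N + 1 + 1 by ring, qPoch_succ, qPoch_succ]
      set X := invQPoch (p ^ 2) (N + 1 + n) with hX
      set Y := invQPoch (p ^ 2) (N + 1 - n) with hY
      have t1 : -(p ^ (2 * N + 1) * ζ) * (qPoch (p ^ 2) (2 * N) * ((-1) ^ (n - 1) *
          p ^ ((n - 1) ^ 2) * ζ ^ (n - 1) * (invQPoch (p ^ 2) (N + (n - 1)) *
          invQPoch (p ^ 2) (N - (n - 1))))) =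
          qPoch (p ^ 2) (2 * N) * ((-1) ^ n * p ^ (n ^ 2) * ζ ^ n *
          (b * invQPoch (p ^ 2) (N + (n - 1)) * Y)) := by
        rw [r5, m1, ← z1]
        linear_combination (qPoch (p ^ 2) (2 * N) * (-1) ^ n * ζ ^ (n - 1) * ζ *
          invQPoch (p ^ 2) (N + (n - 1)) * Y) * s1
      have t2 : -(p ^ (2 * N + 1) * ζ⁻¹) * (qPoch (p ^ 2) (2 * N) * ((-1) ^ (n + 1) *
          p ^ ((n + 1) ^ 2) * ζ ^ (n + 1) * (invQPoch (p ^ 2) (N + (n + 1)) *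
          invQPoch (p ^ 2) (N - (n + 1))))) =
          qPoch (p ^ 2) (2 * N) * ((-1) ^ n * p ^ (n ^ 2) * ζ ^ n *
          (a * invQPoch (p ^ 2) (N - (n + 1)) * X)) := by
        rw [r6, m2, ← z2]
        linear_combination (qPoch (p ^ 2) (2 * N) * (-1) ^ n * ζ ^ (n + 1) * ζ⁻¹ *
          invQPoch (p ^ 2) (N - (n + 1)) * X) * s2
      rw [t1, t2, r1, r2]
      rw [r1] at r3
      rw [r2] at r4
      push_cast
      rw [← hX, ← hY]
      refine mul_left_cancel₀ hp2 ?_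
      have e1 : (p ^ 2) ^ (2 * N + 1 + 1) = a * b := by rw [hab]; ring
      have e2 : p ^ 2 * (p ^ 2) ^ (2 * N + 1) = a * b := by rw [hab]; ring
      have e3 : p ^ 2 * p ^ (4 * N + 2) = a * b := by rw [hab]; ring
      rw [e1]
      set G := qPoch (p ^ 2) (2 * N) * ((-1) ^ n * p ^ (n ^ 2) * ζ ^ n) with hG
      linear_combination (-(1 - a * b) * G * X * Y) * e2 - (G * (1 - a) * (1 - b) * X * Y) * e3
        - (G * b * Y) * r3 - (G * a * X) * r4
    · have hz : ζ * ζ⁻¹ = 1 := mul_inv_cancel₀ hζ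
      generalize ∏ m ∈ Finset.range N, ((1 - p ^ (2 * m + 1) * ζ) * (1 - p ^ (2 * m + 1) * ζ⁻¹)) = S
      linear_combination (S * p ^ (4 * N + 2)) * hz

lemma summable_tripleProduct_bound {p ζ : ℂ} (hp0 : p ≠ 0) (hp : ‖p‖ < 1) (hζ : ζ ≠ 0) :
    Summable fun n : ℤ ↦ ‖p ^ (n ^ 2) * ζ ^ n‖ := by
  have hlog : 0 < -Real.log ‖p‖ := by
    simpa using Real.log_neg (norm_pos_iff.mpr hp0) hp
  refine Summable.of_nonneg_of_le (fun _ ↦ norm_nonneg _) (fun n ↦ ?_)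
    (summable_exp_quadratic hlog |Real.log ‖ζ‖| 0)
  have h1 : ‖p ^ (n ^ 2)‖ = Real.exp (Real.log ‖p‖ * n ^ 2) := by
    rw [norm_zpow, ← Real.rpow_intCast, Real.rpow_def_of_pos (norm_pos_iff.mpr hp0)]
    push_cast; rfl
  have h2 : ‖ζ ^ n‖ = Real.exp (Real.log ‖ζ‖ * n) := by
    rw [norm_zpow, ← Real.rpow_intCast, Real.rpow_def_of_pos (norm_pos_iff.mpr hζ)]
  rw [norm_mul, h1, h2, ← Real.exp_add]
  refine Real.exp_le_exp.mpr ?_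
  have h3 : Real.log ‖ζ‖ * n ≤ |Real.log ‖ζ‖| * |(n : ℝ)| := by
    rw [← abs_mul]; exact le_abs_self _
  simpa using h3

lemma multipliable_one_sub_pow_mul {p : ℂ} (hp : ‖p‖ < 1) (x : ℂ) (a : ℕ) :
    Multipliable fun m : ℕ ↦ 1 - p ^ (2 * m + a) * x := by
  have hQ : ‖p‖ ^ 2 < 1 := pow_lt_one₀ (norm_nonneg _) hp two_ne_zero
  have h := multipliable_one_add_of_summable (f := fun m : ℕ ↦ -(p ^ (2 * m + a) * x)) (by
    have := ((summable_geometric_of_lt_one (by positivity) hQ).mul_right (‖p‖ ^ a * ‖x‖))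
    refine this.congr fun m ↦ ?_
    rw [norm_neg, norm_mul, norm_pow, pow_add, pow_mul]
    ring)
  simpa [← sub_eq_add_neg] using h

/-- The Jacobi triple product identity, as the limit of its finite form. -/
theorem tripleProduct {p ζ : ℂ} (hp0 : p ≠ 0) (hp : ‖p‖ < 1) (hζ : ζ ≠ 0) :
    (∏' m : ℕ, (1 - (p ^ 2) ^ (m + 1))) *
      ((∏' m : ℕ, (1 - p ^ (2 * m + 1) * ζ)) * ∏' m : ℕ, (1 - p ^ (2 * m + 1) * ζ⁻¹)) =
      ∑' n : ℤ, (-1) ^ n * p ^ (n ^ 2) * ζ ^ n := by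
  have hQ : ‖p ^ 2‖ < 1 := by rw [norm_pow]; exact pow_lt_one₀ (norm_nonneg _) hp two_ne_zero
  set L : ℂ := ∏' m : ℕ, (1 - (p ^ 2) ^ (m + 1)) with hL
  have hL0 : L ≠ 0 := tprod_one_sub_pow_ne_zero hQ
  have hlim := tendsto_qPoch hQ
  rw [← hL] at hlim
  have hinv : Filter.Tendsto (fun j ↦ (qPoch (p ^ 2) j)⁻¹) Filter.atTop (nhds L⁻¹) :=
    hlim.inv₀ hL0
  obtain ⟨C, hC⟩ := hlim.norm.bddAbove_range
  obtain ⟨C', hC'⟩ := hinv.norm.bddAbove_range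
  have hC1 : ∀ j, ‖qPoch (p ^ 2) j‖ ≤ C := fun j ↦ hC ⟨j, rfl⟩
  have hC1' : ∀ j, ‖(qPoch (p ^ 2) j)⁻¹‖ ≤ C' := fun j ↦ hC' ⟨j, rfl⟩
  have hC0 : 0 ≤ C := (norm_nonneg _).trans (hC1 0)
  have hC0' : 0 ≤ C' := (norm_nonneg _).trans (hC1' 0)
  have hC2 : ∀ j, ‖invQPoch (p ^ 2) j‖ ≤ C' := fun j ↦ by
    rw [invQPoch]; split_ifs
    · simpa using hC0'
    · exact hC1' _
  have hinvZ : ∀ n : ℤ, Filter.Tendsto (fun N : ℕ ↦ invQPoch (p ^ 2) (N + n)) Filter.atTop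
      (nhds L⁻¹) := fun n ↦ by
    have h1 : Filter.Tendsto (fun N : ℕ ↦ ((N : ℤ) + n).toNat) Filter.atTop Filter.atTop := by
      rw [Filter.tendsto_atTop]
      intro b
      filter_upwards [Filter.eventually_ge_atTop (b + n.natAbs)] with N hN
      omega
    refine (hinv.comp h1).congr' ?_
    filter_upwards [Filter.eventually_ge_atTop n.natAbs] with N hN
    rw [invQPoch, if_neg (by omega)]
    rfl
  have hsum : Filter.Tendsto (fun N : ℕ ↦ ∑' n : ℤ, qPoch (p ^ 2) (2 * N) *
      ((-1) ^ n * p ^ (n ^ 2) * ζ ^ n *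
        (invQPoch (p ^ 2) (N + n) * invQPoch (p ^ 2) (N - n)))) Filter.atTop
      (nhds (∑' n : ℤ, L * ((-1) ^ n * p ^ (n ^ 2) * ζ ^ n * (L⁻¹ * L⁻¹)))) := by
    refine tendsto_tsum_of_dominated_convergence
      (bound := fun n : ℤ ↦ C * (C' * C') * ‖p ^ (n ^ 2) * ζ ^ n‖)
      ((summable_tripleProduct_bound hp0 hp hζ).mul_left _) (fun n ↦ ?_)
      (Filter.Eventually.of_forall fun N n ↦ ?_)
    · have h2 : Filter.Tendsto (fun N : ℕ ↦ 2 * N) Filter.atTop Filter.atTop :=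
        Filter.tendsto_id.const_mul_atTop' two_pos
      have h3 := hinvZ (-n)
      simp only [← sub_eq_add_neg] at h3
      exact (hlim.comp h2).mul (((hinvZ n).mul h3).const_mul _)
    · rw [mul_assoc ((-1 : ℂ) ^ n), norm_mul, norm_mul, norm_mul ((-1 : ℂ) ^ n), norm_zpow,
        norm_neg, norm_one, one_zpow, one_mul, norm_mul (invQPoch _ _)]
      have := mul_le_mul (hC2 (N + n)) (hC2 (N - n)) (norm_nonneg _) hC0'
      calc _ ≤ C * (‖p ^ (n ^ 2) * ζ ^ n‖ * (C' * C')) :=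
            mul_le_mul (hC1 _) (mul_le_mul_of_nonneg_left this (norm_nonneg _))
              (by positivity) hC0
        _ = _ := by ring
  simp only [(hasSum_finite_tripleProduct hp0 hp hζ _).tsum_eq] at hsum
  have hprod : Filter.Tendsto (fun N ↦ ∏ m ∈ Finset.range N,
      ((1 - p ^ (2 * m + 1) * ζ) * (1 - p ^ (2 * m + 1) * ζ⁻¹))) Filter.atTop
      (nhds ((∏' m : ℕ, (1 - p ^ (2 * m + 1) * ζ)) * ∏' m : ℕ, (1 - p ^ (2 * m + 1) * ζ⁻¹))) :=
    ((multipliable_one_sub_pow_mul hp ζ 1).hasProd.mul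
      (multipliable_one_sub_pow_mul hp ζ⁻¹ 1).hasProd).tendsto_prod_nat
  rw [tendsto_nhds_unique hprod hsum, ← tsum_mul_left]
  refine tsum_congr fun n ↦ ?_
  field_simp


/-! ### Taylor series and residues -/

/-- The Taylor series of `f` at `0`, as a formal power series. It is meaningful for functions that
are analytic at `0`. -/
def taylorSeries (f : ℂ → ℂ) : PowerSeries ℂ :=
  PowerSeries.mk fun n ↦ iteratedDeriv n f 0 / (n.factorial : ℂ)

lemma coeff_taylorSeries (f : ℂ → ℂ) (n : ℕ) :
    (taylorSeries f).coeff n = iteratedDeriv n f 0 / (n.factorial : ℂ) :=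
  PowerSeries.coeff_mk _ _

lemma taylorSeries_congr {f g : ℂ → ℂ} (h : f =ᶠ[nhds 0] g) : taylorSeries f = taylorSeries g := by
  ext n
  rw [coeff_taylorSeries, coeff_taylorSeries, h.iteratedDeriv_eq]

lemma taylorSeries_add {f g : ℂ → ℂ} (hf : AnalyticAt ℂ f 0) (hg : AnalyticAt ℂ g 0) :
    taylorSeries (fun z ↦ f z + g z) = taylorSeries f + taylorSeries g := by
  ext n
  rw [map_add, coeff_taylorSeries, coeff_taylorSeries, coeff_taylorSeries, ← add_div]
  congr 1
  exact iteratedDeriv_fun_add hf.contDiffAt hg.contDiffAt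

lemma taylorSeries_mul {f g : ℂ → ℂ} (hf : AnalyticAt ℂ f 0) (hg : AnalyticAt ℂ g 0) :
    taylorSeries (fun z ↦ f z * g z) = taylorSeries f * taylorSeries g := by
  ext n
  rw [PowerSeries.coeff_mul, Finset.Nat.sum_antidiagonal_eq_sum_range_succ_mk, coeff_taylorSeries]
  have h := iteratedDeriv_mul (n := n) (hf.contDiffAt (n := n)) (hg.contDiffAt (n := n))
  rw [show (fun z ↦ f z * g z) = f * g from rfl, h, Finset.sum_div]
  refine Finset.sum_congr rfl fun i hi ↦ ?_
  have hi' : i ≤ n := Nat.lt_succ_iff.mp (Finset.mem_range.mp hi)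
  rw [coeff_taylorSeries, coeff_taylorSeries, Nat.choose_eq_factorial_div_factorial hi',
    Nat.cast_div (Nat.factorial_mul_factorial_dvd_factorial hi')
      (by exact_mod_cast (Nat.mul_ne_zero i.factorial_ne_zero (n - i).factorial_ne_zero))]
  have h1 : (n.factorial : ℂ) ≠ 0 := by exact_mod_cast n.factorial_ne_zero
  have h2 : (i.factorial : ℂ) ≠ 0 := by exact_mod_cast i.factorial_ne_zero
  have h3 : ((n - i).factorial : ℂ) ≠ 0 := by exact_mod_cast (n - i).factorial_ne_zero
  push_cast
  field_simp

lemma taylorSeries_const (c : ℂ) : taylorSeries (fun _ ↦ c) = PowerSeries.C c := by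
  ext n
  rw [coeff_taylorSeries, PowerSeries.coeff_C, iteratedDeriv_const]
  split_ifs with h
  · simp [h]
  · simp

lemma taylorSeries_pow {f : ℂ → ℂ} (hf : AnalyticAt ℂ f 0) (n : ℕ) :
    taylorSeries (fun z ↦ f z ^ n) = taylorSeries f ^ n := by
  induction n with
  | zero => simpa using taylorSeries_const 1
  | succ n ih =>
    simp only [pow_succ]
    rw [taylorSeries_mul (hf.fun_pow n) hf, ih]

lemma taylorSeries_id : taylorSeries (fun z ↦ z) = PowerSeries.X := by
  ext n
  rw [coeff_taylorSeries, PowerSeries.coeff_X]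
  rcases n with _ | _ | n
  · simp
  · simp [iteratedDeriv_one]
  · have : deriv (fun z : ℂ ↦ z) = fun _ ↦ 1 := by funext z; simp
    simp only [iteratedDeriv_succ', this, deriv_const']
    simp

lemma taylorSeries_exp_mul (c : ℂ) (n : ℕ) :
    (taylorSeries fun z ↦ Complex.exp (c * z)).coeff n = c ^ n / (n.factorial : ℂ) := by
  rw [coeff_taylorSeries, iteratedDeriv_cexp_const_mul]
  simp

lemma taylorSeries_deriv (f : ℂ → ℂ) :
    taylorSeries (deriv f) = PowerSeries.derivative ℂ (taylorSeries f) := by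
  ext n
  rw [PowerSeries.coeff_derivative, coeff_taylorSeries, coeff_taylorSeries, iteratedDeriv_succ',
    Nat.factorial_succ]
  have : ((n : ℂ) + 1) ≠ 0 := by exact_mod_cast n.succ_ne_zero
  push_cast
  field_simp

lemma eq_add_mul_dslope (f : ℂ → ℂ) (z : ℂ) : f z = f 0 + z * dslope f 0 z := by
  have := sub_smul_dslope f 0 z
  simp only [sub_zero, smul_eq_mul] at this
  rw [this]; ring

lemma analyticAt_dslope {f : ℂ → ℂ} (hf : AnalyticAt ℂ f 0) : AnalyticAt ℂ (dslope f 0) 0 := by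
  obtain ⟨p, hp⟩ := hf
  exact ⟨_, hp.has_fpower_series_dslope_fslope⟩

lemma taylorSeries_eq_add_X_mul {f : ℂ → ℂ} (hf : AnalyticAt ℂ f 0) :
    taylorSeries f = PowerSeries.C (f 0) + PowerSeries.X * taylorSeries (dslope f 0) := by
  have h : f = fun z ↦ f 0 + z * dslope f 0 z := funext (eq_add_mul_dslope f)
  conv_lhs => rw [h]
  have hid : AnalyticAt ℂ (fun z : ℂ ↦ z) 0 := analyticAt_id
  rw [taylorSeries_add analyticAt_const (hid.fun_mul (analyticAt_dslope hf)),
    taylorSeries_const, taylorSeries_mul hid (analyticAt_dslope hf), taylorSeries_id]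

/-- The integral of `F` along the boundary of the rectangle `[-a, a] × [-b, b]`, run through
counterclockwise. -/
def rectIntegral (a b : ℝ) (F : ℂ → ℂ) : ℂ :=
  (((∫ x in (-a)..a, F (x + ((-b : ℝ) : ℂ) * Complex.I)) -
    ∫ x in (-a)..a, F (x + (b : ℂ) * Complex.I)) +
    Complex.I * ∫ y in (-b)..b, F ((a : ℂ) + y * Complex.I)) -
    Complex.I * ∫ y in (-b)..b, F (((-a : ℝ) : ℂ) + y * Complex.I)

/-- The closed rectangle `[-a, a] × [-b, b]`. -/
def closedRect (a b : ℝ) : Set ℂ := {z | |z.re| ≤ a ∧ |z.im| ≤ b}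

section Rectangle

variable {a b : ℝ}

lemma rectIntegral_eq_zero (ha : 0 < a) (hb : 0 < b) {F : ℂ → ℂ}
    (hF : DifferentiableOn ℂ F (closedRect a b)) : rectIntegral a b F = 0 := by
  have h := Complex.integral_boundary_rect_eq_zero_of_differentiableOn F
    ⟨-a, -b⟩ ⟨a, b⟩ (hF.mono ?_)
  · simpa [rectIntegral] using h
  · rintro z ⟨h1, h2⟩
    simp only [Set.mem_preimage, Set.uIcc_of_le (neg_le_self ha.le),
      Set.uIcc_of_le (neg_le_self hb.le)] at h1 h2
    exact ⟨abs_le.mpr h1, abs_le.mpr h2⟩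

/-- A function which is continuous away from the centre is integrable along the four sides. -/
lemma intervalIntegrable_sides (ha : 0 < a) (hb : 0 < b) {F : ℂ → ℂ}
    (hF : ContinuousOn F (closedRect a b \ {0})) :
    (IntervalIntegrable (fun x : ℝ ↦ F (x + ((-b : ℝ) : ℂ) * Complex.I))
        MeasureTheory.volume (-a) a ∧
      IntervalIntegrable (fun x : ℝ ↦ F (x + (b : ℂ) * Complex.I))
        MeasureTheory.volume (-a) a) ∧
    IntervalIntegrable (fun y : ℝ ↦ F ((a : ℂ) + y * Complex.I)) MeasureTheory.volume (-b) b ∧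
      IntervalIntegrable (fun y : ℝ ↦ F (((-a : ℝ) : ℂ) + y * Complex.I))
        MeasureTheory.volume (-b) b := by
  have hor : ∀ c : ℝ, |c| = b → IntervalIntegrable (fun x : ℝ ↦ F (x + (c : ℂ) * Complex.I))
      MeasureTheory.volume (-a) a := fun c hc ↦ by
    refine ContinuousOn.intervalIntegrable (hF.comp (by fun_prop) fun x hx ↦ ?_)
    rw [Set.uIcc_of_le (neg_le_self ha.le)] at hx
    refine ⟨⟨by simpa using abs_le.mpr hx, by simpa using hc.le⟩, fun h0 ↦ ?_⟩
    have : c = 0 := by simpa using congrArg Complex.im (Set.mem_singleton_iff.mp h0)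
    simp [this] at hc
    linarith
  have ver : ∀ c : ℝ, |c| = a → IntervalIntegrable (fun y : ℝ ↦ F ((c : ℂ) + y * Complex.I))
      MeasureTheory.volume (-b) b := fun c hc ↦ by
    refine ContinuousOn.intervalIntegrable (hF.comp (by fun_prop) fun x hx ↦ ?_)
    rw [Set.uIcc_of_le (neg_le_self hb.le)] at hx
    refine ⟨⟨by simpa using hc.le, by simpa using abs_le.mpr hx⟩, fun h0 ↦ ?_⟩
    have : c = 0 := by simpa using congrArg Complex.re (Set.mem_singleton_iff.mp h0)
    simp [this] at hc
    linarith
  exact ⟨⟨hor _ (by rw [abs_neg, abs_of_pos hb]), hor _ (abs_of_pos hb)⟩,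
    ver _ (abs_of_pos ha), ver _ (by rw [abs_neg, abs_of_pos ha])⟩

lemma rectIntegral_add (ha : 0 < a) (hb : 0 < b) {F G : ℂ → ℂ}
    (hF : ContinuousOn F (closedRect a b \ {0})) (hG : ContinuousOn G (closedRect a b \ {0})) :
    rectIntegral a b (fun z ↦ F z + G z) = rectIntegral a b F + rectIntegral a b G := by
  obtain ⟨⟨f1, f2⟩, f3, f4⟩ := intervalIntegrable_sides ha hb hF
  obtain ⟨⟨g1, g2⟩, g3, g4⟩ := intervalIntegrable_sides ha hb hG
  unfold rectIntegral
  rw [intervalIntegral.integral_add f1 g1, intervalIntegral.integral_add f2 g2,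
    intervalIntegral.integral_add f3 g3, intervalIntegral.integral_add f4 g4]
  ring

lemma rectIntegral_const_mul (a b : ℝ) (c : ℂ) (F : ℂ → ℂ) :
    rectIntegral a b (fun z ↦ c * F z) = c * rectIntegral a b F := by
  unfold rectIntegral
  simp only [intervalIntegral.integral_const_mul]
  ring

lemma rectIntegral_congr (ha : 0 < a) (hb : 0 < b) {F G : ℂ → ℂ}
    (h : ∀ z ∈ closedRect a b \ {0}, F z = G z) : rectIntegral a b F = rectIntegral a b G := by
  have hor : ∀ c : ℝ, |c| = b → ∫ x in (-a)..a, F (x + (c : ℂ) * Complex.I) =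
      ∫ x in (-a)..a, G (x + (c : ℂ) * Complex.I) := fun c hc ↦ by
    refine intervalIntegral.integral_congr fun x hx ↦ h _ ?_
    rw [Set.uIcc_of_le (neg_le_self ha.le)] at hx
    refine ⟨⟨by simpa using abs_le.mpr hx, by simpa using hc.le⟩, fun h0 ↦ ?_⟩
    have : c = 0 := by simpa using congrArg Complex.im (Set.mem_singleton_iff.mp h0)
    simp [this] at hc
    linarith
  have ver : ∀ c : ℝ, |c| = a → ∫ y in (-b)..b, F ((c : ℂ) + y * Complex.I) =
      ∫ y in (-b)..b, G ((c : ℂ) + y * Complex.I) := fun c hc ↦ by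
    refine intervalIntegral.integral_congr fun x hx ↦ h _ ?_
    rw [Set.uIcc_of_le (neg_le_self hb.le)] at hx
    refine ⟨⟨by simpa using hc.le, by simpa using abs_le.mpr hx⟩, fun h0 ↦ ?_⟩
    have : c = 0 := by simpa using congrArg Complex.re (Set.mem_singleton_iff.mp h0)
    simp [this] at hc
    linarith
  unfold rectIntegral
  rw [hor (-b) (by rw [abs_neg, abs_of_pos hb]), hor b (abs_of_pos hb), ver a (abs_of_pos ha),
    ver (-a) (by rw [abs_neg, abs_of_pos ha])]

/-- The boundary integral of a function with a primitive off the origin vanishes. -/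
lemma rectIntegral_eq_zero_of_hasDerivAt (ha : 0 < a) (hb : 0 < b) {F G : ℂ → ℂ}
    (hF : ContinuousOn F (closedRect a b \ {0})) (h : ∀ z ≠ 0, HasDerivAt G (F z) z) :
    rectIntegral a b F = 0 := by
  obtain ⟨⟨f1, f2⟩, f3, f4⟩ := intervalIntegrable_sides ha hb hF
  have hor : ∀ c : ℝ, c ≠ 0 → ∀ x : ℝ,
      HasDerivAt (fun x : ℝ ↦ G (x + (c : ℂ) * Complex.I)) (F (x + (c : ℂ) * Complex.I)) x :=
    fun c hc x ↦ by
      have h1 := h (x + (c : ℂ) * Complex.I) fun h0 ↦ hc (by simpa using congrArg Complex.im h0)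
      have h2 : HasDerivAt (fun x : ℝ ↦ (x : ℂ) + (c : ℂ) * Complex.I) 1 x :=
        (Complex.ofRealCLM.hasDerivAt (x := x)).add_const _
      have h3 := HasDerivAt.comp x h1 h2
      rw [mul_one] at h3
      exact h3
  have ver : ∀ c : ℝ, c ≠ 0 → ∀ y : ℝ,
      HasDerivAt (fun y : ℝ ↦ G ((c : ℂ) + y * Complex.I))
        (F ((c : ℂ) + y * Complex.I) * Complex.I) y :=
    fun c hc y ↦ by
      have h1 := h ((c : ℂ) + y * Complex.I) fun h0 ↦ hc (by simpa using congrArg Complex.re h0)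
      have h2 : HasDerivAt (fun y : ℝ ↦ (c : ℂ) + (y : ℂ) * Complex.I) Complex.I y := by
        simpa using ((Complex.ofRealCLM.hasDerivAt (x := y)).mul_const Complex.I).const_add (c : ℂ)
      exact h1.comp y h2
  have i1 := intervalIntegral.integral_eq_sub_of_hasDerivAt (fun x _ ↦ hor (-b) (by linarith) x) f1
  have i2 := intervalIntegral.integral_eq_sub_of_hasDerivAt (fun x _ ↦ hor b hb.ne' x) f2
  have i3 := intervalIntegral.integral_eq_sub_of_hasDerivAt (fun x _ ↦ ver a ha.ne' x)
    (f3.mul_const Complex.I)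
  have i4 := intervalIntegral.integral_eq_sub_of_hasDerivAt (fun x _ ↦ ver (-a) (by linarith) x)
    (f4.mul_const Complex.I)
  rw [intervalIntegral.integral_mul_const, mul_comm] at i3 i4
  rw [rectIntegral, i1, i2, i3, i4]
  ring

lemma rectIntegral_inv_pow (ha : 0 < a) (hb : 0 < b) (n : ℕ) :
    rectIntegral a b (fun z ↦ (z ^ (n + 2))⁻¹) = 0 := by
  refine rectIntegral_eq_zero_of_hasDerivAt ha hb
    (G := fun z ↦ (-((n : ℂ) + 1))⁻¹ * z ^ (-((n : ℤ) + 1))) ?_ fun z hz ↦ ?_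
  · refine ContinuousOn.inv₀ (by fun_prop) fun z hz ↦ pow_ne_zero _ hz.2
  · have h := (hasDerivAt_zpow (-((n : ℤ) + 1)) z (Or.inl hz)).const_mul (-((n : ℂ) + 1))⁻¹
    refine h.congr_deriv ?_
    have hn : (-((n : ℂ) + 1)) ≠ 0 := neg_ne_zero.mpr (by exact_mod_cast n.succ_ne_zero)
    push_cast
    rw [← mul_assoc, inv_mul_cancel₀ hn, one_mul, ← zpow_natCast, ← zpow_neg]
    congr 1

/-- The value is `2 π i`, but it is enough to see that it is `i` times a positive number: opposite
sides combine to integrals of the positive functions `2 b / (x ^ 2 + b ^ 2)` and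
`2 a / (y ^ 2 + a ^ 2)`. -/
lemma rectIntegral_inv_ne_zero (ha : 0 < a) (hb : 0 < b) :
    rectIntegral a b (fun z ↦ z⁻¹) ≠ 0 := by
  have hc : ContinuousOn (fun z : ℂ ↦ z⁻¹) (closedRect a b \ {0}) :=
    ContinuousOn.inv₀ continuousOn_id fun z hz ↦ hz.2
  obtain ⟨⟨f1, f2⟩, f3, f4⟩ := intervalIntegrable_sides ha hb hc
  have key : ∀ c d : ℝ, 0 < c → 0 < d → 0 < ∫ x in (-d)..d, 2 * c / (x ^ 2 + c ^ 2) :=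
    fun c d hc hd ↦ by
      refine intervalIntegral.intervalIntegral_pos_of_pos_on ?_ (fun x _ ↦ by positivity)
        (by linarith)
      refine Continuous.intervalIntegrable ?_ _ _
      exact Continuous.div (by fun_prop) (by fun_prop) fun x ↦ by positivity
  have e1 : (∫ x in (-a)..a, ((x : ℂ) + ((-b : ℝ) : ℂ) * Complex.I)⁻¹) -
      ∫ x in (-a)..a, ((x : ℂ) + (b : ℂ) * Complex.I)⁻¹ =
      Complex.I * ((∫ x in (-a)..a, 2 * b / (x ^ 2 + b ^ 2) : ℝ) : ℂ) := by
    rw [← intervalIntegral.integral_sub f1 f2, ← intervalIntegral.integral_ofReal,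
      ← intervalIntegral.integral_const_mul]
    refine intervalIntegral.integral_congr fun x _ ↦ ?_
    have h1 : (x : ℂ) + ((-b : ℝ) : ℂ) * Complex.I ≠ 0 := fun h0 ↦ hb.ne' (by
      simpa using congrArg Complex.im h0)
    have h2 : (x : ℂ) + (b : ℂ) * Complex.I ≠ 0 := fun h0 ↦ hb.ne' (by
      simpa using congrArg Complex.im h0)
    have h3 : (x : ℂ) ^ 2 + b ^ 2 ≠ 0 := by
      have : x ^ 2 + b ^ 2 ≠ 0 := by positivity
      exact_mod_cast this
    have h4 : (x : ℂ) ^ 2 + b ^ 2 =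
        (x + ((-b : ℝ) : ℂ) * Complex.I) * (x + (b : ℂ) * Complex.I) := by
      push_cast
      linear_combination ((b : ℂ) ^ 2) * Complex.I_sq
    push_cast
    push_cast at h1 h4
    rw [inv_sub_inv h1 h2, ← h4, ← mul_div_assoc]
    congr 1
    ring
  have e2 : (∫ y in (-b)..b, ((a : ℂ) + y * Complex.I)⁻¹) -
      ∫ y in (-b)..b, (((-a : ℝ) : ℂ) + y * Complex.I)⁻¹ =
      ((∫ y in (-b)..b, 2 * a / (y ^ 2 + a ^ 2) : ℝ) : ℂ) := by
    rw [← intervalIntegral.integral_sub f3 f4, ← intervalIntegral.integral_ofReal]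
    refine intervalIntegral.integral_congr fun y _ ↦ ?_
    have h1 : (a : ℂ) + y * Complex.I ≠ 0 := fun h0 ↦ ha.ne' (by
      simpa using congrArg Complex.re h0)
    have h2 : ((-a : ℝ) : ℂ) + y * Complex.I ≠ 0 := fun h0 ↦ ha.ne' (by
      simpa using congrArg Complex.re h0)
    have h4 : (y : ℂ) ^ 2 + a ^ 2 =
        -((a + y * Complex.I) * (((-a : ℝ) : ℂ) + y * Complex.I)) := by
      push_cast
      linear_combination (y : ℂ) ^ 2 * Complex.I_sq
    push_cast
    push_cast at h2 h4
    rw [inv_sub_inv h1 h2, h4, div_neg, ← neg_div]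
    congr 1
    ring
  have e : rectIntegral a b (fun z ↦ z⁻¹) = Complex.I *
      (((∫ x in (-a)..a, 2 * b / (x ^ 2 + b ^ 2)) +
        ∫ y in (-b)..b, 2 * a / (y ^ 2 + a ^ 2) : ℝ) : ℂ) := by
    rw [rectIntegral, add_sub_assoc, ← mul_sub, e1, e2]
    push_cast
    ring
  rw [e]
  refine mul_ne_zero Complex.I_ne_zero ?_
  exact_mod_cast (add_pos (key b a hb ha) (key a b ha hb)).ne'

/-- The residue theorem for a single pole at the centre of a rectangle, by induction on the order
of the pole: `w(z) = w(0) + z dslope w 0 z`. -/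
lemma rectIntegral_div_pow (ha : 0 < a) (hb : 0 < b) {U : Set ℂ} (hU : IsOpen U)
    (hR : closedRect a b ⊆ U) {w : ℂ → ℂ} (hw : DifferentiableOn ℂ w U) (n : ℕ) :
    rectIntegral a b (fun z ↦ w z / z ^ (n + 1)) =
      (taylorSeries w).coeff n * rectIntegral a b fun z ↦ z⁻¹ := by
  have h0 : (0 : ℂ) ∈ U := hR ⟨by simpa using ha.le, by simpa using hb.le⟩
  induction n generalizing w with
  | zero =>
    have hd : DifferentiableOn ℂ (dslope w 0) U :=
      (Complex.differentiableOn_dslope (hU.mem_nhds h0)).mpr hw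
    have e : rectIntegral a b (fun z ↦ w z / z ^ (0 + 1)) =
        rectIntegral a b fun z ↦ w 0 * z⁻¹ + dslope w 0 z := by
      refine rectIntegral_congr ha hb fun z hz ↦ ?_
      have hz0 : z ≠ 0 := hz.2
      conv_lhs => rw [eq_add_mul_dslope w z]
      field_simp
      ring
    rw [e, rectIntegral_add ha hb, rectIntegral_const_mul, rectIntegral_eq_zero ha hb (hd.mono hR)]
    · simp [coeff_taylorSeries]
    · exact continuousOn_const.mul (ContinuousOn.inv₀ continuousOn_id fun z hz ↦ hz.2)
    · exact (hd.mono hR).continuousOn.mono Set.sdiff_subset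
  | succ n ih =>
    have hd : DifferentiableOn ℂ (dslope w 0) U :=
      (Complex.differentiableOn_dslope (hU.mem_nhds h0)).mpr hw
    have e : rectIntegral a b (fun z ↦ w z / z ^ (n + 1 + 1)) =
        rectIntegral a b fun z ↦ w 0 * (z ^ (n + 2))⁻¹ + dslope w 0 z / z ^ (n + 1) := by
      refine rectIntegral_congr ha hb fun z hz ↦ ?_
      have hz0 : z ≠ 0 := hz.2
      conv_lhs => rw [eq_add_mul_dslope w z]
      field_simp
      ring
    rw [e, rectIntegral_add ha hb, rectIntegral_const_mul, rectIntegral_inv_pow ha hb, ih hd,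
      taylorSeries_eq_add_X_mul (hw.analyticAt (hU.mem_nhds h0)), map_add,
      PowerSeries.coeff_C, PowerSeries.coeff_succ_X_mul]
    · simp
    · exact continuousOn_const.mul (ContinuousOn.inv₀ (by fun_prop) fun z hz ↦ pow_ne_zero _ hz.2)
    · exact ContinuousOn.div ((hd.mono hR).continuousOn.mono Set.sdiff_subset) (by fun_prop)
        fun z hz ↦ pow_ne_zero _ hz.2

end Rectangle

/-- The sum of the residues of a doubly periodic function vanishes: if the periods are `2 π i` and
`2 π i τ`, the integrals along opposite sides of the rectangle `[-π Im τ, π Im τ] × [-π, π]`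
cancel. -/
lemma rectIntegral_eq_zero_of_periodic (τ : ℍ) {F : ℂ → ℂ}
    (h1 : ∀ z, F (z + 2 * Real.pi * Complex.I) = F z)
    (h2 : ∀ z, F (z + 2 * Real.pi * Complex.I * τ) = F z) :
    rectIntegral (Real.pi * τ.im) Real.pi F = 0 := by
  have hor : ∀ x : ℝ, F (x + ((-Real.pi : ℝ) : ℂ) * Complex.I) =
      F (x + (Real.pi : ℂ) * Complex.I) := fun x ↦ by
    rw [← h1]; congr 1; push_cast; ring
  have hper : Function.Periodic
      (fun y : ℝ ↦ F (((-(Real.pi * τ.im) : ℝ) : ℂ) + y * Complex.I)) (2 * Real.pi) := fun y ↦ by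
    dsimp only
    rw [← h1 (_ + (y : ℂ) * Complex.I)]; congr 1; push_cast; ring
  have hτ : (τ : ℂ) = τ.re + τ.im * Complex.I := (Complex.re_add_im _).symm
  have ver : ∀ y : ℝ, F (((Real.pi * τ.im : ℝ) : ℂ) + y * Complex.I) =
      F (((-(Real.pi * τ.im) : ℝ) : ℂ) + ((y + 2 * Real.pi * τ.re : ℝ) : ℂ) * Complex.I) :=
    fun y ↦ by
      rw [← h2]; congr 1; rw [hτ]; push_cast
      linear_combination (2 * Real.pi * τ.im : ℂ) * Complex.I_sq
  have hshift := hper.intervalIntegral_add_eq (-Real.pi + 2 * Real.pi * τ.re) (-Real.pi)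
  unfold rectIntegral
  simp only [hor, ver]
  rw [intervalIntegral.integral_comp_add_right
    (fun y : ℝ ↦ F (((-(Real.pi * τ.im) : ℝ) : ℂ) + y * Complex.I))]
  rw [show -Real.pi + 2 * Real.pi * τ.re + 2 * Real.pi = Real.pi + 2 * Real.pi * τ.re by ring,
    show -Real.pi + 2 * Real.pi = Real.pi by ring] at hshift
  rw [hshift]
  ring


/-! ### Eisenstein series -/

lemma norm_nome_lt_one (τ : ℍ) : ‖nome τ‖ < 1 := norm_exp_two_pi_I_lt_one τ

lemma norm_nome (τ : ℍ) : ‖nome τ‖ = Real.exp (-(2 * Real.pi * τ.im)) := by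
  rw [nome, Complex.norm_exp]
  congr 1
  have : (2 * Real.pi * Complex.I * (τ : ℂ)) = ((2 * Real.pi : ℝ) : ℂ) * (Complex.I * τ) := by
    push_cast; ring
  rw [this, Complex.re_ofReal_mul, Complex.I_mul_re]
  simp

/-- The map `τ ↦ 2 τ` of the upper half-plane. -/
def double (τ : ℍ) : ℍ := ⟨2 * (τ : ℂ), by simpa using τ.2⟩

lemma coe_double (τ : ℍ) : (double τ : ℂ) = 2 * τ := rfl

lemma im_double (τ : ℍ) : (double τ).im = 2 * τ.im := by
  change (2 * (τ : ℂ)).im = _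
  simp

lemma nome_double (τ : ℍ) : nome (double τ) = nome τ ^ 2 := by
  rw [nome, nome, ← Complex.exp_nat_mul, coe_double]
  congr 1
  push_cast
  ring

/-- Composition with `τ ↦ 2 τ`, as a ring homomorphism. -/
def doubleHom : (ℍ → ℂ) →+* (ℍ → ℂ) where
  toFun f := f ∘ double
  map_one' := rfl
  map_mul' _ _ := rfl
  map_zero' := rfl
  map_add' _ _ := rfl

lemma doubleHom_apply (f : ℍ → ℂ) (τ : ℍ) : doubleHom f τ = f (double τ) := rfl

lemma doubleHom_comp_ofComplex (f : ℍ → ℂ) {w : ℂ} (hw : 0 < w.im) :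
    (doubleHom f ∘ ofComplex) w = (f ∘ ofComplex) (2 * w) := by
  have h2 : 0 < (2 * w).im := by simpa using hw
  simp only [Function.comp_apply, doubleHom_apply, ofComplex_apply_of_im_pos hw,
    ofComplex_apply_of_im_pos h2]
  rfl

lemma mdifferentiable_doubleHom {f : ℍ → ℂ} (hf : MDifferentiable 𝓘(ℂ) 𝓘(ℂ) f) :
    MDifferentiable 𝓘(ℂ) 𝓘(ℂ) (doubleHom f) := by
  rw [UpperHalfPlane.mdifferentiable_iff] at hf ⊢
  have h : DifferentiableOn ℂ (fun w ↦ (f ∘ ofComplex) (2 * w)) upperHalfPlaneSet :=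
    hf.comp (by fun_prop) fun w hw ↦ by
      have : 0 < w.im := hw
      change 0 < (2 * w).im
      simpa using this
  exact h.congr fun w hw ↦ doubleHom_comp_ofComplex f hw

lemma qD_doubleHom (f : ℍ → ℂ) : qD (doubleHom f) = (2 : ℂ) • doubleHom (qD f) := by
  funext τ
  have h : (doubleHom f ∘ ofComplex) =ᶠ[nhds (τ : ℂ)] fun w ↦ (f ∘ ofComplex) (2 * w) := by
    filter_upwards [isOpen_upperHalfPlaneSet.mem_nhds τ.2] with w hw
    exact doubleHom_comp_ofComplex f hw
  rw [qD, Derivative.normalizedDerivOfComplex, h.deriv_eq, deriv_comp_mul_left]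
  simp only [Pi.smul_apply, smul_eq_mul, doubleHom_apply, qD, Derivative.normalizedDerivOfComplex,
    coe_double]
  ring

lemma summable_lambert {q : ℂ} (hq : ‖q‖ < 1) (a : ℕ) :
    Summable fun n : ℕ ↦ ‖((n : ℂ) + 1) ^ a * q ^ (n + 1) / (1 - q ^ (n + 1))‖ := by
  have h := (summable_nat_add_iff 1).mpr
    (summable_norm_pow_mul_geometric_div_one_sub (𝕜 := ℂ) a hq).norm
  simpa using h

lemma lambert_eq_tsum_sigma {q : ℂ} (hq : ‖q‖ < 1) (a : ℕ) :
    ∑' n : ℕ, ((n : ℂ) + 1) ^ a * q ^ (n + 1) / (1 - q ^ (n + 1)) =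
      ∑' n : ℕ+, (ArithmeticFunction.sigma a n : ℂ) * q ^ (n : ℕ) := by
  rw [← tsum_pow_div_one_sub_eq_tsum_sigma hq,
    tsum_pnat_eq_tsum_succ (f := fun n : ℕ ↦ (n : ℂ) ^ a * q ^ n / (1 - q ^ n))]
  simp

/-- Even Bernoulli numbers are nonzero because `ζ(2l)` is. -/
lemma bernoulli_two_mul_ne_zero {l : ℕ} (hl : 1 ≤ l) : (bernoulli (2 * l) : ℂ) ≠ 0 := by
  intro h
  have h1 := riemannZeta_two_mul_nat (k := l) (by omega)
  rw [h, mul_zero, zero_div] at h1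
  refine riemannZeta_ne_zero_of_one_le_re ?_ h1
  have : (1 : ℝ) ≤ 2 * l := by
    have : (1 : ℝ) ≤ l := by exact_mod_cast hl
    linarith
  simpa using this

lemma eisE_one : eisE 1 = (1 / 24 : ℂ) • EisensteinSeries.E2 := by
  funext τ
  rw [eisE, lambert_eq_tsum_sigma (norm_nome_lt_one τ), Pi.smul_apply,
    EisensteinSeries.E2_eq_tsum_cexp, mul_one, bernoulli_two]
  simp only [nome, smul_eq_mul]
  push_cast
  ring

lemma eisE_eq_smul_E {l : ℕ} (hl : 3 ≤ 2 * l) :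
    eisE l = ((bernoulli (2 * l) : ℂ) / (4 * l)) • (ModularForm.E hl : ℍ → ℂ) := by
  funext τ
  have hb := bernoulli_two_mul_ne_zero (l := l) (by omega)
  have hl0 : (l : ℂ) ≠ 0 := by exact_mod_cast (show l ≠ 0 by omega)
  rw [eisE, lambert_eq_tsum_sigma (norm_nome_lt_one τ), Pi.smul_apply,
    EisensteinSeries.q_expansion_bernoulli hl (even_two_mul l)]
  simp only [nome, smul_eq_mul, zpow_natCast]
  push_cast
  field_simp
  ring

lemma mdifferentiable_eisE {l : ℕ} (hl : 1 ≤ l) : MDifferentiable 𝓘(ℂ) 𝓘(ℂ) (eisE l) := by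
  rcases hl.eq_or_lt with rfl | h
  · rw [eisE_one]
    exact E2_mdifferentiable.const_smul _
  · rw [eisE_eq_smul_E (by omega)]
    exact (ModularForm.E (show 3 ≤ 2 * l by omega)).holo'.const_smul _

lemma one_add_pow_ne_zero {q : ℂ} (hq : ‖q‖ < 1) (n : ℕ) : 1 + q ^ (n + 1) ≠ 0 := by
  intro h
  have h1 : ‖q ^ (n + 1)‖ = 1 := by rw [← norm_neg, ← eq_neg_of_add_eq_zero_left h, norm_one]
  rw [norm_pow] at h1
  exact absurd h1 (pow_lt_one₀ (norm_nonneg _) hq (by omega)).ne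

/-- `E_{2l,1}(τ) = 2 E_{2l}(2 τ) - E_{2l}(τ)`, because
`x / (1 + x) = x / (1 - x) - 2 x ^ 2 / (1 - x ^ 2)`. -/
lemma eisE1_eq (l : ℕ) : eisE1 l = (2 : ℚ) • doubleHom (eisE l) + (-1 : ℚ) • eisE l := by
  funext τ
  have hq := norm_nome_lt_one τ
  have hq2 : ‖nome τ ^ 2‖ < 1 := by
    rw [norm_pow]; exact pow_lt_one₀ (norm_nonneg _) hq two_ne_zero
  have key : ∑' n : ℕ, ((n : ℂ) + 1) ^ (2 * l - 1) * nome τ ^ (n + 1) / (1 + nome τ ^ (n + 1)) =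
      ∑' n : ℕ, ((n : ℂ) + 1) ^ (2 * l - 1) * nome τ ^ (n + 1) / (1 - nome τ ^ (n + 1)) -
      2 * ∑' n : ℕ, ((n : ℂ) + 1) ^ (2 * l - 1) * (nome τ ^ 2) ^ (n + 1) /
        (1 - (nome τ ^ 2) ^ (n + 1)) := by
    rw [← tsum_mul_left, ← (summable_lambert hq _).of_norm.tsum_sub
      ((summable_lambert hq2 _).of_norm.mul_left 2)]
    refine tsum_congr fun n ↦ ?_
    have h1 := one_sub_pow_succ_ne_zero hq n
    have h2 := one_add_pow_ne_zero hq n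
    have h3 : 1 - (nome τ ^ 2) ^ (n + 1) = (1 - nome τ ^ (n + 1)) * (1 + nome τ ^ (n + 1)) := by
      ring
    rw [h3]
    field_simp
    ring
  rw [eisE1, key]
  simp only [Pi.add_apply, Pi.smul_apply, doubleHom_apply, eisE, nome_double, Rat.smul_def]
  push_cast
  ring

lemma mdifferentiable_eisE1 {l : ℕ} (hl : 1 ≤ l) : MDifferentiable 𝓘(ℂ) 𝓘(ℂ) (eisE1 l) := by
  have h := mdifferentiable_eisE hl
  have e : eisE1 l = (2 : ℂ) • doubleHom (eisE l) + (-1 : ℂ) • eisE l := by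
    rw [eisE1_eq]
    funext τ
    simp [Rat.smul_def]
  rw [e]
  exact ((mdifferentiable_doubleHom h).const_smul _).add (h.const_smul _)

/-- The Dedekind eta function on the upper half-plane. -/
def etaH (τ : ℍ) : ℂ := ModularForm.eta τ

lemma etaH_ne_zero (τ : ℍ) : etaH τ ≠ 0 := ModularForm.eta_ne_zero τ.2

lemma mdifferentiable_etaH : MDifferentiable 𝓘(ℂ) 𝓘(ℂ) etaH := by
  rw [UpperHalfPlane.mdifferentiable_iff]
  intro w hw
  refine ((ModularForm.differentiableAt_eta_of_mem_upperHalfPlaneSet hw).congr_of_eventuallyEq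
    ?_).differentiableWithinAt
  filter_upwards [isOpen_upperHalfPlaneSet.mem_nhds hw] with v hv
  simp [etaH, ofComplex_apply_of_im_pos hv]

lemma qD_etaH : qD etaH = eisE 1 * etaH := by
  funext τ
  have h : (etaH ∘ ofComplex) =ᶠ[nhds (τ : ℂ)] ModularForm.eta := by
    filter_upwards [isOpen_upperHalfPlaneSet.mem_nhds τ.2] with v hv
    simp [etaH, ofComplex_apply_of_im_pos hv]
  have h1 := ModularForm.logDeriv_eta_eq_E2 τ
  have h0 : ModularForm.eta (τ : ℂ) ≠ 0 := etaH_ne_zero τ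
  rw [logDeriv_apply, div_eq_iff h0] at h1
  rw [qD, Derivative.normalizedDerivOfComplex, h.deriv_eq, h1, eisE_one]
  have := Complex.two_pi_I_ne_zero
  simp only [Pi.mul_apply, Pi.smul_apply, smul_eq_mul, etaH]
  field_simp
  ring

lemma weberF1_eq : weberF1 = doubleHom etaH / etaH := rfl

lemma weberF1_ne_zero (τ : ℍ) : weberF1 τ ≠ 0 :=
  div_ne_zero (etaH_ne_zero (double τ)) (etaH_ne_zero τ)

/-- The quotient of holomorphic functions, with nonvanishing denominator, is holomorphic. -/
lemma mdifferentiable_div {f g : ℍ → ℂ} (hf : MDifferentiable 𝓘(ℂ) 𝓘(ℂ) f)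
    (hg : MDifferentiable 𝓘(ℂ) 𝓘(ℂ) g) (h0 : ∀ τ, g τ ≠ 0) :
    MDifferentiable 𝓘(ℂ) 𝓘(ℂ) (f / g) := by
  rw [UpperHalfPlane.mdifferentiable_iff] at hf hg ⊢
  exact hf.div hg fun w _ ↦ h0 _

lemma mdifferentiable_weberF1 : MDifferentiable 𝓘(ℂ) 𝓘(ℂ) weberF1 := by
  rw [weberF1_eq]
  exact mdifferentiable_div (mdifferentiable_doubleHom mdifferentiable_etaH) mdifferentiable_etaH
    etaH_ne_zero

/-- The quotient rule for logarithmic derivatives. -/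
lemma qD_div_of_logDeriv {f g u v : ℍ → ℂ} (hf : MDifferentiable 𝓘(ℂ) 𝓘(ℂ) f)
    (hg : MDifferentiable 𝓘(ℂ) 𝓘(ℂ) g) (h0 : ∀ τ, g τ ≠ 0) (hu : qD f = u * f)
    (hv : qD g = v * g) : qD (f / g) = (u - v) * (f / g) := by
  have h1 : f / g * g = f := by
    funext τ; exact div_mul_cancel₀ _ (h0 τ)
  have h2 := qD_mul (mdifferentiable_div hf hg h0) hg
  rw [h1, hu, hv] at h2
  funext τ
  have h3 := congrFun h2 τ
  have h4 := h0 τ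
  simp only [Pi.mul_apply, Pi.add_apply, Pi.div_apply, Pi.sub_apply] at h3 ⊢
  field_simp at h3 ⊢
  linear_combination -h3

lemma qD_weberF1 : qD weberF1 = eisE1 1 * weberF1 := by
  have h1 : qD (doubleHom etaH) = ((2 : ℂ) • doubleHom (eisE 1)) * doubleHom etaH := by
    rw [qD_doubleHom, qD_etaH, map_mul, smul_mul_assoc]
  have h := qD_div_of_logDeriv (mdifferentiable_doubleHom mdifferentiable_etaH)
    mdifferentiable_etaH etaH_ne_zero h1 qD_etaH
  rw [weberF1_eq, h, eisE1_eq]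
  congr 1
  funext τ
  simp [Rat.smul_def, sub_eq_add_neg]

/-! ### Quasi-modular forms -/

lemma two_le_im_add_inv (τ : ℍ) : 2 ≤ τ.im + 1 / τ.im := by
  have h := τ.im_pos
  have : τ.im + 1 / τ.im - 2 = (τ.im - 1) ^ 2 / τ.im := by field_simp; ring
  have : 0 ≤ (τ.im - 1) ^ 2 / τ.im := by positivity
  linarith

/-- The holomorphic functions of moderate growth. -/
def moderateAlgebra : Subalgebra ℂ (ℍ → ℂ) where
  carrier := {f | MDifferentiable 𝓘(ℂ) 𝓘(ℂ) f ∧ ModerateGrowth f}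
  mul_mem' := by
    rintro f g ⟨hf, C, N, hC⟩ ⟨hg, C', N', hC'⟩
    refine ⟨hf.mul hg, C * C', N + N', fun τ ↦ ?_⟩
    rw [Pi.mul_apply, norm_mul, pow_add, mul_mul_mul_comm]
    exact mul_le_mul (hC τ) (hC' τ) (norm_nonneg _) ((norm_nonneg _).trans (hC τ))
  add_mem' := by
    rintro f g ⟨hf, C, N, hC⟩ ⟨hg, C', N', hC'⟩
    refine ⟨hf.add hg, |C| + |C'|, N + N', fun τ ↦ (norm_add_le _ _).trans ?_⟩
    have h1 : (1 : ℝ) ≤ τ.im + 1 / τ.im := by linarith [two_le_im_add_inv τ]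
    rw [add_mul]
    refine add_le_add ((hC τ).trans ?_) ((hC' τ).trans ?_)
    · exact mul_le_mul (le_abs_self _) (pow_le_pow_right₀ h1 (by omega)) (by positivity)
        (abs_nonneg _)
    · exact mul_le_mul (le_abs_self _) (pow_le_pow_right₀ h1 (by omega)) (by positivity)
        (abs_nonneg _)
  algebraMap_mem' c := ⟨mdifferentiable_const, ‖c‖, 0, fun τ ↦ by
    simp [Pi.algebraMap_apply]⟩

lemma doubleHom_mem_moderateAlgebra {f : ℍ → ℂ} (hf : f ∈ moderateAlgebra) :
    doubleHom f ∈ moderateAlgebra := by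
  obtain ⟨hf, C, N, hC⟩ := hf
  refine ⟨mdifferentiable_doubleHom hf, |C| * 2 ^ N, N, fun τ ↦ (hC _).trans ?_⟩
  have h := τ.im_pos
  have h2 : 2 * τ.im + 1 / (2 * τ.im) ≤ 2 * (τ.im + 1 / τ.im) := by
    rw [mul_add]
    have : 1 / (2 * τ.im) ≤ 2 * (1 / τ.im) := by
      rw [div_le_iff₀ (by positivity)]
      field_simp
      norm_num
    linarith
  rw [im_double, mul_assoc, ← mul_pow]
  exact mul_le_mul (le_abs_self _) (pow_le_pow_left₀ (by positivity) h2 _) (by positivity)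
    (abs_nonneg _)

/-- Lambert series have moderate growth: `∑ n ^ a r ^ n / (1 - r ^ n) ≤ a! (1 - r) ^ (-a - 2)`,
and `1 / (1 - r) ≤ 1 + 1 / (2 π y)` for `r = exp (-2 π y)`. -/
lemma norm_lambert_le (a : ℕ) (τ : ℍ) :
    ‖∑' n : ℕ, ((n : ℂ) + 1) ^ a * nome τ ^ (n + 1) / (1 - nome τ ^ (n + 1))‖ ≤
      a.factorial * 2 ^ (a + 2) * (τ.im + 1 / τ.im) ^ (a + 2) := by
  have hq := norm_nome_lt_one τ
  set r := ‖nome τ‖ with hr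
  have hr0 : 0 ≤ r := norm_nonneg _
  have h1r : 0 < 1 - r := by linarith
  have hy := τ.im_pos
  have hrr : ‖r‖ < 1 := by rwa [Real.norm_of_nonneg hr0]
  have hbound : ∀ n : ℕ, ‖((n : ℂ) + 1) ^ a * nome τ ^ (n + 1) / (1 - nome τ ^ (n + 1))‖ ≤
      (a.factorial / (1 - r)) * ((n + a).choose a * r ^ n) := fun n ↦ by
    have e1 : ‖((n : ℂ) + 1) ^ a‖ ≤ a.factorial * (n + a).choose a := by
      have : ((n + 1) ^ a : ℕ) ≤ a.factorial * (n + a).choose a := by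
        rw [← Nat.ascFactorial_eq_factorial_mul_choose]
        exact Nat.pow_succ_le_ascFactorial (n + 1) a
      have e : ((n : ℂ) + 1) ^ a = (((n + 1) ^ a : ℕ) : ℂ) := by push_cast; rfl
      rw [e, Complex.norm_natCast]
      exact_mod_cast this
    have e2 : ‖nome τ ^ (n + 1)‖ ≤ r ^ n := by
      rw [norm_pow]; exact pow_le_pow_of_le_one hr0 hq.le (by omega)
    have e3 : 1 - r ≤ ‖1 - nome τ ^ (n + 1)‖ := by
      have := norm_sub_norm_le (1 : ℂ) (nome τ ^ (n + 1))
      rw [norm_one, norm_pow, ← hr] at this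
      have : r ^ (n + 1) ≤ r := by
        simpa using pow_le_pow_of_le_one hr0 hq.le (show 1 ≤ n + 1 by omega)
      linarith
    rw [norm_div, norm_mul]
    calc _ ≤ (a.factorial * (n + a).choose a) * r ^ n / (1 - r) := by gcongr
      _ = _ := by ring
  have hs := (summable_choose_mul_geometric_of_norm_lt_one a hrr).mul_left
    ((a.factorial : ℝ) / (1 - r))
  have h1 := tsum_of_norm_bounded hs.hasSum hbound
  rw [tsum_mul_left, tsum_choose_mul_geometric_of_norm_lt_one a hrr] at h1
  have h2 : 1 / (1 - r) ≤ 2 * (τ.im + 1 / τ.im) := by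
    set x := 2 * Real.pi * τ.im with hx
    have hx0 : 0 < x := by have := Real.pi_pos; positivity
    have hexp : r * (1 + x) ≤ 1 := by
      rw [hr, norm_nome, ← hx]
      calc _ ≤ Real.exp (-x) * Real.exp x := by
            have := Real.add_one_le_exp x
            gcongr
            linarith
        _ = 1 := by rw [← Real.exp_add]; simp
    have h3 : 1 / (1 - r) ≤ 1 + 1 / x := by
      have : 1 + 1 / x = (1 + x) / x := by field_simp; ring
      rw [this, div_le_div_iff₀ h1r hx0]
      nlinarith
    have h4 : 1 / x ≤ 1 / τ.im := by
      refine one_div_le_one_div_of_le hy ?_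
      have := Real.pi_gt_three
      nlinarith
    linarith [two_le_im_add_inv τ]
  calc _ ≤ _ := h1
    _ = a.factorial * (1 / (1 - r)) ^ (a + 2) := by
        rw [one_div_pow, pow_succ (1 - r) (a + 1)]; field_simp
    _ ≤ a.factorial * (2 * (τ.im + 1 / τ.im)) ^ (a + 2) := by gcongr
    _ = _ := by rw [mul_pow]; ring

lemma eisE_mem_moderateAlgebra {l : ℕ} (hl : 1 ≤ l) : eisE l ∈ moderateAlgebra := by
  have hS : MDifferentiable 𝓘(ℂ) 𝓘(ℂ) fun τ : ℍ ↦ (bernoulli (2 * l) : ℂ) / (4 * l) :=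
    mdifferentiable_const
  have h : (fun τ : ℍ ↦ (bernoulli (2 * l) : ℂ) / (4 * l)) - eisE l ∈ moderateAlgebra := by
    refine ⟨hS.sub (mdifferentiable_eisE hl), (2 * l - 1).factorial * 2 ^ (2 * l - 1 + 2),
      2 * l - 1 + 2, fun τ ↦ ?_⟩
    have e : ((fun τ : ℍ ↦ (bernoulli (2 * l) : ℂ) / (4 * l)) - eisE l) τ =
        ∑' n : ℕ, ((n : ℂ) + 1) ^ (2 * l - 1) * nome τ ^ (n + 1) / (1 - nome τ ^ (n + 1)) := by
      simp [eisE]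
    rw [e]
    exact norm_lambert_le (2 * l - 1) τ
  have hc : (fun τ : ℍ ↦ (bernoulli (2 * l) : ℂ) / (4 * l)) ∈ moderateAlgebra :=
    moderateAlgebra.algebraMap_mem _
  simpa using moderateAlgebra.sub_mem hc h

/-- Evaluation at `τ` of the coefficients of a polynomial over functions on `ℍ`. -/
abbrev evalAt (τ : ℍ) : (ℍ → ℂ) →+* ℂ := Pi.evalRingHom (fun _ ↦ ℂ) τ

/-- A quasi-modular form, with the functions `g_i` collected in a polynomial `∑ g_i X ^ i`, so that
products of quasi-modular forms correspond to products of polynomials. -/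
def HasQuasiModularPolynomial (Γ : Subgroup SL(2, ℤ)) (w : ℤ) (f : ℍ → ℂ) : Prop :=
  ∃ G : Polynomial (ℍ → ℂ), (∀ i, G.coeff i ∈ moderateAlgebra) ∧
    ∀ γ ∈ Γ, ∀ τ : ℍ, (f ∣[w] γ) τ =
      (G.map (evalAt τ)).eval ((γ 1 0 : ℂ) / denom γ τ)

namespace HasQuasiModularPolynomial

variable {Γ : Subgroup SL(2, ℤ)} {w w' : ℤ} {f g : ℍ → ℂ}

lemma isQuasiModularForm (h : HasQuasiModularPolynomial Γ w f) : IsQuasiModularForm Γ w f := by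
  obtain ⟨G, hG, h⟩ := h
  refine ⟨G.natDegree, G.coeff, fun i _ ↦ hG i, fun γ hγ τ ↦ ?_⟩
  rw [h γ hγ τ, Polynomial.eval_eq_sum_range' (n := G.natDegree + 1)
    (Nat.lt_succ_of_le Polynomial.natDegree_map_le)]
  simp [Polynomial.coeff_map]

lemma one : HasQuasiModularPolynomial Γ 0 1 := by
  refine ⟨1, fun i ↦ ?_, fun γ _ τ ↦ ?_⟩
  · rw [Polynomial.coeff_one]; split_ifs
    exacts [one_mem _, zero_mem _]
  · rw [ModularForm.is_invariant_one]; simp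

lemma add (hf : HasQuasiModularPolynomial Γ w f) (hg : HasQuasiModularPolynomial Γ w g) :
    HasQuasiModularPolynomial Γ w (f + g) := by
  obtain ⟨F, hF, hf⟩ := hf
  obtain ⟨G, hG, hg⟩ := hg
  refine ⟨F + G, fun i ↦ ?_, fun γ hγ τ ↦ ?_⟩
  · rw [Polynomial.coeff_add]; exact add_mem (hF i) (hG i)
  · rw [SlashAction.add_slash, Pi.add_apply, hf γ hγ, hg γ hγ]; simp

lemma smul (c : ℂ) (hf : HasQuasiModularPolynomial Γ w f) :
    HasQuasiModularPolynomial Γ w (c • f) := by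
  obtain ⟨F, hF, hf⟩ := hf
  refine ⟨c • F, fun i ↦ ?_, fun γ hγ τ ↦ ?_⟩
  · rw [Polynomial.coeff_smul]; exact moderateAlgebra.smul_mem (hF i) c
  · have e : (c • F).map (evalAt τ) = c • F.map (evalAt τ) := by
      ext i; simp
    rw [ModularForm.SL_smul_slash, Pi.smul_apply, hf γ hγ, e, Polynomial.eval_smul]

lemma mul (hf : HasQuasiModularPolynomial Γ w f) (hg : HasQuasiModularPolynomial Γ w' g) :
    HasQuasiModularPolynomial Γ (w + w') (f * g) := by
  obtain ⟨F, hF, hf⟩ := hf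
  obtain ⟨G, hG, hg⟩ := hg
  refine ⟨F * G, fun i ↦ ?_, fun γ hγ τ ↦ ?_⟩
  · rw [Polynomial.coeff_mul]; exact sum_mem fun j _ ↦ mul_mem (hF _) (hG _)
  · rw [ModularForm.mul_slash_SL2, Pi.mul_apply, hf γ hγ, hg γ hγ]; simp

lemma mono {Γ' : Subgroup SL(2, ℤ)} (hΓ : Γ' ≤ Γ) (hf : HasQuasiModularPolynomial Γ w f) :
    HasQuasiModularPolynomial Γ' w f := by
  obtain ⟨F, hF, hf⟩ := hf
  exact ⟨F, hF, fun γ hγ ↦ hf γ (hΓ hγ)⟩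

/-- `f (2 τ)` has level `Γ₀(2)` if `f` has level one: for `γ = (a b; c d)` in `Γ₀(2)`,
`2 γ τ = γ' (2 τ)` with `γ' = (a 2b; c/2 d)`. -/
lemma doubleHom (hf : HasQuasiModularPolynomial ⊤ w f) :
    HasQuasiModularPolynomial (CongruenceSubgroup.Gamma0 2) w (doubleHom f) := by
  obtain ⟨F, hF, hf⟩ := hf
  refine ⟨(F.map AndrewsBressoud.doubleHom).comp
    (Polynomial.C (fun _ ↦ (2⁻¹ : ℂ)) * Polynomial.X), fun i ↦ ?_, fun γ hγ τ ↦ ?_⟩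
  · rw [Polynomial.comp_C_mul_X_coeff, Polynomial.coeff_map]
    have hc : (fun _ : ℍ ↦ (2⁻¹ : ℂ)) ∈ moderateAlgebra := moderateAlgebra.algebraMap_mem _
    exact mul_mem (doubleHom_mem_moderateAlgebra (hF i)) (pow_mem hc i)
  · obtain ⟨c, hc⟩ : (2 : ℤ) ∣ γ 1 0 :=
      (ZMod.intCast_zmod_eq_zero_iff_dvd _ 2).mp (CongruenceSubgroup.Gamma0_mem.mp hγ)
    have hdet : γ 0 0 * γ 1 1 - (2 * γ 0 1) * c = 1 := by
      have := γ.det_coe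
      rw [Matrix.det_fin_two, hc] at this
      linarith
    let γ' : SL(2, ℤ) := ⟨!![γ 0 0, 2 * γ 0 1; c, γ 1 1], by
      rw [Matrix.det_fin_two_of, hdet]⟩
    have e10 : γ' 1 0 = c := rfl
    have hden : denom γ' (double τ) = denom γ τ := by
      rw [ModularGroup.denom_apply, ModularGroup.denom_apply, e10, hc, coe_double,
        show γ' 1 1 = γ 1 1 from rfl]
      push_cast; ring
    have hsmul : double (γ • τ) = γ' • double τ := by
      ext1
      rw [coe_double, UpperHalfPlane.coe_specialLinearGroup_apply,
        UpperHalfPlane.coe_specialLinearGroup_apply]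
      simp only [γ', Matrix.of_apply, Matrix.cons_val', Matrix.cons_val_zero,
        Matrix.cons_val_one, Matrix.cons_val_fin_one, hc, coe_double, algebraMap_int_eq,
        eq_intCast]
      push_cast
      rw [show (c : ℂ) * (2 * τ) = 2 * c * τ by ring]
      ring
    have h1 := hf γ' (Subgroup.mem_top _) (double τ)
    rw [ModularForm.SL_slash_apply, hden, ← hsmul] at h1
    rw [ModularForm.SL_slash_apply, doubleHom_apply, h1, e10, hc, Polynomial.map_comp,
      Polynomial.map_map, Polynomial.eval_comp]
    have e2 : (evalAt τ).comp AndrewsBressoud.doubleHom = evalAt (double τ) := rfl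
    rw [e2]
    congr 1
    simp
    ring

end HasQuasiModularPolynomial

/-- For `l ≥ 2` this is modularity; `E_2` has the depth one correction term
`c / (c τ + d)` up to a constant. -/
lemma hasQuasiModularPolynomial_eisE {l : ℕ} (hl : 1 ≤ l) :
    HasQuasiModularPolynomial ⊤ (2 * l) (eisE l) := by
  rcases hl.eq_or_lt with rfl | h
  · set c : ℂ := -(1 / 24) * (1 / (2 * riemannZeta 2)) * (2 * Real.pi * Complex.I) with hc
    refine ⟨Polynomial.C (eisE 1) + Polynomial.C (fun _ ↦ c) * Polynomial.X, fun i ↦ ?_,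
      fun γ _ τ ↦ ?_⟩
    · have hcm : (fun _ : ℍ ↦ c) ∈ moderateAlgebra := moderateAlgebra.algebraMap_mem _
      rw [Polynomial.coeff_add, Polynomial.coeff_C, Polynomial.coeff_C_mul_X]
      refine add_mem ?_ ?_
      · split_ifs
        exacts [eisE_mem_moderateAlgebra le_rfl, zero_mem _]
      · split_ifs
        exacts [hcm, zero_mem _]
    · rw [eisE_one]
      have h2 := congrFun (EisensteinSeries.E2_slash_action γ) τ
      rw [ModularForm.SL_smul_slash]
      rw [Nat.cast_one, mul_one, Pi.smul_apply, h2]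
      simp only [Pi.sub_apply, Pi.smul_apply, smul_eq_mul, EisensteinSeries.D2, Polynomial.map_add,
        Polynomial.map_C, Polynomial.map_mul, Polynomial.map_X, Polynomial.eval_add,
        Polynomial.eval_C, Polynomial.eval_mul, Polynomial.eval_X, Pi.evalRingHom_apply, hc]
      ring
  · refine ⟨Polynomial.C (eisE l), fun i ↦ ?_, fun γ _ τ ↦ ?_⟩
    · rw [Polynomial.coeff_C]; split_ifs
      exacts [eisE_mem_moderateAlgebra hl, zero_mem _]
    · have hE := SlashInvariantFormClass.slash_action_eq
        (ModularForm.E (show 3 ≤ 2 * l by omega)) (Matrix.SpecialLinearGroup.mapGL ℝ γ) ⟨γ, rfl⟩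
      have hE' : (ModularForm.E (show 3 ≤ 2 * l by omega) : ℍ → ℂ) ∣[(2 * l : ℤ)] γ =
          (ModularForm.E (show 3 ≤ 2 * l by omega) : ℍ → ℂ) := by
        rw [ModularForm.SL_slash]
        exact_mod_cast hE
      rw [eisE_eq_smul_E (by omega), ModularForm.SL_smul_slash, hE']
      simp


/-! ### The logarithmic derivative of the theta function -/

/-- The generalized Lambert series `∑_{n ≥ 1} n ^ j q ^ n / (1 - q ^ n) e ^ (n z)`. -/
def lambertExp (q : ℂ) (j : ℤ) (z : ℂ) : ℂ :=
  ∑' n : ℕ, ((n : ℂ) + 1) ^ j * (q ^ (n + 1) / (1 - q ^ (n + 1))) * Complex.exp ((n + 1) * z)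

lemma norm_lambertExp_term_le {q : ℂ} (hq : ‖q‖ < 1) (j : ℤ) {z : ℂ} {ρ : ℝ} (hz : z.re ≤ ρ)
    (n : ℕ) :
    ‖((n : ℂ) + 1) ^ j * (q ^ (n + 1) / (1 - q ^ (n + 1))) * Complex.exp ((n + 1) * z)‖ ≤
      (((n + 1 : ℕ) : ℝ) ^ j.natAbs * (‖q‖ * Real.exp ρ) ^ (n + 1)) * (1 - ‖q‖)⁻¹ := by
  have h1 : ‖((n : ℂ) + 1) ^ j‖ ≤ ((n + 1 : ℕ) : ℝ) ^ j.natAbs := by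
    rw [norm_zpow, show ((n : ℂ) + 1) = ((n + 1 : ℕ) : ℂ) by push_cast; ring, Complex.norm_natCast,
      ← zpow_natCast]
    exact zpow_le_zpow_right₀ (by exact_mod_cast Nat.succ_le_succ (Nat.zero_le n)) (by omega)
  have h2 : ‖Complex.exp ((n + 1) * z)‖ ≤ Real.exp ρ ^ (n + 1) := by
    rw [Complex.norm_exp, ← Real.exp_nat_mul, Real.exp_le_exp]
    have : (((n : ℂ) + 1) * z).re = ((n : ℝ) + 1) * z.re := by
      simp [Complex.mul_re]
    rw [this]
    push_cast
    exact mul_le_mul_of_nonneg_left hz (by positivity)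
  have h3 : ‖q ^ (n + 1) / (1 - q ^ (n + 1))‖ ≤ ‖q‖ ^ (n + 1) * (1 - ‖q‖)⁻¹ := by
    rw [norm_div, norm_pow, div_eq_mul_inv]
    refine mul_le_mul_of_nonneg_left (inv_anti₀ (by linarith) ?_) (by positivity)
    have h4 : ‖q‖ ^ (n + 1) ≤ ‖q‖ := pow_le_of_le_one (norm_nonneg _) hq.le (by omega)
    have h5 := norm_sub_norm_le (1 : ℂ) (q ^ (n + 1))
    rw [norm_one, norm_pow] at h5
    linarith
  have h0 : 0 ≤ (1 - ‖q‖)⁻¹ := inv_nonneg.mpr (by linarith)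
  rw [norm_mul, norm_mul]
  calc _ ≤ ((n + 1 : ℕ) : ℝ) ^ j.natAbs * (‖q‖ ^ (n + 1) * (1 - ‖q‖)⁻¹) * Real.exp ρ ^ (n + 1) :=
        mul_le_mul (mul_le_mul h1 h3 (norm_nonneg _) (by positivity)) h2 (norm_nonneg _)
          (by positivity)
    _ = _ := by rw [mul_pow]; ring

lemma summable_lambertExp_bound {s : ℝ} (hs0 : 0 ≤ s) (hs : s < 1) (k : ℕ) (c : ℝ) :
    Summable fun n : ℕ ↦ (((n + 1 : ℕ) : ℝ) ^ k * s ^ (n + 1)) * c := by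
  have h := summable_pow_mul_geometric_of_norm_lt_one (R := ℝ) k (r := s)
    (by rwa [Real.norm_of_nonneg hs0])
  exact ((summable_nat_add_iff 1).mpr h).mul_right c

lemma exists_re_lt_mul_exp_lt_one {q z : ℂ} (hz : ‖q‖ * Real.exp z.re < 1) :
    ∃ ρ, z.re < ρ ∧ ‖q‖ * Real.exp ρ < 1 := by
  have hc : Continuous fun x : ℝ ↦ ‖q‖ * Real.exp x := by fun_prop
  obtain ⟨ρ, h1, h2⟩ := ((hc.tendsto z.re).eventually_lt_const hz).exists_gt
  exact ⟨ρ, h1, h2⟩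

lemma hasDerivAt_lambertExp {q : ℂ} (hq : ‖q‖ < 1) (j : ℤ) {z : ℂ}
    (hz : ‖q‖ * Real.exp z.re < 1) :
    HasDerivAt (lambertExp q j) (lambertExp q (j + 1) z) z := by
  obtain ⟨ρ, h1, h2⟩ := exists_re_lt_mul_exp_lt_one hz
  have hconv : Convex ℝ {w : ℂ | w.re < ρ} := convex_halfSpace_re_lt ρ
  refine hasDerivAt_tsum_of_isPreconnected (t := {w : ℂ | w.re < ρ})
    (summable_lambertExp_bound (by positivity) h2 (j + 1).natAbs (1 - ‖q‖)⁻¹)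
    (isOpen_lt Complex.continuous_re continuous_const) hconv.isPreconnected
    (fun n w hw ↦ ?_) (fun n w hw ↦ norm_lambertExp_term_le hq (j + 1) (le_of_lt hw) n) h1
    (.of_norm_bounded (summable_lambertExp_bound (by positivity) h2 j.natAbs (1 - ‖q‖)⁻¹)
      fun n ↦ norm_lambertExp_term_le hq j h1.le n) h1
  have h := ((hasDerivAt_id w).const_mul ((n : ℂ) + 1)).cexp.const_mul
    (((n : ℂ) + 1) ^ j * (q ^ (n + 1) / (1 - q ^ (n + 1))))
  refine h.congr_deriv ?_
  rw [zpow_add_one₀ (by exact_mod_cast n.succ_ne_zero)]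
  simp only [id, mul_one]
  ring

lemma iteratedDeriv_lambertExp {q : ℂ} (hq : ‖q‖ < 1) (j : ℤ) (n : ℕ) {z : ℂ}
    (hz : ‖q‖ * Real.exp z.re < 1) :
    iteratedDeriv n (lambertExp q j) z = lambertExp q (j + n) z := by
  induction n generalizing z with
  | zero => simp
  | succ n ih =>
    have hc : Continuous fun w : ℂ ↦ ‖q‖ * Real.exp w.re := by fun_prop
    have he : iteratedDeriv n (lambertExp q j) =ᶠ[nhds z] lambertExp q (j + n) :=
      ((hc.tendsto z).eventually_lt_const hz).mono fun w hw ↦ ih hw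
    rw [iteratedDeriv_succ, he.deriv_eq, (hasDerivAt_lambertExp hq _ hz).deriv]
    congr 1
    push_cast; ring

lemma analyticAt_lambertExp {q : ℂ} (hq : ‖q‖ < 1) (j : ℤ) :
    AnalyticAt ℂ (lambertExp q j) 0 := by
  have hc : Continuous fun w : ℂ ↦ ‖q‖ * Real.exp w.re := by fun_prop
  rw [Complex.analyticAt_iff_eventually_differentiableAt]
  have h0 : ‖q‖ * Real.exp (0 : ℂ).re < 1 := by simpa using hq
  exact ((hc.tendsto 0).eventually_lt_const h0).mono fun w hw ↦
    (hasDerivAt_lambertExp hq j hw).differentiableAt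

/-- The logarithm of the product is expanded as a double series and summed in the other order. -/
lemma tprod_one_sub_pow_succ_mul_exp {q : ℂ} (hq : ‖q‖ < 1) {z : ℂ}
    (hz : ‖q‖ * Real.exp z.re < 1) :
    ∏' m : ℕ, (1 - q ^ (m + 1) * Complex.exp z) = Complex.exp (-lambertExp q (-1) z) := by
  have hx : ∀ m : ℕ, ‖q ^ (m + 1) * Complex.exp z‖ = ‖q‖ ^ m * (‖q‖ * Real.exp z.re) := fun m ↦ by
    rw [norm_mul, norm_pow, Complex.norm_exp]; ring
  have hx1 : ∀ m : ℕ, ‖q ^ (m + 1) * Complex.exp z‖ < 1 := fun m ↦ by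
    rw [hx]
    calc _ ≤ 1 * (‖q‖ * Real.exp z.re) :=
          mul_le_mul_of_nonneg_right (pow_le_one₀ (norm_nonneg _) hq.le) (by positivity)
      _ < 1 := by rwa [one_mul]
  have hlog : ∀ m : ℕ, HasSum (fun n : ℕ ↦ (q ^ (m + 1) * Complex.exp z) ^ (n + 1) / ((n : ℂ) + 1))
      (-Complex.log (1 - q ^ (m + 1) * Complex.exp z)) := fun m ↦ by
    have h := Complex.hasSum_taylorSeries_neg_log (hx1 m)
    have := (hasSum_nat_add_iff' 1).mpr h
    simpa using this
  have hsum : Summable fun p : ℕ × ℕ ↦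
      (q ^ (p.1 + 1) * Complex.exp z) ^ (p.2 + 1) / ((p.2 : ℂ) + 1) := by
    refine Summable.of_norm_bounded (g := fun p : ℕ × ℕ ↦
      ‖q‖ ^ p.1 * (‖q‖ * Real.exp z.re) ^ p.2) ?_ fun p ↦ ?_
    · exact (summable_geometric_of_lt_one (norm_nonneg _) hq).mul_of_nonneg
        (summable_geometric_of_lt_one (by positivity) hz) (fun _ ↦ by positivity)
        (fun _ ↦ by positivity)
    · rw [norm_div, norm_pow, hx, show ((p.2 : ℂ) + 1) = ((p.2 + 1 : ℕ) : ℂ) by push_cast; ring,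
        Complex.norm_natCast, mul_pow]
      have h1 : (‖q‖ ^ p.1) ^ (p.2 + 1) ≤ ‖q‖ ^ p.1 :=
        pow_le_of_le_one (by positivity) (pow_le_one₀ (norm_nonneg _) hq.le) (by omega)
      have h2 : (‖q‖ * Real.exp z.re) ^ (p.2 + 1) ≤ (‖q‖ * Real.exp z.re) ^ p.2 :=
        pow_le_pow_of_le_one (by positivity) hz.le (by omega)
      refine (div_le_self (by positivity)
        (by exact_mod_cast Nat.succ_le_succ (Nat.zero_le _))).trans (mul_le_mul h1 h2 (by positivity) (by positivity))
  have hlam : -lambertExp q (-1) z = ∑' m : ℕ, Complex.log (1 - q ^ (m + 1) * Complex.exp z) := by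
    have h1 : ∑' m : ℕ, Complex.log (1 - q ^ (m + 1) * Complex.exp z) =
        -∑' (m : ℕ) (n : ℕ), (q ^ (m + 1) * Complex.exp z) ^ (n + 1) / ((n : ℂ) + 1) := by
      rw [← tsum_neg]
      exact tsum_congr fun m ↦ by rw [(hlog m).tsum_eq, neg_neg]
    have hcomm := Summable.tsum_comm
      (f := fun m n : ℕ ↦ (q ^ (m + 1) * Complex.exp z) ^ (n + 1) / ((n : ℂ) + 1)) hsum
    rw [h1, ← hcomm, lambertExp]
    refine congrArg Neg.neg ?_
    refine tsum_congr fun n ↦ ?_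
    have hq1 : ‖q ^ (n + 1)‖ < 1 := by
      rw [norm_pow]; exact pow_lt_one₀ (norm_nonneg _) hq (by omega)
    have h2 : ∀ m : ℕ, (q ^ (m + 1) * Complex.exp z) ^ (n + 1) / ((n : ℂ) + 1) =
        (q ^ (n + 1)) ^ m * (((n : ℂ) + 1) ^ (-1 : ℤ) * q ^ (n + 1) *
          Complex.exp ((n + 1) * z)) := fun m ↦ by
      rw [mul_pow, ← Complex.exp_nat_mul, zpow_neg_one]
      push_cast
      ring
    simp only [h2]
    rw [tsum_mul_right, tsum_geometric_of_norm_lt_one hq1]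
    ring
  rw [hlam]
  refine (Complex.cexp_tsum_eq_tprod (fun m h0 ↦ ?_) ?_).symm
  · rw [sub_eq_zero] at h0
    have := hx1 m
    rw [← h0, norm_one] at this
    exact lt_irrefl _ this
  · refine Summable.congr (f := fun m ↦ -∑' n : ℕ,
      (q ^ (m + 1) * Complex.exp z) ^ (n + 1) / ((n : ℂ) + 1)) hsum.prod.neg fun m ↦ ?_
    rw [(hlog m).tsum_eq, neg_neg]

/-- The odd Jacobi theta function `∑_n (-1) ^ n q ^ ((n + 1/2) ^ 2 / 2) e ^ ((n + 1/2) z)`. -/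
abbrev oddTheta (z τ : ℂ) : ℂ := thetaSeries (1 / 2) (1 / 2) 0 z τ

lemma norm_nome_mul_exp_lt_one (τ : ℍ) {x : ℝ} (hx : x < 2 * Real.pi * τ.im) :
    ‖nome τ‖ * Real.exp x < 1 := by
  rw [norm_nome, ← Real.exp_add, Real.exp_lt_one_iff]
  linarith

/-- The triple product identity writes the odd theta function as a nowhere vanishing function
times `2 sinh (z / 2)`. -/
lemma exists_oddTheta_eq (τ : ℍ) : ∃ K : ℂ, K ≠ 0 ∧ ∀ z : ℂ, |z.re| < 2 * Real.pi * τ.im →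
    oddTheta z τ = K * (Complex.exp (z / 2) - Complex.exp (-(z / 2))) *
      Complex.exp (-(lambertExp (nome τ) (-1) z + lambertExp (nome τ) (-1) (-z))) := by
  set q := nome τ with hqdef
  have hq : ‖q‖ < 1 := norm_nome_lt_one τ
  set p := Complex.exp (Real.pi * Complex.I * τ) with hpdef
  have hp2 : p ^ 2 = q := by
    rw [hpdef, ← Complex.exp_nat_mul, hqdef, nome]; congr 1; push_cast; ring
  have hp : ‖p‖ < 1 := by
    have : ‖p‖ ^ 2 < 1 := by rw [← norm_pow, hp2]; exact hq
    exact (sq_lt_one_iff₀ (norm_nonneg _)).mp this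
  have hp0 : p ≠ 0 := Complex.exp_ne_zero _
  refine ⟨Complex.exp (Real.pi * Complex.I * τ / 4) * ∏' m : ℕ, (1 - q ^ (m + 1)),
    mul_ne_zero (Complex.exp_ne_zero _) (tprod_one_sub_pow_ne_zero hq), fun z hz ↦ ?_⟩
  obtain ⟨hz1, hz2⟩ := abs_lt.mp hz
  have hzp : ‖q‖ * Real.exp z.re < 1 := norm_nome_mul_exp_lt_one τ hz2
  have hzn : ‖q‖ * Real.exp (-z).re < 1 :=
    norm_nome_mul_exp_lt_one τ (by rw [Complex.neg_re]; linarith)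
  set ζ := p * Complex.exp z with hζ
  have hζ0 : ζ ≠ 0 := mul_ne_zero hp0 (Complex.exp_ne_zero _)
  have hsum : oddTheta z τ = Complex.exp (Real.pi * Complex.I * τ / 4) * Complex.exp (z / 2) *
      ∑' n : ℤ, (-1) ^ n * p ^ (n ^ 2) * ζ ^ n := by
    rw [oddTheta, thetaSeries, ← tsum_mul_left]
    refine tsum_congr fun n ↦ ?_
    rw [thetaTerm, hζ, mul_zpow, hpdef, ← Complex.exp_int_mul, ← Complex.exp_int_mul,
      ← Complex.exp_int_mul, pow_zero, mul_one]
    calc _ = (-1) ^ n * Complex.exp (Real.pi * Complex.I * τ / 4 + z / 2 +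
          (((n ^ 2 : ℤ) : ℂ) * (Real.pi * Complex.I * τ)) +
          ((n : ℂ) * (Real.pi * Complex.I * τ)) + n * z) := by
          congr 2; push_cast; ring
      _ = _ := by rw [Complex.exp_add, Complex.exp_add, Complex.exp_add, Complex.exp_add]; ring
  have h1 : ∏' m : ℕ, (1 - p ^ (2 * m + 1) * ζ) =
      Complex.exp (-lambertExp q (-1) z) := by
    rw [← tprod_one_sub_pow_succ_mul_exp hq hzp]
    refine tprod_congr fun m ↦ ?_
    rw [hζ, ← hp2, ← pow_mul]
    ring
  have h2 : ∏' m : ℕ, (1 - p ^ (2 * m + 1) * ζ⁻¹) =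
      (1 - Complex.exp (-z)) * Complex.exp (-lambertExp q (-1) (-z)) := by
    have h3 : ∀ m : ℕ, 1 - p ^ (2 * m + 1) * ζ⁻¹ = 1 - q ^ m * Complex.exp (-z) := fun m ↦ by
      rw [hζ, mul_inv, Complex.exp_neg z, ← hp2, ← pow_mul, pow_succ, mul_assoc, ← mul_assoc p,
        mul_inv_cancel₀ hp0, one_mul]
    rw [tprod_congr h3, tprod_eq_zero_mul', tprod_one_sub_pow_succ_mul_exp hq hzn, pow_zero,
      one_mul]
    have := (multipliable_one_sub_pow_mul hp (Complex.exp (-z)) 2)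
    refine this.congr fun m ↦ ?_
    rw [← hp2, ← pow_mul]
    ring_nf
  rw [hsum, ← tripleProduct hp0 hp hζ0, h1, h2, hp2, neg_add, Complex.exp_add]
  have h4 : Complex.exp (z / 2) * (1 - Complex.exp (-z)) =
      Complex.exp (z / 2) - Complex.exp (-(z / 2)) := by
    rw [mul_sub, mul_one, ← Complex.exp_add]; congr 2; ring
  rw [← h4]
  ring

lemma exp_half_sub_exp_neg_half (z : ℂ) : Complex.exp (z / 2) - Complex.exp (-(z / 2)) =
    Complex.exp (-(z / 2)) * (Complex.exp z - 1) := by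
  rw [mul_sub, ← Complex.exp_add]; congr 2 <;> ring_nf

lemma oddTheta_zero (τ : ℍ) : oddTheta 0 τ = 0 := by
  obtain ⟨K, -, h⟩ := exists_oddTheta_eq τ
  rw [h 0 (by simpa using mul_pos Real.two_pi_pos τ.im_pos)]
  simp

/-- The only zero of the odd theta function in this rectangle is the origin. -/
lemma oddTheta_ne_zero (τ : ℍ) {z : ℂ} (h1 : |z.re| < 2 * Real.pi * τ.im)
    (h2 : |z.im| < 2 * Real.pi) (hz : z ≠ 0) : oddTheta z τ ≠ 0 := by
  obtain ⟨K, hK, h⟩ := exists_oddTheta_eq τ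
  rw [h z h1, exp_half_sub_exp_neg_half]
  refine mul_ne_zero (mul_ne_zero hK (mul_ne_zero (Complex.exp_ne_zero _) fun h0 ↦ hz ?_))
    (Complex.exp_ne_zero _)
  obtain ⟨n, hn⟩ := Complex.exp_eq_one_iff.mp (sub_eq_zero.mp h0)
  have him : z.im = n * (2 * Real.pi) := by
    rw [hn]; simp
  have hn0 : n = 0 := by
    rw [him, abs_mul, abs_of_pos Real.two_pi_pos] at h2
    have h3 : |(n : ℝ)| < 1 := by
      by_contra! h4
      have := mul_le_mul_of_nonneg_right h4 Real.two_pi_pos.le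
      linarith
    have h4 : |n| < 1 := by exact_mod_cast h3
    exact Int.abs_lt_one_iff.mp h4
  rw [hn, hn0]; simp

lemma hasDerivAt_oddTheta (τ : ℍ) (z : ℂ) :
    HasDerivAt (fun w ↦ oddTheta w τ) (thetaSeries (1 / 2) (1 / 2) 1 z τ) z := by
  have h := hasDerivAt_thetaSeries_left (κ := 1 / 2) (by norm_num) (1 / 2) 0 z τ.im_pos
  refine h.congr_deriv ?_
  push_cast; ring

lemma hasDerivAt_exp_half (z : ℂ) :
    HasDerivAt (fun w ↦ Complex.exp (w / 2) - Complex.exp (-(w / 2)))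
      ((Complex.exp (z / 2) + Complex.exp (-(z / 2))) / 2) z := by
  have h := ((hasDerivAt_id z).div_const 2).cexp.sub ((hasDerivAt_id z).div_const 2).neg.cexp
  refine h.congr_deriv ?_
  simp only [id, Pi.neg_apply]
  ring

/-- The logarithmic derivative of the odd theta function, cleared of its denominator. -/
lemma exp_sub_one_mul_deriv_oddTheta (τ : ℍ) {z : ℂ} (hz : |z.re| < 2 * Real.pi * τ.im) :
    (Complex.exp z - 1) * thetaSeries (1 / 2) (1 / 2) 1 z τ =
      oddTheta z τ * ((Complex.exp z - 1) *
        (1 / 2 - (lambertExp (nome τ) 0 z - lambertExp (nome τ) 0 (-z))) + 1) := by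
  obtain ⟨K, -, h⟩ := exists_oddTheta_eq τ
  obtain ⟨hz1, hz2⟩ := abs_lt.mp hz
  have hq : ‖nome τ‖ < 1 := norm_nome_lt_one τ
  have hzp : ‖nome τ‖ * Real.exp z.re < 1 := norm_nome_mul_exp_lt_one τ hz2
  have hzn : ‖nome τ‖ * Real.exp (-z).re < 1 :=
    norm_nome_mul_exp_lt_one τ (by rw [Complex.neg_re]; linarith)
  have hl1 := hasDerivAt_lambertExp hq (-1) hzp
  have hl2 := (hasDerivAt_lambertExp hq (-1) hzn).comp z (hasDerivAt_neg z)
  rw [neg_add_cancel] at hl1 hl2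
  have hd := ((hasDerivAt_exp_half z).const_mul K).mul (hl1.add hl2).neg.cexp
  have he : (fun w ↦ oddTheta w τ) =ᶠ[nhds z] _ :=
    ((Complex.continuous_re.abs.tendsto z).eventually_lt_const hz).mono fun w hw ↦ h w hw
  have hu := (hasDerivAt_oddTheta τ z).unique (hd.congr_of_eventuallyEq he)
  rw [hu, h z hz, exp_half_sub_exp_neg_half]
  have h1 : Complex.exp (z / 2) = Complex.exp (-(z / 2)) * Complex.exp z := by
    rw [← Complex.exp_add]; congr 1; ring
  simp only [Pi.neg_apply, Pi.add_apply, Function.comp]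
  rw [h1]
  ring

/-- The odd theta function has a simple zero at the origin. -/
lemma thetaMoment_one_ne_zero (τ : ℍ) : thetaMoment (1 / 2) (1 / 2) 1 τ ≠ 0 := by
  obtain ⟨K, hK, h⟩ := exists_oddTheta_eq τ
  have h0 : |(0 : ℂ).re| < 2 * Real.pi * τ.im := by
    simpa using mul_pos Real.two_pi_pos τ.im_pos
  have hq : ‖nome τ‖ < 1 := norm_nome_lt_one τ
  have hzp : ‖nome τ‖ * Real.exp (0 : ℂ).re < 1 := by simpa using hq
  have hl1 := hasDerivAt_lambertExp hq (-1) hzp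
  have hl2 := (hasDerivAt_lambertExp hq (-1) (z := -0) (by simpa using hq)).comp 0
    (hasDerivAt_neg 0)
  have hd := ((hasDerivAt_exp_half 0).const_mul K).mul (hl1.add hl2).neg.cexp
  have he : (fun w ↦ oddTheta w τ) =ᶠ[nhds 0] _ :=
    ((Complex.continuous_re.abs.tendsto 0).eventually_lt_const h0).mono fun w hw ↦ h w hw
  have hu := (hasDerivAt_oddTheta τ 0).unique (hd.congr_of_eventuallyEq he)
  rw [thetaMoment, hu]
  simp [hK, Complex.exp_ne_zero]

/-- The Taylor coefficients of `z θ'(z) / θ(z)` for the odd theta function: for even `n ≥ 2` the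
coefficient of `z ^ n` is a multiple of the Eisenstein series of weight `n`. -/
def logDerivSeries (τ : ℍ) : PowerSeries ℂ := PowerSeries.mk fun n ↦
  if Even n then (if n = 0 then 1 else 2 * n / (n.factorial : ℂ) * eisE (n / 2) τ) else 0

lemma coeff_taylorSeries_oddTheta (τ : ℍ) (n : ℕ) :
    (taylorSeries fun z ↦ oddTheta z τ).coeff n =
      thetaMoment (1 / 2) (1 / 2) n τ / (n.factorial : ℂ) := by
  have h := congrFun (iteratedDeriv_thetaSeries (κ := 1 / 2) (by norm_num) (1 / 2) τ.im_pos n) 0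
  rw [coeff_taylorSeries, h, thetaMoment]
  norm_num

lemma lambertExp_zero_right (τ : ℍ) (l : ℕ) :
    lambertExp (nome τ) ((2 * l - 1 : ℕ) : ℤ) 0 =
      (bernoulli (2 * l) : ℂ) / (4 * l) - eisE l τ := by
  rw [eisE, sub_sub_cancel, lambertExp]
  refine tsum_congr fun n ↦ ?_
  rw [mul_zero, Complex.exp_zero, mul_one, zpow_natCast, mul_div_assoc]

/-- The Taylor expansion of `z θ' = θ · (z θ' / θ)`. The factor `e ^ z - 1` of
`exp_sub_one_mul_deriv_oddTheta` is cancelled against the Bernoulli generating function, which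
supplies the constant terms of the Eisenstein series. -/
lemma X_mul_derivative_taylorSeries_oddTheta (τ : ℍ) :
    PowerSeries.X * PowerSeries.derivative ℂ (taylorSeries fun z ↦ oddTheta z τ) =
      (taylorSeries fun z ↦ oddTheta z τ) * logDerivSeries τ := by
  set q := nome τ with hqdef
  have hq : ‖q‖ < 1 := norm_nome_lt_one τ
  set t := taylorSeries fun z ↦ oddTheta z τ with ht
  set L : ℂ → ℂ := fun z ↦ (-1) * lambertExp q 0 z + lambertExp q 0 (-z) with hL
  have hneg : AnalyticAt ℂ (fun z ↦ lambertExp q 0 (-z)) 0 := by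
    have h : AnalyticAt ℂ (lambertExp q 0) (-(0 : ℂ)) := by
      rw [neg_zero]; exact analyticAt_lambertExp hq 0
    exact h.fun_comp (f := fun z : ℂ ↦ -z) (by fun_prop)
  have hLan : AnalyticAt ℂ L 0 :=
    (analyticAt_const.fun_mul (analyticAt_lambertExp hq 0)).fun_add hneg
  have hθ : AnalyticAt ℂ (fun z ↦ oddTheta z τ) 0 :=
    (differentiable_thetaSeries (by norm_num) _ _ τ.im_pos).analyticAt 0
  have hexp : AnalyticAt ℂ (fun z : ℂ ↦ Complex.exp z + (-1)) 0 :=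
    analyticAt_cexp.fun_add analyticAt_const
  have hE : taylorSeries (fun z : ℂ ↦ Complex.exp z + (-1)) = PowerSeries.exp ℂ - 1 := by
    rw [taylorSeries_add analyticAt_cexp analyticAt_const, taylorSeries_const, sub_eq_add_neg,
      map_neg, map_one]
    congr 1
    ext n
    have := taylorSeries_exp_mul 1 n
    simp only [one_mul] at this
    rw [this, PowerSeries.coeff_exp]
    simp
  have hLcoeff : ∀ n, (taylorSeries L).coeff n =
      (-1 + (-1) ^ n) * lambertExp q n 0 / (n.factorial : ℂ) := fun n ↦ by
    have h0 : ‖q‖ * Real.exp (0 : ℂ).re < 1 := by simpa using hq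
    rw [taylorSeries_add (analyticAt_const.fun_mul (analyticAt_lambertExp hq 0)) hneg,
      taylorSeries_mul analyticAt_const (analyticAt_lambertExp hq 0), taylorSeries_const, map_add,
      PowerSeries.coeff_C_mul, coeff_taylorSeries, coeff_taylorSeries, iteratedDeriv_comp_neg,
      neg_zero, iteratedDeriv_lambertExp hq 0 n h0, zero_add, smul_eq_mul]
    ring
  have hmain : (PowerSeries.exp ℂ - 1) * PowerSeries.derivative ℂ t =
      t * ((PowerSeries.exp ℂ - 1) * (PowerSeries.C (1 / 2) + taylorSeries L) + 1) := by
    have hd : deriv (fun z ↦ oddTheta z τ) = fun z ↦ thetaSeries (1 / 2) (1 / 2) 1 z τ :=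
      funext fun z ↦ (hasDerivAt_oddTheta τ z).deriv
    have hd' : AnalyticAt ℂ (fun z ↦ thetaSeries (1 / 2) (1 / 2) 1 z τ) 0 :=
      (differentiable_thetaSeries (by norm_num) _ _ τ.im_pos).analyticAt 0
    have hh : AnalyticAt ℂ (fun z ↦ 1 / 2 + L z) 0 := analyticAt_const.fun_add hLan
    have hg : AnalyticAt ℂ (fun z ↦ (Complex.exp z + (-1)) * (1 / 2 + L z)) 0 := hexp.fun_mul hh
    rw [ht, ← taylorSeries_deriv, hd, ← hE, ← taylorSeries_mul hexp hd',
      ← taylorSeries_const (1 / 2), ← taylorSeries_add analyticAt_const hLan,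
      ← taylorSeries_mul hexp hh, ← map_one PowerSeries.C, ← taylorSeries_const 1,
      ← taylorSeries_add hg analyticAt_const,
      ← taylorSeries_mul hθ (hg.fun_add analyticAt_const)]
    refine taylorSeries_congr ?_
    have h0 : |(0 : ℂ).re| < 2 * Real.pi * τ.im := by
      simpa using mul_pos Real.two_pi_pos τ.im_pos
    refine ((Complex.continuous_re.abs.tendsto 0).eventually_lt_const h0).mono fun z hz ↦ ?_
    have := exp_sub_one_mul_deriv_oddTheta τ hz
    simp only [hL, ← sub_eq_add_neg]
    rw [this]
    ring
  have hY : logDerivSeries τ = PowerSeries.X * (PowerSeries.C (1 / 2) + taylorSeries L) +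
      bernoulliPowerSeries ℂ := by
    ext n
    rw [logDerivSeries, PowerSeries.coeff_mk, map_add, bernoulliPowerSeries, PowerSeries.coeff_mk]
    rcases n with _ | n
    · simp
    rw [PowerSeries.coeff_succ_X_mul, map_add, hLcoeff, PowerSeries.coeff_C]
    rcases Nat.even_or_odd (n + 1) with he | ho
    · obtain ⟨l, hl⟩ := he
      obtain rfl : n = 2 * l - 1 := by omega
      have hl1 : 1 ≤ l := by omega
      have hodd : Odd (2 * l - 1) := ⟨l - 1, by omega⟩
      rw [if_pos ⟨l, hl⟩, if_neg (by omega), if_neg (by omega), lambertExp_zero_right τ l,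
        hodd.neg_one_pow, show 2 * l - 1 + 1 = 2 * l by omega, show 2 * l / 2 = l by omega]
      have hf : ((2 * l).factorial : ℂ) = 2 * l * ((2 * l - 1).factorial : ℂ) := by
        rw [← Nat.mul_factorial_pred (by omega : 2 * l ≠ 0)]; push_cast; ring
      have hf0 : ((2 * l - 1).factorial : ℂ) ≠ 0 := by exact_mod_cast Nat.factorial_ne_zero _
      have hl0 : (l : ℂ) ≠ 0 := by exact_mod_cast (by omega : l ≠ 0)
      simp only [eq_ratCast, Rat.cast_div, Rat.cast_natCast]
      rw [hf]
      push_cast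
      field_simp
      ring
    · rw [if_neg (Nat.not_even_iff_odd.mpr ho)]
      have he : Even n := by rcases ho with ⟨l, hl⟩; exact ⟨l, by omega⟩
      rw [he.neg_one_pow]
      rcases Nat.eq_zero_or_pos n with rfl | hn
      · simp [bernoulli_one]; norm_num
      · rw [if_neg hn.ne', bernoulli_eq_zero_of_odd ho (by omega)]
        simp
  rw [hY]
  have hB := bernoulliPowerSeries_mul_exp_sub_one ℂ
  calc _ = bernoulliPowerSeries ℂ * ((PowerSeries.exp ℂ - 1) * PowerSeries.derivative ℂ t) := by
        rw [← hB]; ring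
    _ = t * ((bernoulliPowerSeries ℂ * (PowerSeries.exp ℂ - 1)) *
        (PowerSeries.C (1 / 2) + taylorSeries L) + bernoulliPowerSeries ℂ) := by rw [hmain]; ring
    _ = _ := by rw [hB]


/-! ### Isobaric polynomials in Eisenstein series -/

/-- Isobaric polynomials of weight `n` with rational coefficients in the functions `S`, where the
functions in `S m` have weight `m`. A function may have several weights; nothing is assumed about
relations between the generators. -/
inductive IsIsobaric (S : ℕ → Set (ℍ → ℂ)) : ℕ → (ℍ → ℂ) → Prop
  | of {n : ℕ} {f : ℍ → ℂ} : f ∈ S n → IsIsobaric S n f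
  | zero (n : ℕ) : IsIsobaric S n 0
  | one : IsIsobaric S 0 1
  | add {n : ℕ} {f g : ℍ → ℂ} : IsIsobaric S n f → IsIsobaric S n g → IsIsobaric S n (f + g)
  | smul {n : ℕ} {f : ℍ → ℂ} (c : ℚ) : IsIsobaric S n f → IsIsobaric S n (c • f)
  | mul {m n : ℕ} {f g : ℍ → ℂ} :
      IsIsobaric S m f → IsIsobaric S n g → IsIsobaric S (m + n) (f * g)

/-- The Eisenstein series of level one, by weight. -/
def eisGenOne (n : ℕ) : Set (ℍ → ℂ) := {f | ∃ l : ℕ, 1 ≤ l ∧ n = 2 * l ∧ f = eisE l}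

/-- The generators of `eisRing`, by weight. -/
def eisGenTwo (n : ℕ) : Set (ℍ → ℂ) :=
  {f | ∃ l : ℕ, 1 ≤ l ∧ n = 2 * l ∧ (f = eisE l ∨ f = eisE1 l)}

lemma rat_smul_eq (c : ℚ) (f : ℍ → ℂ) : c • f = (c : ℂ) • f := by
  ext τ
  simp [Rat.smul_def]

namespace IsIsobaric

variable {S T : ℕ → Set (ℍ → ℂ)} {n : ℕ} {f g : ℍ → ℂ}

lemma mono (h : ∀ n, S n ⊆ T n) (hf : IsIsobaric S n f) : IsIsobaric T n f := by
  induction hf with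
  | of h1 => exact .of (h _ h1)
  | zero => exact .zero _
  | one => exact .one
  | add _ _ h1 h2 => exact h1.add h2
  | smul c _ h1 => exact h1.smul c
  | mul _ _ h1 h2 => exact h1.mul h2

lemma sub (hf : IsIsobaric S n f) (hg : IsIsobaric S n g) : IsIsobaric S n (f - g) := by
  have h := hf.add (hg.smul (-1))
  rwa [neg_one_smul, ← sub_eq_add_neg] at h

lemma neg (hf : IsIsobaric S n f) : IsIsobaric S n (-f) := by
  have h := hf.smul (-1)
  rwa [neg_one_smul] at h

lemma sum {ι : Type*} (s : Finset ι) {F : ι → ℍ → ℂ} (h : ∀ i ∈ s, IsIsobaric S n (F i)) :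
    IsIsobaric S n (∑ i ∈ s, F i) :=
  Finset.sum_induction F (IsIsobaric S n) (fun _ _ h1 h2 ↦ h1.add h2) (.zero n) h

lemma congr_weight {m : ℕ} (h : m = n) (hf : IsIsobaric S m f) : IsIsobaric S n f := h ▸ hf

lemma mdifferentiable (hf : IsIsobaric eisGenTwo n f) : MDifferentiable 𝓘(ℂ) 𝓘(ℂ) f := by
  induction hf with
  | of h =>
    obtain ⟨l, hl, -, rfl | rfl⟩ := h
    exacts [mdifferentiable_eisE hl, mdifferentiable_eisE1 hl]
  | zero => exact mdifferentiable_zero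
  | one => exact mdifferentiable_one
  | add _ _ h1 h2 => exact h1.add h2
  | smul c _ h1 => rw [rat_smul_eq]; exact h1.const_smul _
  | mul _ _ h1 h2 => exact h1.mul h2

lemma mem_eisRing (hf : IsIsobaric eisGenTwo n f) : f ∈ eisRing := by
  induction hf with
  | of h =>
    obtain ⟨l, hl, -, h⟩ := h
    exact Algebra.subset_adjoin ⟨l, hl, h⟩
  | zero => exact zero_mem _
  | one => exact one_mem _
  | add _ _ h1 h2 => exact add_mem h1 h2
  | smul c _ h1 => exact eisRing.smul_mem h1 c
  | mul _ _ h1 h2 => exact mul_mem h1 h2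

lemma hasQuasiModularPolynomial (hf : IsIsobaric eisGenTwo n f) :
    HasQuasiModularPolynomial (CongruenceSubgroup.Gamma0 2) n f := by
  induction hf with
  | of h =>
    obtain ⟨l, hl, rfl, rfl | rfl⟩ := h
    · push_cast
      exact (hasQuasiModularPolynomial_eisE hl).mono le_top
    · rw [eisE1_eq, rat_smul_eq, rat_smul_eq]
      push_cast
      exact ((hasQuasiModularPolynomial_eisE hl).doubleHom.smul _).add
        (((hasQuasiModularPolynomial_eisE hl).mono le_top).smul _)
  | zero n => exact ⟨0, fun i ↦ by simp [zero_mem], fun γ _ τ ↦ by simp [SlashAction.zero_slash]⟩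
  | one => exact .one
  | add _ _ h1 h2 => exact h1.add h2
  | smul c _ h1 => rw [rat_smul_eq]; exact h1.smul _
  | mul _ _ h1 h2 => push_cast; exact h1.mul h2

lemma eisGenOne_subset (n : ℕ) : eisGenOne n ⊆ eisGenTwo n := by
  rintro f ⟨l, hl, hn, rfl⟩
  exact ⟨l, hl, hn, Or.inl rfl⟩

lemma toTwo (hf : IsIsobaric eisGenOne n f) : IsIsobaric eisGenTwo n f := hf.mono eisGenOne_subset

lemma doubleHom_eisE {l : ℕ} (hl : 1 ≤ l) :
    IsIsobaric eisGenTwo (2 * l) (doubleHom (eisE l)) := by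
  have h : doubleHom (eisE l) = (1 / 2 : ℚ) • (eisE1 l + eisE l) := by
    rw [eisE1_eq]
    module
  rw [h]
  exact .smul _ (.add (.of ⟨l, hl, rfl, Or.inr rfl⟩) (.of ⟨l, hl, rfl, Or.inl rfl⟩))

lemma doubleHom (hf : IsIsobaric eisGenOne n f) : IsIsobaric eisGenTwo n (doubleHom f) := by
  induction hf with
  | of h =>
    obtain ⟨l, hl, rfl, rfl⟩ := h
    exact doubleHom_eisE hl
  | zero => rw [map_zero]; exact .zero _
  | one => rw [map_one]; exact .one
  | add _ _ h1 h2 => rw [map_add]; exact h1.add h2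
  | smul c _ h1 => rw [map_rat_smul]; exact h1.smul c
  | mul _ _ h1 h2 => rw [map_mul]; exact h1.mul h2

/-- A derivation maps isobaric polynomials to isobaric polynomials as soon as it does so for the
generators. -/
lemma qD_of_generators (hd : ∀ n, ∀ f ∈ S n, MDifferentiable 𝓘(ℂ) 𝓘(ℂ) f)
    (h : ∀ n, ∀ f ∈ S n, IsIsobaric S (n + 2) (qD f)) (hf : IsIsobaric S n f) :
    MDifferentiable 𝓘(ℂ) 𝓘(ℂ) f ∧ IsIsobaric S (n + 2) (qD f) := by
  induction hf with
  | of h1 => exact ⟨hd _ _ h1, h _ _ h1⟩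
  | zero => exact ⟨mdifferentiable_zero, by rw [qD_zero]; exact .zero _⟩
  | one => exact ⟨mdifferentiable_one, by rw [qD_one]; exact .zero _⟩
  | add _ _ h1 h2 => exact ⟨h1.1.add h2.1, by rw [qD_add h1.1 h2.1]; exact h1.2.add h2.2⟩
  | smul c _ h1 =>
    rw [rat_smul_eq]
    refine ⟨h1.1.const_smul _, ?_⟩
    rw [qD_smul _ h1.1, ← rat_smul_eq]
    exact h1.2.smul c
  | mul hf hg h1 h2 =>
    refine ⟨h1.1.mul h2.1, ?_⟩
    rw [qD_mul h1.1 h2.1]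
    exact ((h1.2.mul hg).congr_weight (by ring)).add ((hf.mul h2.2).congr_weight (by ring))

end IsIsobaric

/-! ### The Taylor coefficients of the odd theta function -/

/-- The Taylor coefficients of `θ(z) / (z θ'(0))` for the odd theta function `θ`. -/
def oddThetaCoeff (j : ℕ) : ℍ → ℂ := fun τ ↦
  thetaMoment (1 / 2) (1 / 2) (j + 1) τ /
    (((j + 1).factorial : ℂ) * thetaMoment (1 / 2) (1 / 2) 1 τ)

/-- The coefficients of `logDerivSeries`, as functions on the upper half-plane. -/
def logDerivCoeff (n : ℕ) : ℍ → ℂ := fun τ ↦ (logDerivSeries τ).coeff n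

lemma logDerivCoeff_zero : logDerivCoeff 0 = 1 := by
  ext τ; simp [logDerivCoeff, logDerivSeries]

lemma logDerivCoeff_odd {n : ℕ} (h : ¬ Even n) : logDerivCoeff n = 0 := by
  ext τ; simp [logDerivCoeff, logDerivSeries, h]

lemma logDerivCoeff_two_mul {l : ℕ} (hl : 1 ≤ l) :
    logDerivCoeff (2 * l) = (4 * l / ((2 * l).factorial : ℚ) : ℚ) • eisE l := by
  rw [rat_smul_eq]
  ext τ
  simp only [logDerivCoeff, logDerivSeries, PowerSeries.coeff_mk, even_two_mul, if_true,
    if_neg (by omega : 2 * l ≠ 0), Nat.mul_div_cancel_left l two_pos, Pi.smul_apply, smul_eq_mul]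
  push_cast
  ring

lemma isIsobaric_logDerivCoeff (n : ℕ) : IsIsobaric eisGenOne n (logDerivCoeff n) := by
  by_cases h : Even n
  · obtain ⟨l, rfl⟩ := h
    rw [← two_mul]
    rcases Nat.eq_zero_or_pos l with rfl | hl
    · rw [mul_zero, logDerivCoeff_zero]; exact .one
    · rw [logDerivCoeff_two_mul hl]
      exact .smul _ (.of ⟨l, hl, rfl, rfl⟩)
  · rw [logDerivCoeff_odd h]; exact .zero n

lemma oddThetaCoeff_zero : oddThetaCoeff 0 = 1 := by
  ext τ
  have h := thetaMoment_one_ne_zero τ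
  simp only [oddThetaCoeff, zero_add, Nat.factorial_one, Nat.cast_one, one_mul, div_self h,
    Pi.one_apply]

lemma coeff_succ_taylorSeries_oddTheta (τ : ℍ) (j : ℕ) :
    (taylorSeries fun z ↦ oddTheta z τ).coeff (j + 1) =
      thetaMoment (1 / 2) (1 / 2) 1 τ * oddThetaCoeff j τ := by
  have h1 := thetaMoment_one_ne_zero τ
  have h2 : ((j + 1).factorial : ℂ) ≠ 0 := by exact_mod_cast Nat.factorial_ne_zero _
  rw [coeff_taylorSeries_oddTheta, oddThetaCoeff]
  field_simp

/-- The recursion for the Taylor coefficients of `θ` coming from its logarithmic derivative. -/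
lemma succ_smul_oddThetaCoeff (j : ℕ) : ((j + 1 : ℕ) : ℚ) • oddThetaCoeff j =
    ∑ a ∈ Finset.range (j + 1), oddThetaCoeff a * logDerivCoeff (j - a) := by
  ext τ
  have h := congrArg (PowerSeries.coeff (j + 1)) (X_mul_derivative_taylorSeries_oddTheta τ)
  have h1 := thetaMoment_one_ne_zero τ
  have h0 : (taylorSeries fun z ↦ oddTheta z τ).coeff 0 = 0 := by
    rw [coeff_taylorSeries, iteratedDeriv_zero, oddTheta_zero, zero_div]
  rw [PowerSeries.coeff_succ_X_mul, PowerSeries.coeff_derivative,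
    coeff_succ_taylorSeries_oddTheta, PowerSeries.coeff_mul,
    Finset.Nat.sum_antidiagonal_eq_sum_range_succ_mk, Finset.sum_range_succ', h0, zero_mul,
    add_zero] at h
  simp only [coeff_succ_taylorSeries_oddTheta, Nat.add_sub_add_right, mul_assoc] at h
  rw [← Finset.mul_sum] at h
  have h2 := mul_left_cancel₀ h1 h
  rw [rat_smul_eq, Pi.smul_apply, Finset.sum_apply, smul_eq_mul]
  simp only [Pi.mul_apply, logDerivCoeff]
  rw [← h2]
  push_cast
  ring

lemma isIsobaric_oddThetaCoeff (j : ℕ) : IsIsobaric eisGenOne j (oddThetaCoeff j) := by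
  induction j using Nat.strong_induction_on with
  | _ j ih =>
    rcases Nat.eq_zero_or_pos j with rfl | hj
    · rw [oddThetaCoeff_zero]; exact .one
    have h := succ_smul_oddThetaCoeff j
    rw [Finset.sum_range_succ, Nat.sub_self, logDerivCoeff_zero, mul_one] at h
    have h1 : oddThetaCoeff j = (1 / (j : ℚ)) •
        ∑ a ∈ Finset.range j, oddThetaCoeff a * logDerivCoeff (j - a) := by
      have hj0 : (j : ℚ) ≠ 0 := by exact_mod_cast hj.ne'
      rw [eq_sub_iff_add_eq.mpr h.symm]
      push_cast
      rw [add_smul, one_smul, add_sub_cancel_right, smul_smul, one_div_mul_cancel hj0, one_smul]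
    rw [h1]
    refine .smul _ (.sum _ fun a ha ↦ ?_)
    have ha' := Finset.mem_range.mp ha
    exact ((ih a ha').mul (isIsobaric_logDerivCoeff (j - a))).congr_weight (by omega)

lemma oddThetaCoeff_two : oddThetaCoeff 2 = eisE 1 := by
  have h := succ_smul_oddThetaCoeff 2
  simp only [Finset.sum_range_succ, Finset.range_zero, Finset.sum_empty, Nat.sub_zero,
    Nat.sub_self, logDerivCoeff_zero, oddThetaCoeff_zero, zero_add, one_mul, mul_one,
    logDerivCoeff_odd (n := 2 - 1) (by decide), mul_zero, add_zero] at h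
  rw [logDerivCoeff_two_mul (l := 1) le_rfl] at h
  norm_num [Nat.factorial] at h
  have h3 : (2 : ℚ) • oddThetaCoeff 2 = (2 : ℚ) • eisE 1 := by
    have : (3 : ℚ) • oddThetaCoeff 2 = (2 : ℚ) • oddThetaCoeff 2 + oddThetaCoeff 2 := by module
    rw [this] at h
    exact add_right_cancel h
  exact smul_right_injective _ (two_ne_zero) h3

lemma oddThetaCoeff_one : oddThetaCoeff 1 = 0 := by
  have h := succ_smul_oddThetaCoeff 1
  simp only [Finset.sum_range_succ, Finset.range_zero, Finset.sum_empty, Nat.sub_zero,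
    Nat.sub_self, logDerivCoeff_zero, oddThetaCoeff_zero, zero_add, one_mul, mul_one,
    logDerivCoeff_odd (n := 1) (by decide)] at h
  have h3 : (2 : ℚ) • oddThetaCoeff 1 = oddThetaCoeff 1 + oddThetaCoeff 1 := by module
  push_cast at h
  rw [h3] at h
  simpa using h

/-- The heat equation for the odd theta function, on Taylor coefficients. The second term comes from
the normalization by `θ'(0)`. -/
lemma qD_oddThetaCoeff (j : ℕ) : qD (oddThetaCoeff j) =
    (((j : ℚ) + 3) * (j + 2) / 2) • oddThetaCoeff (j + 2) -
      (3 : ℚ) • (oddThetaCoeff 2 * oddThetaCoeff j) := by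
  have hM := mdifferentiable_thetaMoment (κ := 1 / 2) (by norm_num) (1 / 2)
  have hD := qD_thetaMoment (κ := 1 / 2) (by norm_num) (1 / 2)
  have he := (isIsobaric_oddThetaCoeff j).toTwo.mdifferentiable
  have hmul : ∀ i, thetaMoment (1 / 2) (1 / 2) (i + 1) =
      ((i + 1).factorial : ℂ) • (thetaMoment (1 / 2) (1 / 2) 1 * oddThetaCoeff i) := fun i ↦ by
    ext τ
    have h1 := thetaMoment_one_ne_zero τ
    have h2 : ((i + 1).factorial : ℂ) ≠ 0 := by exact_mod_cast Nat.factorial_ne_zero _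
    simp only [Pi.smul_apply, Pi.mul_apply, oddThetaCoeff, smul_eq_mul]
    field_simp
  have h := congrArg qD (hmul j)
  rw [qD_smul _ ((hM 1).mul he), qD_mul (hM 1) he, hD, hD, hmul (j + 2),
    show 1 + 2 = 2 + 1 from rfl, hmul 2] at h
  ext τ
  have hτ := congrFun h τ
  have h1 := thetaMoment_one_ne_zero τ
  have h2 : ((j + 1).factorial : ℂ) ≠ 0 := by exact_mod_cast Nat.factorial_ne_zero _
  have h3 : ((j + 2 + 1).factorial : ℂ) = (j + 3) * (j + 2) * ((j + 1).factorial : ℂ) := by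
    rw [Nat.factorial_succ, Nat.factorial_succ]; push_cast; ring
  rw [rat_smul_eq, rat_smul_eq]
  simp only [Pi.smul_apply, Pi.mul_apply, Pi.add_apply, Pi.sub_apply, smul_eq_mul, h3] at hτ ⊢
  rw [show (Nat.factorial (2 + 1) : ℂ) = 6 by norm_num [Nat.factorial]] at hτ
  push_cast at hτ ⊢
  apply mul_left_cancel₀ (mul_ne_zero h1 h2)
  linear_combination -hτ

/-- The derivatives of the Eisenstein series are computed recursively from the heat equation. -/
lemma isIsobaric_qD_logDerivCoeff (n : ℕ) :
    IsIsobaric eisGenOne (n + 2) (qD (logDerivCoeff n)) := by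
  induction n using Nat.strong_induction_on with
  | _ n ih =>
    have hY : ∀ i, MDifferentiable 𝓘(ℂ) 𝓘(ℂ) (logDerivCoeff i) := fun i ↦
      (isIsobaric_logDerivCoeff i).toTwo.mdifferentiable
    have hε : ∀ i, MDifferentiable 𝓘(ℂ) 𝓘(ℂ) (oddThetaCoeff i) := fun i ↦
      (isIsobaric_oddThetaCoeff i).toTwo.mdifferentiable
    have hεD : ∀ i, IsIsobaric eisGenOne (i + 2) (qD (oddThetaCoeff i)) := fun i ↦ by
      rw [qD_oddThetaCoeff]
      exact ((isIsobaric_oddThetaCoeff _).smul _).sub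
        ((((isIsobaric_oddThetaCoeff 2).mul (isIsobaric_oddThetaCoeff i)).congr_weight
          (by ring)).smul _)
    have h := succ_smul_oddThetaCoeff n
    rw [Finset.sum_range_succ', Nat.sub_zero, oddThetaCoeff_zero, one_mul, rat_smul_eq] at h
    have h1 := congrArg qD h
    rw [qD_smul _ (hε n), qD_add (mdifferentiable_finset_sum _ fun i _ ↦ (hε _).mul (hY _)) (hY n),
      qD_sum _ fun i _ ↦ (hε _).mul (hY _), ← rat_smul_eq] at h1
    rw [← sub_eq_iff_eq_add'.mpr h1]
    refine ((hεD n).smul _).sub (.sum _ fun i hi ↦ ?_)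
    have hi' := Finset.mem_range.mp hi
    rw [qD_mul (hε _) (hY _)]
    exact (((hεD _).mul (isIsobaric_logDerivCoeff _)).congr_weight (by omega)).add
      (((isIsobaric_oddThetaCoeff _).mul (ih _ (by omega))).congr_weight (by omega))

lemma isIsobaric_qD_eisE {l : ℕ} (hl : 1 ≤ l) :
    IsIsobaric eisGenOne (2 * l + 2) (qD (eisE l)) := by
  have h := isIsobaric_qD_logDerivCoeff (2 * l)
  have hc : (4 * l / ((2 * l).factorial : ℚ) : ℚ) ≠ 0 := by positivity
  rw [logDerivCoeff_two_mul hl, rat_smul_eq, qD_smul _ (mdifferentiable_eisE hl),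
    ← rat_smul_eq] at h
  have h1 := h.smul (4 * l / ((2 * l).factorial : ℚ) : ℚ)⁻¹
  rwa [smul_smul, inv_mul_cancel₀ hc, one_smul] at h1

/-- The ring generated by the Eisenstein series is closed under the derivation. -/
lemma IsIsobaric.qD {n : ℕ} {f : ℍ → ℂ} (hf : IsIsobaric eisGenTwo n f) :
    IsIsobaric eisGenTwo (n + 2) (qD f) := by
  refine (hf.qD_of_generators (fun n f h ↦ (IsIsobaric.of h).mdifferentiable) ?_).2
  rintro n f ⟨l, hl, rfl, rfl | rfl⟩
  · exact (isIsobaric_qD_eisE hl).toTwo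
  · have hE := mdifferentiable_eisE hl
    rw [eisE1_eq, rat_smul_eq, rat_smul_eq, qD_add ((mdifferentiable_doubleHom hE).const_smul _)
      (hE.const_smul _), qD_smul _ (mdifferentiable_doubleHom hE), qD_smul _ hE, qD_doubleHom,
      ← rat_smul_eq, ← rat_smul_eq]
    refine .add (.smul _ ?_) ((isIsobaric_qD_eisE hl).toTwo.smul _)
    have h := (isIsobaric_qD_eisE hl).doubleHom.smul 2
    rwa [rat_smul_eq, Rat.cast_ofNat] at h


/-! ### The differential equation of the theta functions -/

lemma IsIsobaric.eq_zero_of_odd {n : ℕ} {f : ℍ → ℂ} (hf : IsIsobaric eisGenTwo n f)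
    (hn : Odd n) : f = 0 := by
  induction hf with
  | of h =>
    obtain ⟨l, -, rfl, -⟩ := h
    exact absurd hn (Nat.not_odd_iff_even.mpr (even_two_mul l))
  | zero => rfl
  | one => exact absurd hn (by decide)
  | add _ _ h1 h2 => rw [h1 hn, h2 hn, add_zero]
  | smul c _ h1 => rw [h1 hn, smul_zero]
  | @mul m n f g _ _ h1 h2 =>
    rcases Nat.even_or_odd m with hm | hm
    · have hn' : Odd n := by
        rcases hm with ⟨a, rfl⟩
        rcases hn with ⟨b, hb⟩
        exact ⟨b - a, by omega⟩
      rw [h2 hn', mul_zero]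
    · rw [h1 hm, zero_mul]

/-- A formal power series whose `n`-th coefficient is isobaric of weight `n`. -/
def IsIsobaricSeries (A : PowerSeries (ℍ → ℂ)) : Prop :=
  ∀ n, IsIsobaric eisGenTwo n (A.coeff n)

namespace IsIsobaricSeries

variable {A B : PowerSeries (ℍ → ℂ)}

lemma mul (hA : IsIsobaricSeries A) (hB : IsIsobaricSeries B) : IsIsobaricSeries (A * B) := by
  intro n
  rw [PowerSeries.coeff_mul]
  refine .sum _ fun p hp ↦ ?_
  exact ((hA p.1).mul (hB p.2)).congr_weight (Finset.HasAntidiagonal.mem_antidiagonal.mp hp)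

lemma pow (hA : IsIsobaricSeries A) (m : ℕ) : IsIsobaricSeries (A ^ m) := by
  induction m with
  | zero =>
    intro n
    rw [pow_zero, PowerSeries.coeff_one]
    split_ifs with h
    · rw [h]; exact .one
    · exact .zero n
  | succ m ih => rw [pow_succ]; exact ih.mul hA

lemma invOfUnit (hA : IsIsobaricSeries A) : IsIsobaricSeries (PowerSeries.invOfUnit A 1) := by
  intro n
  induction n using Nat.strong_induction_on with
  | _ n ih =>
    rw [PowerSeries.coeff_invOfUnit]
    split_ifs with h
    · rw [h, inv_one, Units.val_one]; exact .one
    · rw [inv_one, Units.val_one, neg_one_mul]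
      refine .neg (.sum _ fun p hp ↦ ?_)
      split_ifs with h1
      · exact ((hA p.1).mul (ih p.2 h1)).congr_weight
          (Finset.HasAntidiagonal.mem_antidiagonal.mp hp)
      · exact .zero n

end IsIsobaricSeries

/-- The Taylor series of `θ(z; τ) / (z θ'(0; τ))`. -/
def oddThetaSeries : PowerSeries (ℍ → ℂ) := PowerSeries.mk oddThetaCoeff

/-- The Taylor series of `θ(2 z; 2 τ) / (2 z θ'(0; 2 τ))`. -/
def oddThetaSeriesDouble : PowerSeries (ℍ → ℂ) :=
  PowerSeries.mk fun j ↦ ((2 : ℚ) ^ j) • doubleHom (oddThetaCoeff j)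

/-- The Taylor series of `z ^ (2k+1) θ(2 z; 2 τ) / θ(z; τ) ^ (2k+2)`, up to a constant. -/
def kernelSeries (k : ℕ) : PowerSeries (ℍ → ℂ) :=
  oddThetaSeriesDouble * PowerSeries.invOfUnit oddThetaSeries 1 ^ (2 * k + 2)

lemma constantCoeff_oddThetaSeries : PowerSeries.constantCoeff oddThetaSeries = 1 := by
  rw [← PowerSeries.coeff_zero_eq_constantCoeff_apply, oddThetaSeries, PowerSeries.coeff_mk,
    oddThetaCoeff_zero]

lemma kernelSeries_mul_pow (k : ℕ) :
    kernelSeries k * oddThetaSeries ^ (2 * k + 2) = oddThetaSeriesDouble := by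
  have h := PowerSeries.mul_invOfUnit oddThetaSeries 1
    (by rw [constantCoeff_oddThetaSeries, Units.val_one])
  rw [kernelSeries, mul_assoc, ← mul_pow, mul_comm _ oddThetaSeries, h, one_pow, mul_one]

lemma isIsobaricSeries_kernelSeries (k : ℕ) : IsIsobaricSeries (kernelSeries k) := by
  have h1 : IsIsobaricSeries oddThetaSeries := fun n ↦ by
    rw [oddThetaSeries, PowerSeries.coeff_mk]; exact (isIsobaric_oddThetaCoeff n).toTwo
  have h2 : IsIsobaricSeries oddThetaSeriesDouble := fun n ↦ by
    rw [oddThetaSeriesDouble, PowerSeries.coeff_mk]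
    exact (isIsobaric_oddThetaCoeff n).doubleHom.smul _
  exact h2.mul (h1.invOfUnit.pow _)

lemma coeff_zero_kernelSeries (k : ℕ) : (kernelSeries k).coeff 0 = 1 := by
  have h := congrArg PowerSeries.constantCoeff (kernelSeries_mul_pow k)
  rw [map_mul, map_pow, constantCoeff_oddThetaSeries, one_pow, mul_one] at h
  rw [PowerSeries.coeff_zero_eq_constantCoeff_apply, h,
    ← PowerSeries.coeff_zero_eq_constantCoeff_apply, oddThetaSeriesDouble, PowerSeries.coeff_mk,
    oddThetaCoeff_zero, map_one, pow_zero, one_smul]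

lemma coeff_two_mul_of_coeff_one_eq_zero {R : Type*} [CommRing R] {A B : PowerSeries R}
    (hA : A.coeff 0 = 1) (hA1 : A.coeff 1 = 0) (hB : B.coeff 0 = 1) :
    (A * B).coeff 2 = A.coeff 2 + B.coeff 2 := by
  rw [PowerSeries.coeff_mul, Finset.Nat.sum_antidiagonal_eq_sum_range_succ_mk]
  simp [Finset.sum_range_succ, hA, hA1, hB, add_comm]

lemma coeff_pow_of_coeff_one_eq_zero {R : Type*} [CommRing R] {A : PowerSeries R}
    (hA : A.coeff 0 = 1) (hA1 : A.coeff 1 = 0) (m : ℕ) :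
    (A ^ m).coeff 0 = 1 ∧ (A ^ m).coeff 1 = 0 ∧ (A ^ m).coeff 2 = m * A.coeff 2 := by
  induction m with
  | zero => simp [PowerSeries.coeff_one]
  | succ m ih =>
    obtain ⟨h0, h1, h2⟩ := ih
    rw [pow_succ]
    refine ⟨?_, ?_, ?_⟩
    · rw [PowerSeries.coeff_mul]; simp [h0, hA]
    · rw [PowerSeries.coeff_mul, Finset.Nat.sum_antidiagonal_eq_sum_range_succ_mk]
      simp [Finset.sum_range_succ, h0, h1, hA, hA1]
    · rw [coeff_two_mul_of_coeff_one_eq_zero h0 h1 hA, h2]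
      push_cast; ring

lemma coeff_two_kernelSeries (k : ℕ) :
    (kernelSeries k).coeff 2 = (2 : ℂ) • eisE1 1 - (2 * k : ℂ) • eisE 1 := by
  have h1 : oddThetaSeries.coeff 0 = 1 := by
    rw [PowerSeries.coeff_zero_eq_constantCoeff_apply, constantCoeff_oddThetaSeries]
  have h2 : oddThetaSeries.coeff 1 = 0 := by
    rw [oddThetaSeries, PowerSeries.coeff_mk, oddThetaCoeff_one]
  obtain ⟨p0, p1, p2⟩ := coeff_pow_of_coeff_one_eq_zero h1 h2 (2 * k + 2)
  have h := congrArg (PowerSeries.coeff 2) (kernelSeries_mul_pow k)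
  rw [mul_comm, coeff_two_mul_of_coeff_one_eq_zero p0 p1 (coeff_zero_kernelSeries k), p2,
    oddThetaSeriesDouble, oddThetaSeries, PowerSeries.coeff_mk, PowerSeries.coeff_mk,
    oddThetaCoeff_two, rat_smul_eq] at h
  rw [eq_sub_of_add_eq' h, eisE1_eq, rat_smul_eq, rat_smul_eq]
  ext τ
  simp
  ring

lemma taylorSeries_comp_mul {f : ℂ → ℂ} (hf : Differentiable ℂ f) (c : ℂ) (n : ℕ) :
    (taylorSeries fun z ↦ f (c * z)).coeff n = c ^ n * (taylorSeries f).coeff n := by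
  rw [coeff_taylorSeries, coeff_taylorSeries, iteratedDeriv_comp_const_mul hf.contDiff]
  simp [mul_div_assoc]

lemma coeff_taylorSeries_dslope {f : ℂ → ℂ} (hf : AnalyticAt ℂ f 0) (n : ℕ) :
    (taylorSeries (dslope f 0)).coeff n = (taylorSeries f).coeff (n + 1) := by
  rw [taylorSeries_eq_add_X_mul hf, map_add, PowerSeries.coeff_C, if_neg n.succ_ne_zero, zero_add,
    PowerSeries.coeff_succ_X_mul]

lemma oddTheta_add_two_pi_I (z τ : ℂ) :
    oddTheta (z + 2 * Real.pi * Complex.I) τ = -oddTheta z τ := by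
  have h := thetaSeries_add_two_pi_I (1 / 2) (1 / 2) z τ 1 (-1) fun m ↦ by
    have h1 : (2 * ((1 / 2 : ℝ) : ℂ) * (m + ((1 / 2 : ℝ) : ℂ)) *
        (2 * Real.pi * Complex.I * (1 : ℤ))) =
        m * (2 * Real.pi * Complex.I) + Real.pi * Complex.I := by
      push_cast; ring
    rw [h1, Complex.exp_add, Complex.exp_int_mul_two_pi_mul_I, Complex.exp_pi_mul_I, one_mul]
  rwa [Int.cast_one, mul_one, neg_one_mul] at h

lemma oddTheta_add_two_pi_I_mul (z τ : ℂ) : oddTheta (z + 2 * Real.pi * Complex.I * τ) τ =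
    -Complex.exp (-(Real.pi * Complex.I * τ) - z) * oddTheta z τ := by
  rw [oddTheta, thetaSeries_add_two_pi_I_mul]
  congr 3
  push_cast; ring

/-- With `f(z) = ∑_n (-1) ^ n q ^ (k (n + s / 2k) ^ 2) e ^ ((2 k n + s) z)`, the function
`f(z) θ(2 z; 2 τ) / θ(z; τ) ^ (2k+2)` has the periods `2 π i` and `2 π i τ`, and its only pole in a
period rectangle is the origin, of order `2 k + 1`. So its residue there vanishes, which is this
relation between the Taylor coefficients of the factors. -/
lemma sum_thetaMoment_mul_kernelSeries {k : ℕ} (hk : 1 ≤ k) (s : ℕ) (τ : ℍ) :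
    ∑ a ∈ Finset.range (2 * k + 1), (2 * k : ℂ) ^ a / (a.factorial : ℂ) *
      thetaMoment k (s / (2 * k)) a τ * (kernelSeries k).coeff (2 * k - a) τ = 0 := by
  have hkpos : (0 : ℝ) < k := by exact_mod_cast hk
  have hk0 : (k : ℂ) ≠ 0 := by exact_mod_cast hkpos.ne'
  have hpi : 0 < Real.pi * τ.im := mul_pos Real.pi_pos τ.im_pos
  set f : ℂ → ℂ := fun z ↦ thetaSeries k (s / (2 * k)) 0 z τ with hfdef
  set θ : ℂ → ℂ := fun z ↦ oddTheta z τ with hθdef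
  set N : ℂ → ℂ := fun z ↦ oddTheta (2 * z) (double τ) with hNdef
  have hf : Differentiable ℂ f := differentiable_thetaSeries hkpos _ _ τ.im_pos
  have hθ : Differentiable ℂ θ := differentiable_thetaSeries (by norm_num) _ _ τ.im_pos
  have hN2 : Differentiable ℂ fun z ↦ oddTheta z (double τ) :=
    differentiable_thetaSeries (by norm_num) _ _ (double τ).im_pos
  have hN : Differentiable ℂ N := hN2.comp (differentiable_id.const_mul 2)
  have hθ0 : θ 0 = 0 := oddTheta_zero τ
  have hN0 : N 0 = 0 := by simp only [hNdef, mul_zero]; exact oddTheta_zero (double τ)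
  have hds : ∀ {g : ℂ → ℂ}, Differentiable ℂ g → Differentiable ℂ (dslope g 0) := fun hg ↦
    differentiableOn_univ.mp ((Complex.differentiableOn_dslope Filter.univ_mem).mpr
      (differentiableOn_univ.mpr hg))
  set v := dslope θ 0 with hv
  set n := dslope N 0 with hn
  have hθv : ∀ z, θ z = z * v z := fun z ↦ by rw [eq_add_mul_dslope θ z, hθ0, zero_add]
  have hNn : ∀ z, N z = z * n z := fun z ↦ by rw [eq_add_mul_dslope N z, hN0, zero_add]
  set U : Set ℂ := {z | |z.re| < 2 * Real.pi * τ.im ∧ |z.im| < 2 * Real.pi} with hU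
  have hUo : IsOpen U := (isOpen_lt Complex.continuous_re.abs continuous_const).inter
    (isOpen_lt Complex.continuous_im.abs continuous_const)
  have hRU : closedRect (Real.pi * τ.im) Real.pi ⊆ U := fun z hz ↦
    ⟨by have := hz.1; linarith, by have := hz.2; have := Real.pi_pos; linarith⟩
  have hv0 : v 0 = thetaMoment (1 / 2) (1 / 2) 1 τ := by
    rw [hv, dslope_same, (hasDerivAt_oddTheta τ 0).deriv]; rfl
  have hvU : ∀ z ∈ U, v z ≠ 0 := fun z hz h0 ↦ by
    by_cases hz0 : z = 0
    · rw [hz0, hv0] at h0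
      exact thetaMoment_one_ne_zero τ h0
    · exact oddTheta_ne_zero τ hz.1 hz.2 hz0 ((hθv z).trans (by rw [h0, mul_zero]))
  set w : ℂ → ℂ := fun z ↦ f z * n z * (v z ^ (2 * k + 2))⁻¹ with hw
  have hwU : DifferentiableOn ℂ w U :=
    (hf.mul (hds hN)).differentiableOn.mul
      (((hds hθ).pow _).differentiableOn.inv fun z hz ↦ pow_ne_zero _ (hvU z hz))
  -- the doubly periodic function
  set F : ℂ → ℂ := fun z ↦ f z * N z / θ z ^ (2 * k + 2) with hF
  have hF1 : ∀ z, F (z + 2 * Real.pi * Complex.I) = F z := fun z ↦ by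
    have e1 : f (z + 2 * Real.pi * Complex.I) = f z := by
      have := thetaSeries_add_two_pi_I k (s / (2 * k)) z τ 1 1 fun m ↦ by
        rw [Complex.exp_eq_one_iff]
        refine ⟨2 * k * m + s, ?_⟩
        push_cast
        field_simp
      simpa using this
    have e2 : θ (z + 2 * Real.pi * Complex.I) = -θ z := oddTheta_add_two_pi_I z τ
    have e3 : N (z + 2 * Real.pi * Complex.I) = N z := by
      simp only [hNdef]
      rw [show 2 * (z + 2 * Real.pi * Complex.I) =
        2 * z + 2 * Real.pi * Complex.I + 2 * Real.pi * Complex.I by ring, oddTheta_add_two_pi_I,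
        oddTheta_add_two_pi_I, neg_neg]
    simp only [hF, e1, e2, e3]
    rw [Even.neg_pow ⟨k + 1, by ring⟩]
  have hF2 : ∀ z, F (z + 2 * Real.pi * Complex.I * τ) = F z := fun z ↦ by
    have e1 := thetaSeries_add_two_pi_I_mul k (s / (2 * k)) z τ
    have e4 : 2 * (z + 2 * Real.pi * Complex.I * τ) =
        2 * z + 2 * Real.pi * Complex.I * (double τ) := by rw [coe_double]; ring
    simp only [hF, hfdef, hNdef, hθdef]
    rw [e4, e1, oddTheta_add_two_pi_I_mul, oddTheta_add_two_pi_I_mul, mul_pow,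
      Even.neg_pow ⟨k + 1, by ring⟩, ← Complex.exp_nat_mul]
    have e5 : Complex.exp (-(2 * Real.pi * Complex.I * (k : ℝ) * τ) - 2 * (k : ℝ) * z) *
        Complex.exp (-(Real.pi * Complex.I * double τ) - 2 * z) =
        Complex.exp ((2 * k + 2 : ℕ) * (-(Real.pi * Complex.I * τ) - z)) := by
      rw [← Complex.exp_add, coe_double]
      congr 1
      push_cast; ring
    rw [← e5]
    have := Complex.exp_ne_zero (-(2 * Real.pi * Complex.I * (k : ℝ) * τ) - 2 * (k : ℝ) * z)
    have := Complex.exp_ne_zero (-(Real.pi * Complex.I * double τ) - 2 * z)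
    field_simp
  have hint : rectIntegral (Real.pi * τ.im) Real.pi F = 0 :=
    rectIntegral_eq_zero_of_periodic τ hF1 hF2
  have hcongr : rectIntegral (Real.pi * τ.im) Real.pi F =
      rectIntegral (Real.pi * τ.im) Real.pi fun z ↦ w z / z ^ (2 * k + 1) := by
    refine rectIntegral_congr hpi Real.pi_pos fun z hz ↦ ?_
    have hz0 : z ≠ 0 := hz.2
    have hvz := hvU z (hRU hz.1)
    simp only [hF, hw]
    rw [hθv, hNn, mul_pow]
    field_simp
    ring
  rw [hcongr, rectIntegral_div_pow hpi Real.pi_pos hUo hRU hwU] at hint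
  have hcoeff : (taylorSeries w).coeff (2 * k) = 0 :=
    (mul_eq_zero.mp hint).resolve_right (rectIntegral_inv_ne_zero hpi Real.pi_pos)
  -- the Taylor series of the factors
  have hA : ∀ {g : ℂ → ℂ}, Differentiable ℂ g → AnalyticAt ℂ g 0 := fun hg ↦ hg.analyticAt 0
  have hvs : taylorSeries v = PowerSeries.C (thetaMoment (1 / 2) (1 / 2) 1 τ) *
      PowerSeries.map (evalAt τ) oddThetaSeries := by
    ext j
    rw [hv, coeff_taylorSeries_dslope (hA hθ), coeff_succ_taylorSeries_oddTheta,
      PowerSeries.coeff_C_mul, PowerSeries.coeff_map, oddThetaSeries, PowerSeries.coeff_mk]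
    rfl
  have hns : taylorSeries n =
      PowerSeries.C (2 * thetaMoment (1 / 2) (1 / 2) 1 (double τ)) *
      PowerSeries.map (evalAt τ) oddThetaSeriesDouble := by
    ext j
    rw [hn, coeff_taylorSeries_dslope (hA hN), taylorSeries_comp_mul hN2,
      coeff_succ_taylorSeries_oddTheta, PowerSeries.coeff_C_mul, PowerSeries.coeff_map,
      oddThetaSeriesDouble, PowerSeries.coeff_mk, rat_smul_eq]
    simp only [evalAt, Pi.evalRingHom_apply, Pi.smul_apply, doubleHom_apply, smul_eq_mul]
    push_cast
    ring
  have hprod : taylorSeries w * taylorSeries v ^ (2 * k + 2) = taylorSeries f * taylorSeries n := by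
    have hwA : AnalyticAt ℂ w 0 := hwU.analyticAt (hUo.mem_nhds (hRU ⟨by simpa using hpi.le,
      by simpa using Real.pi_pos.le⟩))
    rw [← taylorSeries_pow (hA (hds hθ)), ← taylorSeries_mul hwA ((hA (hds hθ)).fun_pow _),
      ← taylorSeries_mul (hA hf) (hA (hds hN))]
    refine taylorSeries_congr ?_
    filter_upwards [hUo.mem_nhds (hRU ⟨by simpa using hpi.le, by simpa using Real.pi_pos.le⟩)]
      with z hz
    simp only [hw]
    rw [mul_assoc, inv_mul_cancel₀ (pow_ne_zero _ (hvU z hz)), mul_one]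
  set c : ℂ := thetaMoment (1 / 2) (1 / 2) 1 τ ^ (2 * k + 2) with hc
  set d : ℂ := 2 * thetaMoment (1 / 2) (1 / 2) 1 (double τ) with hd
  have hc0 : c ≠ 0 := pow_ne_zero _ (thetaMoment_one_ne_zero τ)
  have hd0 : d ≠ 0 := mul_ne_zero two_ne_zero (thetaMoment_one_ne_zero _)
  set K := PowerSeries.map (evalAt τ) (kernelSeries k) with hK
  set O := PowerSeries.map (evalAt τ) oddThetaSeries with hO
  have hKO : K * O ^ (2 * k + 2) = PowerSeries.map (evalAt τ) oddThetaSeriesDouble := by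
    rw [← kernelSeries_mul_pow k, map_mul, map_pow]
  have hO0 : O ^ (2 * k + 2) ≠ 0 := by
    refine pow_ne_zero _ fun h0 ↦ ?_
    have := congrArg PowerSeries.constantCoeff h0
    rw [← PowerSeries.coeff_zero_eq_constantCoeff_apply, hO, PowerSeries.coeff_map,
      PowerSeries.coeff_zero_eq_constantCoeff_apply, constantCoeff_oddThetaSeries] at this
    simp at this
  rw [hvs, hns, ← hKO, mul_pow, ← map_pow, ← hc] at hprod
  have hprod2 : PowerSeries.C c * taylorSeries w = PowerSeries.C d * (taylorSeries f * K) := by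
    refine mul_right_cancel₀ hO0 ?_
    linear_combination hprod
  have h := congrArg (PowerSeries.coeff (2 * k)) hprod2
  rw [PowerSeries.coeff_C_mul, PowerSeries.coeff_C_mul, hcoeff, mul_zero, PowerSeries.coeff_mul,
    Finset.Nat.sum_antidiagonal_eq_sum_range_succ_mk] at h
  have h2 := (mul_eq_zero.mp h.symm).resolve_left hd0
  rw [← h2]
  refine Finset.sum_congr rfl fun a _ ↦ ?_
  have hfa := congrFun (iteratedDeriv_thetaSeries hkpos (s / (2 * k)) τ.im_pos a) 0
  rw [coeff_taylorSeries, hfa, hK, PowerSeries.coeff_map, thetaMoment]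
  simp only [evalAt, Pi.evalRingHom_apply]
  push_cast
  ring

lemma sum_range_two_mul_add_one {M : Type*} [AddCommMonoid M] {g : ℕ → M}
    (k : ℕ) (h : ∀ i < k, g (2 * i + 1) = 0) :
    ∑ a ∈ Finset.range (2 * k + 1), g a = ∑ m ∈ Finset.range (k + 1), g (2 * m) := by
  induction k with
  | zero => simp
  | succ k ih =>
    rw [show 2 * (k + 1) + 1 = 2 * k + 1 + 1 + 1 by ring, Finset.sum_range_succ,
      Finset.sum_range_succ, ih fun i hi ↦ h i (by omega), h k k.lt_succ_self, add_zero,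
      Finset.sum_range_succ _ (k + 1)]
    rfl

/-- The coefficients of the monic operator of order `k` annihilating the theta functions
`∑_n (-1) ^ n q ^ (k (n + s / 2k) ^ 2)`. The rational factor turns the coefficients
`(2k) ^ (2m) / (2m)!` of the residue relation into those of a monic operator. -/
def thetaOpCoeff (k m : ℕ) : ℍ → ℂ :=
  ((2 * k).factorial * (4 * k) ^ m / ((4 * k) ^ k * (2 * m).factorial) : ℚ) •
    (kernelSeries k).coeff (2 * (k - m))

lemma isIsobaric_thetaOpCoeff (k m : ℕ) :
    IsIsobaric eisGenTwo (2 * (k - m)) (thetaOpCoeff k m) :=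
  (isIsobaricSeries_kernelSeries k _).smul _

lemma thetaOpCoeff_pred {k : ℕ} (hk : 1 ≤ k) :
    thetaOpCoeff k (k - 1) = (2 * k - 1 : ℂ) • (eisE1 1 - (k : ℂ) • eisE 1) := by
  obtain ⟨l, rfl⟩ : ∃ l, k = l + 1 := ⟨k - 1, by omega⟩
  rw [thetaOpCoeff, show 2 * (l + 1 - (l + 1 - 1)) = 2 by omega, coeff_two_kernelSeries,
    Nat.add_sub_cancel, rat_smul_eq, show 2 * (l + 1) = 2 * l + 1 + 1 by ring,
    Nat.factorial_succ, Nat.factorial_succ]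
  have h1 : ((2 * l).factorial : ℂ) ≠ 0 := by exact_mod_cast Nat.factorial_ne_zero _
  have h2 : ((l : ℂ) + 1) ≠ 0 := by exact_mod_cast l.succ_ne_zero
  have h3 : (((2 * l + 1 + 1 : ℕ) * ((2 * l + 1 : ℕ) * (2 * l).factorial : ℕ) : ℕ) *
      (4 * (l + 1 : ℕ)) ^ l / ((4 * (l + 1 : ℕ)) ^ (l + 1) * (2 * l).factorial) : ℂ) =
      (2 * l + 1) / 2 := by
    push_cast
    rw [pow_succ]
    field_simp
    ring
  ext τ
  simp only [Pi.smul_apply, Pi.sub_apply, smul_eq_mul]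
  push_cast at h3 ⊢
  rw [h3]
  ring

/-- The residue relation, read as a differential equation: by the heat equation the even moments of
the theta function are its derivatives, and the odd moments occur with coefficients of odd weight,
which vanish. -/
lemma monicOp_thetaOpCoeff_eq_zero {k : ℕ} (hk : 1 ≤ k) (s : ℕ) :
    monicOp k (thetaOpCoeff k) (thetaMoment k (s / (2 * k)) 0) = 0 := by
  have hkpos : (0 : ℝ) < k := by exact_mod_cast hk
  ext τ
  have h := sum_thetaMoment_mul_kernelSeries hk s τ
  rw [sum_range_two_mul_add_one k fun i hi ↦ by
    rw [(isIsobaricSeries_kernelSeries k _).eq_zero_of_odd ⟨k - i - 1, by omega⟩, Pi.zero_apply,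
      mul_zero]] at h
  have h4 : ((4 : ℂ) * k) ^ k ≠ 0 := pow_ne_zero _ (by
    exact mul_ne_zero (by norm_num) (by exact_mod_cast hkpos.ne'))
  have hk0 : ((2 * k).factorial : ℂ) ≠ 0 := by exact_mod_cast Nat.factorial_ne_zero _
  rw [Finset.sum_range_succ, Nat.sub_self, coeff_zero_kernelSeries] at h
  simp only [monicOp, iterate_qD_thetaMoment hkpos, Pi.add_apply, Finset.sum_apply, Pi.mul_apply,
    Pi.smul_apply, Pi.zero_apply, smul_eq_mul, thetaOpCoeff, rat_smul_eq]
  have h5 : ∀ m : ℕ, (2 * k : ℂ) ^ (2 * m) = (4 * k) ^ m * k ^ m := fun m ↦ by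
    rw [pow_mul, ← mul_pow]; congr 1; ring
  simp only [h5] at h
  have h6 := congrArg (fun x ↦ x * ((2 * k).factorial : ℂ) / (4 * k : ℂ) ^ k) h
  simp only [add_mul, Finset.sum_mul, zero_mul, zero_div, add_div, Finset.sum_div] at h6
  rw [add_comm, ← h6]
  congr 1
  · refine Finset.sum_congr rfl fun m hm ↦ ?_
    rw [Nat.mul_sub]
    push_cast
    field_simp
  · push_cast
    simp only [Pi.one_apply]
    field_simp


/-! ### Weights of the coefficients -/

lemma isIsobaric_shiftCoeff {u : ℍ → ℂ} (hu : IsIsobaric eisGenTwo 2 u) (m n : ℕ) :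
    IsIsobaric eisGenTwo (2 * (m - n)) (shiftCoeff u m n) := by
  induction m generalizing n with
  | zero =>
    cases n with
    | zero => exact .one
    | succ n => exact .zero _
  | succ m ih =>
    cases n with
    | zero =>
      exact ((ih 0).qD.congr_weight (by omega)).add ((hu.mul (ih 0)).congr_weight (by omega))
    | succ n =>
      rcases Nat.lt_or_ge m (n + 1) with h | h
      · rw [shiftCoeff, shiftCoeff_of_lt u h, qD_zero, mul_zero, add_zero, add_zero]
        exact (ih n).congr_weight (by omega)
      · exact (((ih n).congr_weight (by omega)).add ((ih (n + 1)).qD.congr_weight (by omega))).add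
          ((hu.mul (ih (n + 1))).congr_weight (by omega))

lemma isIsobaric_conjCoeff {k : ℕ} {u : ℍ → ℂ} {a : ℕ → ℍ → ℂ} (hu : IsIsobaric eisGenTwo 2 u)
    (ha : ∀ m, IsIsobaric eisGenTwo (2 * (k - m)) (a m)) (n : ℕ) :
    IsIsobaric eisGenTwo (2 * (k - n)) (conjCoeff k u a n) := by
  refine (isIsobaric_shiftCoeff hu k n).add (.sum _ fun m hm ↦ ?_)
  have hm' := Finset.mem_range.mp hm
  rcases Nat.lt_or_ge m n with h | h
  · rw [shiftCoeff_of_lt u h, mul_zero]; exact .zero _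
  · exact ((ha m).mul (isIsobaric_shiftCoeff hu m n)).congr_weight (by omega)

/-! ### The characters as theta quotients -/

/-- The theta function `∑_n (-1) ^ n q ^ (k (n + s / 2k) ^ 2)`. -/
abbrev theta (k s : ℕ) : ℍ → ℂ := thetaMoment k (s / (2 * k)) 0

lemma theta_eq_tsum {k : ℕ} (hk : 1 ≤ k) (s : ℕ) (τ : ℍ) :
    theta k s τ = nomePow ((s : ℚ) ^ 2 / (4 * k)) τ *
      ∑' n : ℤ, (-1 : ℂ) ^ n * nome τ ^ (k * n ^ 2 + (s : ℤ) * n) := by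
  have hk0 : (k : ℂ) ≠ 0 := by exact_mod_cast (by omega : k ≠ 0)
  rw [theta, thetaMoment, thetaSeries, ← tsum_mul_left]
  refine tsum_congr fun n ↦ ?_
  rw [thetaTerm, nomePow, nome, ← Complex.exp_int_mul, mul_left_comm, ← Complex.exp_add, pow_zero,
    mul_one]
  congr 2
  push_cast
  field_simp
  ring

lemma etaH_eq (τ : ℍ) :
    etaH τ = nomePow (1 / 24) τ * ∏' n : ℕ, (1 - nome τ ^ (n + 1)) := by
  rw [etaH, ModularForm.eta, nomePow, Function.Periodic.qParam]
  congr 1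
  · congr 1
    push_cast; ring
  · refine tprod_congr fun n ↦ ?_
    rw [ModularForm.eta_q_eq_pow, nome]

lemma nomePow_ne_zero (a : ℚ) (τ : ℍ) : nomePow a τ ≠ 0 := Complex.exp_ne_zero _

lemma nomePow_add (a b : ℚ) (τ : ℍ) : nomePow (a + b) τ = nomePow a τ * nomePow b τ := by
  rw [nomePow, nomePow, nomePow, ← Complex.exp_add]
  congr 1
  push_cast; ring

lemma nome_ne_zero (τ : ℍ) : nome τ ≠ 0 := Complex.exp_ne_zero _

lemma multipliable_one_add_pow {q : ℂ} (hq : ‖q‖ < 1) :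
    Multipliable fun n : ℕ ↦ 1 + q ^ (n + 1) := by
  refine multipliable_one_add_of_summable ?_
  simpa using (summable_nat_add_iff 1).mpr (summable_geometric_of_lt_one (norm_nonneg _) hq)

lemma character_eq {k : ℕ} (hk : 1 ≤ k) (j : ℕ) :
    character k (j + 1) = weberF1 / etaH * theta k j := by
  ext τ
  have hq := norm_nome_lt_one τ
  have hL := tprod_one_sub_pow_ne_zero hq
  have h1 : qPochInf (nome τ) (nome τ) = ∏' n : ℕ, (1 - nome τ ^ (n + 1)) :=
    tprod_congr fun n ↦ by rw [pow_succ']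
  have h2 : qPochInf (-nome τ) (nome τ) = ∏' n : ℕ, (1 + nome τ ^ (n + 1)) :=
    tprod_congr fun n ↦ by rw [pow_succ']; ring
  have h3 : ∏' n : ℕ, (1 - nome (double τ) ^ (n + 1)) =
      (∏' n : ℕ, (1 - nome τ ^ (n + 1))) * ∏' n : ℕ, (1 + nome τ ^ (n + 1)) := by
    rw [← (ModularForm.multipliable_one_sub_pow hq).tprod_mul (multipliable_one_add_pow hq)]
    refine tprod_congr fun n ↦ ?_
    rw [nome_double]; ring
  have h4 : nomePow (1 / 24) (double τ) = nomePow (1 / 24) τ * nomePow (1 / 24) τ := by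
    rw [nomePow, nomePow, ← Complex.exp_add, coe_double]
    congr 1; ring
  have h5 := nomePow_ne_zero (1 / 24) τ
  simp only [Pi.mul_apply, Pi.div_apply]
  rw [theta_eq_tsum hk, weberF1_eq, Pi.div_apply, doubleHom_apply, etaH_eq, etaH_eq, h3, h4,
    character, h1, h2]
  have e1 : (((j + 1 : ℕ) : ℚ) - 1) = j := by push_cast; ring
  have e2 : (((j + 1 : ℕ) : ℤ) - 1) = j := by push_cast; ring
  rw [e1, e2]
  field_simp

/-- The triple product identity with `p = q ^ k` and `ζ = q ^ j`. -/
lemma andrewsBressoud_eq {k : ℕ} (hk : 1 ≤ k) (j : ℕ) :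
    andrewsBressoud k (j + 1) = theta k j / etaH := by
  ext τ
  have hk0 : (k : ℚ) ≠ 0 := by exact_mod_cast (by omega : k ≠ 0)
  have hq := norm_nome_lt_one τ
  have hq0 := nome_ne_zero τ
  have hL := tprod_one_sub_pow_ne_zero hq
  set q := nome τ with hqdef
  set p := q ^ k with hp
  set ζ := q ^ j with hζ
  have hp1 : ‖p‖ < 1 := by
    rw [hp, norm_pow]; exact pow_lt_one₀ (norm_nonneg _) hq (by omega)
  have hp0 : p ≠ 0 := pow_ne_zero _ hq0
  have hζ0 : ζ ≠ 0 := pow_ne_zero _ hq0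
  have hp2 : ‖p ^ 2‖ < 1 := by
    rw [norm_pow]; exact pow_lt_one₀ (norm_nonneg _) hp1 two_ne_zero
  have hjtp := tripleProduct hp0 hp1 hζ0
  have hsum : ∑' n : ℤ, (-1 : ℂ) ^ n * p ^ (n ^ 2) * ζ ^ n =
      ∑' n : ℤ, (-1 : ℂ) ^ n * q ^ (k * n ^ 2 + (j : ℤ) * n) := by
    refine tsum_congr fun n ↦ ?_
    rw [zpow_add₀ hq0, zpow_mul, zpow_mul, zpow_natCast, zpow_natCast, ← mul_assoc]
  have hmulA := (ModularForm.multipliable_one_sub_pow hp2).mul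
    ((multipliable_one_sub_pow_mul hp1 ζ 1).mul (multipliable_one_sub_pow_mul hp1 ζ⁻¹ 1))
  rw [← (multipliable_one_sub_pow_mul hp1 ζ 1).tprod_mul (multipliable_one_sub_pow_mul hp1 ζ⁻¹ 1),
    ← (ModularForm.multipliable_one_sub_pow hp2).tprod_mul
      ((multipliable_one_sub_pow_mul hp1 ζ 1).mul (multipliable_one_sub_pow_mul hp1 ζ⁻¹ 1)),
    hsum] at hjtp
  have hinv : HasProd (fun n : ℕ ↦ (1 - q ^ (n + 1))⁻¹) (∏' n : ℕ, (1 - q ^ (n + 1)))⁻¹ :=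
    (ModularForm.multipliable_one_sub_pow hq).hasProd.inv₀ hL
  have hterm : ∀ n : ℕ, (let m : ℤ := n + 1
      (1 - q ^ (2 * k * m)) * (1 - q ^ (2 * k * m - k - (j + 1 : ℕ) + 1)) *
      (1 - q ^ (2 * k * m - k + (j + 1 : ℕ) - 1)) / (1 - q ^ m)) =
      ((1 - (p ^ 2) ^ (n + 1)) * ((1 - p ^ (2 * n + 1) * ζ) * (1 - p ^ (2 * n + 1) * ζ⁻¹))) *
        (1 - q ^ (n + 1))⁻¹ := fun n ↦ by
    have e1 : q ^ (2 * k * ((n : ℤ) + 1)) = (p ^ 2) ^ (n + 1) := by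
      rw [hp, ← pow_mul, ← pow_mul, ← zpow_natCast]
      congr 1; push_cast; ring
    have e2 : q ^ (2 * k * ((n : ℤ) + 1) - k - (j + 1 : ℕ) + 1) = p ^ (2 * n + 1) * ζ⁻¹ := by
      rw [hp, hζ, ← pow_mul, ← zpow_natCast, ← zpow_natCast, ← zpow_neg, ← zpow_add₀ hq0]
      congr 1; push_cast; ring
    have e3 : q ^ (2 * k * ((n : ℤ) + 1) - k + (j + 1 : ℕ) - 1) = p ^ (2 * n + 1) * ζ := by
      rw [hp, hζ, ← pow_mul, ← zpow_natCast, ← zpow_natCast, ← zpow_add₀ hq0]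
      congr 1; push_cast; ring
    have e4 : q ^ ((n : ℤ) + 1) = q ^ (n + 1) := by exact_mod_cast zpow_natCast q (n + 1)
    simp only [e1, e2, e3, e4]
    rw [div_eq_mul_inv]; ring
  rw [andrewsBressoud, tprod_congr hterm, hmulA.tprod_mul hinv.multipliable, hjtp,
    hinv.tprod_eq, Pi.div_apply,
    theta_eq_tsum hk, etaH_eq, ← hqdef]
  have he : leadingExponent k (j + 1) + 1 / 24 = (j : ℚ) ^ 2 / (4 * k) := by
    rw [leadingExponent]; push_cast; field_simp; ring
  rw [← he, nomePow_add]
  have h5 := nomePow_ne_zero (1 / 24) τ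
  field_simp

/-! ### Linear independence of the theta functions -/

/-- The point `i (m + 1)` of the upper half-plane. -/
def imaginaryPoint (m : ℕ) : ℍ := ⟨((m : ℂ) + 1) * Complex.I, by
  simpa using (by positivity : (0 : ℝ) < m + 1)⟩

/-- For `0 ≤ s < k` the smallest of the numbers `(2 k n + s) ^ 2` is `s ^ 2`, attained only at
`n = 0`. -/
lemma sq_lt_sq_of_exponent {k s s₀ : ℕ} (h0 : s₀ ≤ s) (h1 : s < k) {n : ℤ}
    (h : ¬ (n = 0 ∧ s = s₀)) : ((s₀ : ℤ)) ^ 2 < (2 * k * n + s) ^ 2 := by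
  rw [sq_lt_sq, Nat.abs_cast]
  rcases lt_trichotomy n 0 with hn | rfl | hn
  · rw [lt_abs]; right; nlinarith
  · rw [lt_abs]; left; simp at h; omega
  · rw [lt_abs]; left; nlinarith

/-- The theta function indexed by `s` has leading exponent `s ^ 2 / 4k` at the cusp. -/
lemma tendsto_theta {k s s₀ : ℕ} (h0 : s₀ ≤ s) (h1 : s < k) :
    Filter.Tendsto (fun m : ℕ ↦ Complex.exp (2 * Real.pi * (m + 1) * (s₀ ^ 2 / (4 * k))) *
      theta k s (imaginaryPoint m)) Filter.atTop (nhds (if s = s₀ then 1 else 0)) := by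
  have hk0 : (k : ℂ) ≠ 0 := by exact_mod_cast (by omega : k ≠ 0)
  have hkpos : (0 : ℝ) < k := by exact_mod_cast (by omega : 0 < k)
  -- the exponents, after division by the leading term
  set e : ℤ → ℝ := fun n ↦
    2 * Real.pi * ((((2 * k * n + s) ^ 2 - s₀ ^ 2 : ℤ) : ℝ) / (4 * k)) with he
  have hterm : ∀ (m : ℕ) (n : ℤ), Complex.exp (2 * Real.pi * (m + 1) * (s₀ ^ 2 / (4 * k))) *
      thetaTerm k (s / (2 * k)) 0 0 (imaginaryPoint m) n =
      (-1) ^ n * Complex.exp ((-(e n * (m + 1)) : ℝ)) := fun m n ↦ by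
    rw [thetaTerm, pow_zero, mul_one, mul_left_comm, ← Complex.exp_add]
    congr 2
    have hI : (imaginaryPoint m : ℂ) = (m + 1) * Complex.I := rfl
    rw [hI]
    simp only [he]
    push_cast
    field_simp
    ring_nf
    rw [Complex.I_sq]
    ring
  have he0 : ∀ n, 0 ≤ e n := fun n ↦ by
    have : 0 ≤ (2 * k * n + s) ^ 2 - (s₀ : ℤ) ^ 2 := by
      by_cases h : n = 0 ∧ s = s₀
      · rw [h.1, h.2]; simp
      · exact sub_nonneg.mpr (sq_lt_sq_of_exponent h0 h1 h).le
    have : (0 : ℝ) ≤ (((2 * k * n + s) ^ 2 - s₀ ^ 2 : ℤ) : ℝ) := by exact_mod_cast this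
    have := Real.pi_pos
    positivity
  have hnorm : ∀ (m : ℕ) (n : ℤ), ‖(-1 : ℂ) ^ n * Complex.exp ((-(e n * (m + 1)) : ℝ))‖ =
      Real.exp (-(e n * (m + 1))) := fun m n ↦ by
    rw [norm_mul, norm_zpow, norm_neg, norm_one, one_zpow, one_mul, Complex.norm_exp,
      Complex.ofReal_re]
  have hlim : (if s = s₀ then (1 : ℂ) else 0) =
      ∑' n : ℤ, if n = 0 ∧ s = s₀ then (1 : ℂ) else 0 := by
    by_cases h : s = s₀
    · simp [h]
    · simp [h]
  simp only [theta, thetaMoment, thetaSeries, ← tsum_mul_left, hterm]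
  rw [hlim]
  refine tendsto_tsum_of_dominated_convergence (bound := fun n ↦ Real.exp (-(e n * (0 + 1)))) ?_
    (fun n ↦ ?_) (Filter.Eventually.of_forall fun m n ↦ ?_)
  -- the dominating series is the series at the point `i`
  · have h := ((summable_norm_thetaTerm hkpos (s / (2 * k)) 0 0
      (imaginaryPoint 0).im_pos).mul_left
      ‖Complex.exp (2 * Real.pi * ((0 : ℕ) + 1) * (s₀ ^ 2 / (4 * k)))‖)
    simp only [← norm_mul] at h
    refine h.congr fun n ↦ ?_
    have h2 := hterm 0 n
    rw [h2, hnorm]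
    simp
  · by_cases h : n = 0 ∧ s = s₀
    · rw [if_pos h]
      have : e 0 = 0 := by simp [he, h.2]
      simp [this, h.1]
    · rw [if_neg h, tendsto_zero_iff_norm_tendsto_zero]
      simp only [hnorm]
      have hpos : 0 < e n := by
        have h2 := sub_pos.mpr (sq_lt_sq_of_exponent h0 h1 h)
        have h3 : (0 : ℝ) < (((2 * k * n + s) ^ 2 - s₀ ^ 2 : ℤ) : ℝ) := by exact_mod_cast h2
        have := Real.pi_pos
        positivity
      refine Real.tendsto_exp_neg_atTop_nhds_zero.comp ?_
      exact (Filter.tendsto_atTop_add_const_right _ _ tendsto_natCast_atTop_atTop).const_mul_atTop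
        hpos
  · rw [hnorm, Real.exp_le_exp, neg_le_neg_iff]
    exact mul_le_mul_of_nonneg_left (by simp) (he0 n)

/-- The leading exponents `s ^ 2 / 4k` are distinct, so the coefficients of a linear relation vanish
one after the other. -/
lemma linearIndependent_theta (k : ℕ) :
    LinearIndependent ℂ fun j : Fin k ↦ theta k j := by
  rw [Fintype.linearIndependent_iff]
  intro c hc i
  induction hn : (i : ℕ) using Nat.strong_induction_on generalizing i with
  | _ n ih =>
    have hlim : Filter.Tendsto (fun m : ℕ ↦ ∑ j : Fin k, c j *
        (Complex.exp (2 * Real.pi * (m + 1) * (n ^ 2 / (4 * k))) *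
          theta k j (imaginaryPoint m))) Filter.atTop
        (nhds (∑ j : Fin k, c j * if (j : ℕ) = n then 1 else 0)) := by
      refine tendsto_finsetSum _ fun j _ ↦ ?_
      rcases Nat.lt_or_ge j n with h | h
      · rw [ih j h j rfl]
        simp
      · exact (tendsto_theta h j.2).const_mul (c j)
    have hzero : ∀ m : ℕ, ∑ j : Fin k, c j *
        (Complex.exp (2 * Real.pi * (m + 1) * (n ^ 2 / (4 * k))) *
          theta k j (imaginaryPoint m)) = 0 := fun m ↦ by
      have h := congrFun hc (imaginaryPoint m)
      rw [Finset.sum_apply] at h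
      simp only [Pi.smul_apply, smul_eq_mul, Pi.zero_apply] at h
      simp only [mul_left_comm (c _)]
      rw [← Finset.mul_sum, h, mul_zero]
    simp only [hzero] at hlim
    have h := tendsto_nhds_unique hlim tendsto_const_nhds
    rw [Finset.sum_eq_single i (fun j _ hj ↦ ?_) (by simp), if_pos hn, mul_one] at h
    · exact h
    · rw [if_neg fun h' ↦ hj (Fin.ext (h'.trans hn.symm)), mul_zero]

lemma linearIndependent_mul {ι : Type*} {b : ι → ℍ → ℂ} (hb : LinearIndependent ℂ b) {M : ℍ → ℂ}
    (hM : ∀ τ, M τ ≠ 0) : LinearIndependent ℂ fun i ↦ M * b i := by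
  refine hb.map' (LinearMap.mulLeft ℂ M) (LinearMap.ker_eq_bot.mpr fun f g h ↦ ?_)
  ext τ
  exact mul_left_cancel₀ (hM τ) (congrFun h τ)

end AndrewsBressoud

open AndrewsBressoud in
theorem proposition2p2 (k : ℕ) (hk : 2 ≤ k) :
    ∃ F P : ℕ → ℍ → ℂ,
      -- the differential equation of the characters
      (∀ n < k, F n ∈ eisRing) ∧
      F (k - 1) = -((2 * k * (k - 1) : ℂ) • eisE 1 + (1 - k : ℂ) • eisE1 1) ∧
      IsFundamentalSystem k F (fun j : Fin k => character k (j + 1)) ∧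
      -- the substitution turns it into the equation with coefficients `P`
      (∀ y : ℍ → ℂ, MDifferentiable 𝓘(ℂ) 𝓘(ℂ) y →
        monicOp k P (y / weberF1) = monicOp k F y / weberF1) ∧
      P (k - 1) = -((2 * k * (k - 1) : ℂ) • eisE 1 + (1 - 2 * k : ℂ) • eisE1 1) ∧
      (∀ n < k, IsQuasiModularForm (CongruenceSubgroup.Gamma0 2) (2 * ((k : ℤ) - n)) (P n)) ∧
      IsFundamentalSystem k P (fun j : Fin k => andrewsBressoud k (j + 1)) := by
  have hk1 : 1 ≤ k := by omega
  have hkpos : (0 : ℝ) < k := by exact_mod_cast hk1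
  -- both operators are conjugates of the one annihilating the theta functions, by `η` for the
  -- series `B_{k,j} = θ_j / η` and by `η / 𝔣₁` for the characters `𝔣₁ θ_j / η`
  have hE : IsIsobaric eisGenTwo 2 (eisE 1) := .of ⟨1, le_rfl, rfl, Or.inl rfl⟩
  have hE1 : IsIsobaric eisGenTwo 2 (eisE1 1) := .of ⟨1, le_rfl, rfl, Or.inr rfl⟩
  have hP := isIsobaric_conjCoeff hE (isIsobaric_thetaOpCoeff k)
  have hF := isIsobaric_conjCoeff (hE.sub hE1) (isIsobaric_thetaOpCoeff k)
  have hη := mdifferentiable_etaH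
  have hM : MDifferentiable 𝓘(ℂ) 𝓘(ℂ) (etaH / weberF1) :=
    mdifferentiable_div hη mdifferentiable_weberF1 weberF1_ne_zero
  have hMD : qD (etaH / weberF1) = (eisE 1 - eisE1 1) * (etaH / weberF1) :=
    qD_div_of_logDeriv hη mdifferentiable_weberF1 weberF1_ne_zero qD_etaH qD_weberF1
  have hθ : ∀ j, MDifferentiable 𝓘(ℂ) 𝓘(ℂ) (theta k j) := fun j ↦
    mdifferentiable_thetaMoment hkpos _ _
  have hM0 : ∀ τ, (etaH / weberF1) τ ≠ 0 := fun τ ↦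
    div_ne_zero (etaH_ne_zero τ) (weberF1_ne_zero τ)
  have hconjP : ∀ y, MDifferentiable 𝓘(ℂ) 𝓘(ℂ) y →
      etaH * monicOp k (conjCoeff k (eisE 1) (thetaOpCoeff k)) y =
        monicOp k (thetaOpCoeff k) (etaH * y) := fun y hy ↦
    mul_monicOp_conjCoeff _ hη hE.mdifferentiable qD_etaH hy
  have hconjF : ∀ y, MDifferentiable 𝓘(ℂ) 𝓘(ℂ) y →
      etaH / weberF1 * monicOp k (conjCoeff k (eisE 1 - eisE1 1) (thetaOpCoeff k)) y =
        monicOp k (thetaOpCoeff k) (etaH / weberF1 * y) := fun y hy ↦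
    mul_monicOp_conjCoeff _ hM (hE.sub hE1).mdifferentiable hMD hy
  have hli := linearIndependent_theta k
  refine ⟨conjCoeff k (eisE 1 - eisE1 1) (thetaOpCoeff k),
    conjCoeff k (eisE 1) (thetaOpCoeff k), fun n _ ↦ (hF n).mem_eisRing, ?_, ?_, fun y hy ↦ ?_,
    ?_, fun n hn ↦ ?_, ?_⟩
  · rw [conjCoeff_pred hk1, thetaOpCoeff_pred hk1]
    module
  · have hch : (fun j : Fin k ↦ character k (j + 1)) =
        fun j : Fin k ↦ weberF1 / etaH * theta k j := funext fun j ↦ character_eq hk1 j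
    rw [hch]
    have hM' : MDifferentiable 𝓘(ℂ) 𝓘(ℂ) (weberF1 / etaH) :=
      mdifferentiable_div mdifferentiable_weberF1 hη etaH_ne_zero
    refine isFundamentalSystem_of_linearIndependent (fun n _ ↦ (hF n).mdifferentiable)
      (fun j ↦ hM'.mul (hθ j)) (fun j ↦ ?_)
      (linearIndependent_mul hli fun τ ↦ div_ne_zero (weberF1_ne_zero τ) (etaH_ne_zero τ))
    have h := hconjF _ (hM'.mul (hθ j))
    have h1 : etaH / weberF1 * (weberF1 / etaH * theta k j) = theta k j := by
      ext τ
      have h2 := etaH_ne_zero τ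
      have h3 := weberF1_ne_zero τ
      simp only [Pi.mul_apply, Pi.div_apply]
      field_simp
    rw [h1, monicOp_thetaOpCoeff_eq_zero hk1] at h
    ext τ
    exact (mul_eq_zero.mp (congrFun h τ)).resolve_left (hM0 τ)
  · have hyw := mdifferentiable_div hy mdifferentiable_weberF1 weberF1_ne_zero
    have h1 := hconjP _ hyw
    have h2 := hconjF y hy
    have h3 : etaH * (y / weberF1) = etaH / weberF1 * y := by
      ext τ
      simp only [Pi.mul_apply, Pi.div_apply]
      ring
    rw [h3, ← h2] at h1
    ext τ
    have h4 := congrFun h1 τ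
    refine mul_left_cancel₀ (etaH_ne_zero τ) ?_
    simp only [Pi.mul_apply, Pi.div_apply] at h4 ⊢
    rw [h4]
    ring
  · rw [conjCoeff_pred hk1, thetaOpCoeff_pred hk1]
    module
  · have h := (hP n).hasQuasiModularPolynomial.isQuasiModularForm
    rw [Nat.cast_mul, Nat.cast_sub hn.le] at h
    exact h
  · have hB : (fun j : Fin k ↦ andrewsBressoud k (j + 1)) =
        fun j : Fin k ↦ etaH⁻¹ * theta k j := funext fun j ↦ by
      rw [andrewsBressoud_eq hk1, div_eq_inv_mul]
    have hη' : MDifferentiable 𝓘(ℂ) 𝓘(ℂ) etaH⁻¹ := by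
      have := mdifferentiable_div mdifferentiable_one hη etaH_ne_zero
      rwa [one_div] at this
    rw [hB]
    refine isFundamentalSystem_of_linearIndependent (fun n _ ↦ (hP n).mdifferentiable)
      (fun j ↦ hη'.mul (hθ j)) (fun j ↦ ?_)
      (linearIndependent_mul hli fun τ ↦ inv_ne_zero (etaH_ne_zero τ))
    have h := hconjP _ (hη'.mul (hθ j))
    have h1 : etaH * (etaH⁻¹ * theta k j) = theta k j := by
      ext τ
      exact mul_inv_cancel_left₀ (etaH_ne_zero τ) _
    rw [h1, monicOp_thetaOpCoeff_eq_zero hk1] at h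
    ext τ
    exact (mul_eq_zero.mp (congrFun h τ)).resolve_left (etaH_ne_zero τ)

end
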